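/- **Setting.** Let $\Sigma$ be the four-punctured sphere, with $\pi_1\Sigma=\langle c_1,c_2,c_3,c_4 \mid c_1c_2c_3c_4=1\rangle$ ($c_i$ peripheral), and put $b=(c_1c_2)^{-1}$. The pure mapping class group $\mathrm{PMod}(\Sigma)$ is the group of outer automorphisms of $\pi_1\Sigma$ that preserve the conjugacy class of each $c_i$; it acts on conjugacy classes of representations $\rho:\pi_1\Sigma\to \mathrm{PSL}_2\mathbb R$ by precomposition with the inverse. For $\alpha\in(0,2\pi)^4$ with $\sum_i\alpha_i>6\pi$, the Deroin–Tholozan (DT) component $\mathrm{Rep}^{DT}_\alpha$ is the set of conjugacy classes $[\rho]$ such that each $\rho(c_i)$ is an anti-clockwise rotation of angle $\alpha_i$ of the hyperbolic plane and such that the relative Euler class of $\rho$ is $3$: the lifts of the $\rho(c_i)$ to $\widetilde{\mathrm{PSL}}_2\mathbb R$ with rotation angle in $(0,2\pi)$ satisfy $\tilde c_1\tilde c_2\tilde c_3\tilde c_4=z^3$, where $z$ is the rotation of angle $2\pi$. For $[\rho]\in \mathrm{Rep}^{DT}_\alpha$ let $C_i$ be the fixed point of $\rho(c_i)$, and let $B$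 and $\beta\in(0,2\pi)$ be the centre and the angle of the anti-clockwise rotation $\rho(b)$. The triangle chain of $[\rho]$ consists of the triangles $(C_1,C_2,B)$ and $(B,C_3,C_4)$. It is singular if one of them is reduced to a point. If it is not, let $\gamma\in\mathbb R/2\pi\mathbb Z$ be the anti-clockwise angle at $B$ from the ray $BC_3$ to the ray $BC_2$; $(\beta,\gamma)$ are the action-angle coordinates of $[\rho]$. There are exactly two points with a singular chain: the north pole, which has $\beta=\alpha_3+\alpha_4-2\pi$, and the south pole, which has $\beta=4\pi-\alpha_1-\alpha_2$. For real numbers $p,q,r>1$ with $\frac1p+\frac1q+\frac1r<1$, a rotation triangle group $D(p,q,r)\subset\mathrm{PSL}_2\mathbb R$ is a group generated by the rotations of angles $2\pi/p,2\pi/q,2\pi/r$ about the vertices of a hyperbolic triangle with respective interior angles $\pi/p,\pi/q,\pi/r$ (it is unique up to conjugation). **Statement.** Let $\theta_1,\theta_2\in(0,2\pi)$ with $\theta_1+\theta_2>3\pi$, and let $\alpha$ be one of the orderings below of $\{\theta_1,\theta_1,\theta_2,\theta_2\}$. By an orbit of Type II in $\mathrm{Rep}^{DT}_\alpha$ we mean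 a $\mathrm{PMod}(\Sigma)$-orbit of length $2$ contained in $\mathrm{Rep}^{DT}_\alpha$. 1. $\mathrm{Rep}^{DT}_\alpha$ contains an orbit of Type II whose two points are as follows. - If $\alpha=(\theta_1,\theta_1,\theta_2,\theta_2)$: the south pole, with $\beta=4\pi-2\theta_1$, and the north pole, with $\beta=2\theta_2-2\pi$. - If $\alpha=(\theta_1,\theta_2,\theta_1,\theta_2)$: the points with action-angle coordinates $(\pi,\frac{\pi}{2})$ and $(\pi,\frac{3\pi}{2})$. - If $\alpha=(\theta_1,\theta_2,\theta_2,\theta_1)$: the points with action-angle coordinates $(\pi,0)$ and $(\pi,\pi)$. 2. If $\theta_1\neq\theta_2$, this is the unique orbit of length $2$ in $\mathrm{Rep}^{DT}_\alpha$. 3. If $\theta_1=\theta_2$, then $\mathrm{Rep}^{DT}_\alpha$ contains all three orbits listed in (1); they are distinct, and they are exactly the orbits of Type II in $\mathrm{Rep}^{DT}_\alpha$. 4. The image of any representation whose conjugacy class belongs to an orbit of Type II in $\mathrm{Rep}^{DT}_\alpha$ is a rotation triangle group $D(2,\overline\theta_1,\overline\theta_2)$, where $\overline\theta_i=\left(1-\frac{\theta_i}{2\pi}\right)^{-1}$.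 -/

import Mathlib

open scoped Real UpperHalfPlane MatrixGroups

noncomputable section

namespace TypeII

/-! ### The four-punctured sphere, its pure mapping class group and its character variety -/

/-- The fundamental group of the four-punctured sphere, in a geometric presentation: four
peripheral generators `c₁, c₂, c₃, c₄` (indexed here by `0, 1, 2, 3`) with `c₁ c₂ c₃ c₄ = 1`. -/
abbrev SphereGroup : Type :=
  PresentedGroup ({FreeGroup.of 0 * FreeGroup.of 1 * FreeGroup.of 2 * FreeGroup.of 3} :
    Set (FreeGroup (Fin 4)))

/-- The peripheral generators. -/
def c (i : Fin 4) : SphereGroup := PresentedGroup.of i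

/-- The element `b = (c₁ c₂)⁻¹`; it defines the standard pants decomposition. -/
def b : SphereGroup := (c 0 * c 1)⁻¹

/-- Automorphisms of the fundamental group that map every peripheral generator to a conjugate
of itself. -/
def pureAut : Subgroup (MulAut SphereGroup) where
  carrier := {φ | ∀ i, IsConj (c i) (φ (c i))}
  one_mem' := fun _ => IsConj.refl _
  mul_mem' := by
    intro φ ψ hφ hψ i
    exact (hφ i).trans (φ.toMonoidHom.map_isConj (hψ i))
  inv_mem' := by
    intro φ hφ i
    have h := (φ⁻¹).toMonoidHom.map_isConj (hφ i)
    have h2 : (φ⁻¹) (φ (c i)) = c i := φ.symm_apply_apply (c i)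
    have h3 : IsConj ((φ⁻¹) (c i)) ((φ⁻¹) (φ (c i))) := h
    rw [h2] at h3
    exact h3.symm

/-- Inner automorphisms, as a subgroup of `pureAut`. -/
def innerAut : Subgroup pureAut := (MulAut.conj (G := SphereGroup)).range.subgroupOf pureAut

instance innerAut_normal : innerAut.Normal where
  conj_mem := by
    rintro ⟨_, hφ⟩ ⟨g, rfl⟩ ⟨ψ, hψ⟩
    refine ⟨ψ g, ?_⟩
    ext x
    simp [MulAut.conj_apply]

/-- The pure mapping class group of the four-punctured sphere, through its action on the
fundamental group (Dehn--Nielsen--Baer): outer automorphisms that preserve the conjugacy class of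
each peripheral generator. -/
abbrev PMod : Type := pureAut ⧸ innerAut

/-- Representations of the fundamental group into `PSL(2, ℝ)`. -/
abbrev Representation : Type := SphereGroup →* PSL(2, ℝ)

/-- Two representations are conjugate if they differ by conjugation inside `PSL(2, ℝ)`. -/
instance conjSetoid : Setoid Representation where
  r ρ σ := ∃ g : PSL(2, ℝ), ∀ x, σ x = g * ρ x * g⁻¹
  iseqv :=
    { refl := fun ρ => ⟨1, by simp⟩
      symm := by
        rintro ρ σ ⟨g, hg⟩
        exact ⟨g⁻¹, fun x => by rw [hg x]; group⟩
      trans := by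
        rintro ρ σ τ ⟨g, hg⟩ ⟨h, hh⟩
        exact ⟨h * g, fun x => by rw [hh x, hg x]; group⟩ }

/-- Conjugacy classes of representations. -/
abbrev Rep : Type := Quotient conjSetoid

/-- Automorphisms act on conjugacy classes of representations by `φ • [ρ] = [ρ ∘ φ⁻¹]`. -/
instance pureAutAction : MulAction pureAut Rep where
  smul φ := Quotient.map
    (fun ρ : Representation => ρ.comp ((φ : MulAut SphereGroup)⁻¹ : MulAut SphereGroup).toMonoidHom)
    (by
      rintro ρ σ ⟨g, hg⟩
      exact ⟨g, fun x => hg _⟩)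
  one_smul := by
    rintro ⟨ρ⟩
    rfl
  mul_smul := by
    rintro ⟨φ, hφ⟩ ⟨ψ, hψ⟩ ⟨ρ⟩
    rfl

theorem innerAut_le_ker :
    innerAut ≤ (MulAction.toPermHom pureAut Rep).ker := by
  rintro ⟨_, hφ⟩ ⟨g, rfl⟩
  rw [MonoidHom.mem_ker]
  ext x
  obtain ⟨ρ⟩ := x
  refine Quotient.sound ⟨ρ g, fun x => ?_⟩
  have hx : (MulAut.conj g)⁻¹ x = g⁻¹ * x * g := by
    rw [← map_inv, MulAut.conj_apply, inv_inv]
  change ρ x = ρ g * ρ ((MulAut.conj g)⁻¹ x) * (ρ g)⁻¹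
  rw [hx, map_mul, map_mul, map_inv]
  group

/-- The action of the pure mapping class group on conjugacy classes of representations. -/
instance pmodAction : MulAction PMod Rep :=
  MulAction.compHom Rep
    (QuotientGroup.lift innerAut (MulAction.toPermHom pureAut Rep) innerAut_le_ker)

/-! ### Rotations of the hyperbolic plane -/

/-- The anti-clockwise rotation of angle `ϑ` about `i` in the upper half-plane. -/
def rot (ϑ : ℝ) : SL(2, ℝ) :=
  ⟨!![Real.cos (ϑ / 2), Real.sin (ϑ / 2); -Real.sin (ϑ / 2), Real.cos (ϑ / 2)], by
    rw [Matrix.det_fin_two_of]; nlinarith [Real.sin_sq_add_cos_sq (ϑ / 2)]⟩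

/-- `g` is the anti-clockwise rotation of angle `ϑ` about the point `p`. -/
def IsRotationAbout (g : PSL(2, ℝ)) (p : ℍ) (ϑ : ℝ) : Prop :=
  ∃ h : SL(2, ℝ), h • UpperHalfPlane.I = p ∧ g = ((h * rot ϑ * h⁻¹ : SL(2, ℝ)) : PSL(2, ℝ))

/-- The position of `X` in the Poincaré disc model centred at `B`. Geodesic rays from `B` become
Euclidean rays from `0`, and oriented angles at `B` are preserved. -/
def disc (B X : ℍ) : ℂ := ((X : ℂ) - (B : ℂ)) / ((X : ℂ) - (starRingEnd ℂ) (B : ℂ))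

/-- The oriented angle at `B`, measured anti-clockwise, from the geodesic ray `BX` to the
geodesic ray `BY` (for `X ≠ B` and `Y ≠ B`). -/
def orientedAngle (X B Y : ℍ) : Real.Angle := (Complex.arg (disc B Y / disc B X) : Real.Angle)

/-- The unoriented interior angle at `B` between the geodesic segments `BX` and `BY`
(for `X ≠ B` and `Y ≠ B`). -/
def interiorAngle (X B Y : ℍ) : ℝ := InnerProductGeometry.angle (disc B X) (disc B Y)

/-- `H` is a rotation triangle group `D(p, q, r)`: it is generated by the rotations of angles
`2π/p`, `2π/q`, `2π/r` about the vertices of a hyperbolic triangle with respective interior angles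
`π/p`, `π/q`, `π/r`. The numbers `p, q, r` are real. -/
def IsRotationTriangleGroup (p q r : ℝ) (H : Subgroup PSL(2, ℝ)) : Prop :=
  ∃ P Q R : ℍ, P ≠ Q ∧ Q ≠ R ∧ R ≠ P ∧
    interiorAngle Q P R = π / p ∧ interiorAngle R Q P = π / q ∧ interiorAngle P R Q = π / r ∧
    ∃ x y z : PSL(2, ℝ), IsRotationAbout x P (2 * π / p) ∧ IsRotationAbout y Q (2 * π / q) ∧
      IsRotationAbout z R (2 * π / r) ∧ H = Subgroup.closure {x, y, z}

/-! ### The Deroin--Tholozan component -/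

/-- `f` lifts the action of `g` on the boundary circle of the hyperbolic plane to the universal
cover `ℝ`. The boundary is parametrized by `x ↦ [cos (π x) : -sin (π x)]`, a parametrization by
`ℝ / ℤ` compatible with the anti-clockwise orientation (`rot ϑ` is `x ↦ x + ϑ / (2π)`). -/
def IsCircleLift (g : PSL(2, ℝ)) (f : CircleDeg1Lift) : Prop :=
  ∃ A : SL(2, ℝ), (A : PSL(2, ℝ)) = g ∧ ∀ x : ℝ, ∃ r : ℝ,
    (A : Matrix (Fin 2) (Fin 2) ℝ).mulVec ![Real.cos (π * x), -Real.sin (π * x)] =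
      r • ![Real.cos (π * f x), -Real.sin (π * f x)]

/-- The relative Euler class of `ρ` is `k`: the lifts of the elliptic elements `ρ(cᵢ)` to the
universal cover of `PSL(2, ℝ)` with rotation angle in `(0, 2π)` multiply to the `k`-th power of the
positive generator of the centre (the rotation of angle `2π`, that is `x ↦ x + 1`). -/
def HasEulerClass (ρ : Representation) (k : ℤ) : Prop :=
  ∃ f : Fin 4 → CircleDeg1Lift,
    (∀ i, IsCircleLift (ρ (c i)) (f i) ∧ ∀ x : ℝ, x < f i x ∧ f i x < x + 1) ∧
    ∀ x : ℝ, (f 0 * f 1 * f 2 * f 3) x = x + k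

/-- The relative character variety: classes of representations mapping `cᵢ` to a rotation of
angle `αᵢ`. -/
def RelRep (α : Fin 4 → ℝ) : Set Rep :=
  {x | ∃ ρ : Representation, ⟦ρ⟧ = x ∧ ∀ i, ∃ p : ℍ, IsRotationAbout (ρ (c i)) p (α i)}

/-- The Deroin--Tholozan component of the relative character variety, for angles `αᵢ ∈ (0, 2π)`
with `∑ αᵢ > 6π`: it consists of the supra-maximal representations, those with relative Euler
class `3` (equivalently of volume `-(∑ αᵢ - 6π)`). -/
def DT (α : Fin 4 → ℝ) : Set Rep :=
  {x | x ∈ RelRep α ∧ ∃ ρ : Representation, ⟦ρ⟧ = x ∧ HasEulerClass ρ 3}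

/-! ### Triangle chains and action-angle coordinates -/

/-- `C₁, C₂, C₃, C₄` and `B` are the vertices of the triangle chain of `ρ` for the pants
decomposition given by `b`, and `β ∈ (0, 2π)` is the angle of the rotation `ρ(b)`. The chain
consists of the triangles `(C₁, C₂, B)` and `(B, C₃, C₄)`. -/
def IsChain (α : Fin 4 → ℝ) (ρ : Representation) (C : Fin 4 → ℍ) (B : ℍ) (β : ℝ) : Prop :=
  (∀ i, IsRotationAbout (ρ (c i)) (C i) (α i)) ∧ 0 < β ∧ β < 2 * π ∧ IsRotationAbout (ρ b) B β

/-- One of the two triangles of the chain is reduced to a point. -/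
def IsSingularChain (C : Fin 4 → ℍ) (B : ℍ) : Prop :=
  (C 0 = B ∧ C 1 = B) ∨ (C 2 = B ∧ C 3 = B)

/-- Each of the two triangles of the chain has distinct vertices. -/
def IsRegularChain (C : Fin 4 → ℍ) (B : ℍ) : Prop :=
  (C 0 ≠ C 1 ∧ C 1 ≠ B ∧ B ≠ C 0) ∧ (B ≠ C 2 ∧ C 2 ≠ C 3 ∧ C 3 ≠ B)

/-- The action coordinate of `x` is `β`. -/
def HasAction (α : Fin 4 → ℝ) (x : Rep) (β : ℝ) : Prop :=
  ∃ (ρ : Representation) (C : Fin 4 → ℍ) (B : ℍ), ⟦ρ⟧ = x ∧ IsChain α ρ C B β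

/-- The triangle chain of `x` is regular and its action-angle coordinates are `(β, γ)`, where `γ`
is the angle from the ray `BC₃` anti-clockwise to the ray `BC₂`. -/
def HasActionAngle (α : Fin 4 → ℝ) (x : Rep) (β : ℝ) (γ : Real.Angle) : Prop :=
  ∃ (ρ : Representation) (C : Fin 4 → ℍ) (B : ℍ), ⟦ρ⟧ = x ∧ IsChain α ρ C B β ∧
    IsRegularChain C B ∧ orientedAngle (C 2) B (C 1) = γ

/-- The north pole: the point with singular chain and `β = α₃ + α₄ - 2π`. -/
def IsNorthPole (α : Fin 4 → ℝ) (x : Rep) : Prop :=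
  ∃ (ρ : Representation) (C : Fin 4 → ℍ) (B : ℍ), ⟦ρ⟧ = x ∧
    IsChain α ρ C B (α 2 + α 3 - 2 * π) ∧ IsSingularChain C B

/-- The south pole: the point with singular chain and `β = 4π - α₁ - α₂`. -/
def IsSouthPole (α : Fin 4 → ℝ) (x : Rep) : Prop :=
  ∃ (ρ : Representation) (C : Fin 4 → ℍ) (B : ℍ), ⟦ρ⟧ = x ∧
    IsChain α ρ C B (4 * π - α 0 - α 1) ∧ IsSingularChain C B

/-! ### Orbits of Type II -/

/-- A finite orbit of Type II in the Deroin--Tholozan component: a pure mapping class group orbit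
of length two. -/
def IsTypeIIOrbit (α : Fin 4 → ℝ) (O : Set Rep) : Prop :=
  O ⊆ DT α ∧ (∃ x : Rep, O = MulAction.orbit PMod x) ∧ O.ncard = 2

/-- `O` consists of the north pole, with `β = βN`, and of the south pole, with `β = βS`. -/
def ConsistsOfPoles (α : Fin 4 → ℝ) (βN βS : ℝ) (O : Set Rep) : Prop :=
  ∃ N S : Rep, N ≠ S ∧ O = {N, S} ∧
    (∀ x ∈ DT α, IsNorthPole α x ↔ x = N) ∧ (∀ x ∈ DT α, IsSouthPole α x ↔ x = S) ∧
    HasAction α N βN ∧ HasAction α S βS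

/-- `O` consists of the point with action-angle coordinates `(β, γ₁)` and of the point with
action-angle coordinates `(β, γ₂)`. -/
def ConsistsOfRegular (α : Fin 4 → ℝ) (β : ℝ) (γ₁ γ₂ : Real.Angle) (O : Set Rep) : Prop :=
  ∃ P Q : Rep, P ≠ Q ∧ O = {P, Q} ∧
    (∀ x ∈ DT α, HasActionAngle α x β γ₁ ↔ x = P) ∧
    (∀ x ∈ DT α, HasActionAngle α x β γ₂ ↔ x = Q)

end TypeII

end

/-! The condition `θ₁ + θ₂ > 3π` makes both angles exceed `π`. A rotation of angle `αᵢ` then has a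
canonical lift to `SL(2, ℝ)` with negative trace `2 cos (αᵢ / 2)`, and the component becomes
algebraic: relative Euler class `3` means that the product of the four canonical lifts is `-1`
(`mem_DT_iff`). The sign gives the parity of the Euler class, which lies strictly between `0` and
`4`. The value `1` is impossible because two rotations of angle larger than `π` together move some
boundary point by at least a full turn.

Inside the component a class is determined by the traces `X`, `Y`, `Z` of `c₁c₂`, `c₂c₃`, `c₁c₃`.
Together with the fixed trace of `c₁c₂c₃` they give the pairwise distances and the orientation of
the three centres `C₁`, `C₂`, `C₃`, hence this triple up to isometry. The coordinates satisfy the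
Fricke relation, and Dehn twists act on them by explicit polynomials.

On an orbit of length two, each of the Dehn twists along `c₁c₂` and `c₂c₃` fixes both points or
exchanges them. They cannot both fix a point, since three of the centres would coincide
(`not_fixed_by_both`). In each of the other three cases, comparing the twist formulas at the two
points makes two of the three coordinates vanish, and what remains of the formulas forces the angles
to be equal in pairs (`exists_subset_typeSet`).

Conversely, suppose that the angles are equal in pairs, and consider the points where the two
corresponding coordinates vanish. These conditions are preserved by half twists once the position of
the exceptional generator is followed. Artin's induction in the free group writes every pure
automorphism, up to conjugation, as a composition of half twists, so the set is invariant
(`HasRole.comp`). The Fricke relation becomes a quadratic equation with two explicit roots for the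
last coordinate. Both roots are attained, starting from two rotations `U`, `V` whose product is a
half turn, and they differ because `θ₁ + θ₂ > 3π`. The set thus has two points, and it is an orbit
since the twists do not both fix a point.

The geometry is read off from the coordinates. When the first two angles are equal, the two roots
say `C₁ = C₂` and `C₃ = C₄`, which are the poles. In the other two cases `X = 0`, so that `b` is a
half turn, and the laws of cosines and sines at `B` turn `Y` and `Z` into `cos γ` and `sin γ`.
Finally, the image is generated by two rotations whose product is a half turn. Their centres and
that of the half turn are the vertices of a right-angled triangle. -/

namespace TypeII

/-! ### Traces in `SL(2, ℝ)` -/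

/-- The trace of an element of `SL(2, ℝ)`. -/
def tr (A : SL(2, ℝ)) : ℝ := A.1 0 0 + A.1 1 1

theorem det_eq (A : SL(2, ℝ)) : A.1 0 0 * A.1 1 1 - A.1 0 1 * A.1 1 0 = 1 := by
  have h := A.2
  rwa [Matrix.det_fin_two] at h

theorem mul_entry (A B : SL(2, ℝ)) (i j : Fin 2) :
    (A * B).1 i j = A.1 i 0 * B.1 0 j + A.1 i 1 * B.1 1 j := by
  rw [Matrix.SpecialLinearGroup.coe_mul, Matrix.mul_apply, Fin.sum_univ_two]

theorem inv_entries (A : SL(2, ℝ)) :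
    A⁻¹.1 0 0 = A.1 1 1 ∧ A⁻¹.1 0 1 = -A.1 0 1 ∧ A⁻¹.1 1 0 = -A.1 1 0 ∧ A⁻¹.1 1 1 = A.1 0 0 := by
  rw [Matrix.SpecialLinearGroup.coe_inv, Matrix.adjugate_fin_two]
  simp

theorem neg_entry (A : SL(2, ℝ)) (i j : Fin 2) : (-A).1 i j = -A.1 i j := by
  rw [Matrix.SpecialLinearGroup.coe_neg, Matrix.neg_apply]

theorem one_entries : (1 : SL(2, ℝ)).1 0 0 = 1 ∧ (1 : SL(2, ℝ)).1 0 1 = 0 ∧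
    (1 : SL(2, ℝ)).1 1 0 = 0 ∧ (1 : SL(2, ℝ)).1 1 1 = 1 := by
  rw [Matrix.SpecialLinearGroup.coe_one]
  simp

theorem sl_ext {A B : SL(2, ℝ)} (h00 : A.1 0 0 = B.1 0 0) (h01 : A.1 0 1 = B.1 0 1)
    (h10 : A.1 1 0 = B.1 1 0) (h11 : A.1 1 1 = B.1 1 1) : A = B := by
  apply Matrix.SpecialLinearGroup.ext
  intro i j
  fin_cases i <;> fin_cases j <;> assumption

theorem tr_mul_comm (A B : SL(2, ℝ)) : tr (A * B) = tr (B * A) := by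
  simp only [tr, mul_entry]; ring

theorem tr_inv (A : SL(2, ℝ)) : tr A⁻¹ = tr A := by
  obtain ⟨h1, -, -, h4⟩ := inv_entries A
  simp only [tr, h1, h4]; ring

theorem tr_neg (A : SL(2, ℝ)) : tr (-A) = -tr A := by
  simp only [tr, neg_entry]; ring

theorem tr_one : tr 1 = 2 := by
  obtain ⟨h1, -, -, h4⟩ := one_entries
  simp only [tr, h1, h4]; norm_num

theorem tr_conj (g A : SL(2, ℝ)) : tr (g * A * g⁻¹) = tr A := by
  rw [tr_mul_comm, ← mul_assoc, inv_mul_cancel, one_mul]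

/-- Cayley–Hamilton: `B + B⁻¹` is the scalar matrix `tr B`. -/
theorem tr_mul_inv (A B : SL(2, ℝ)) : tr (A * B⁻¹) = tr A * tr B - tr (A * B) := by
  obtain ⟨h1, h2, h3, h4⟩ := inv_entries B
  simp only [tr, mul_entry, h1, h2, h3, h4]; ring

theorem tr_sq (A : SL(2, ℝ)) : tr (A * A) = tr A ^ 2 - 2 := by
  have h := tr_mul_inv A A
  rw [mul_inv_cancel, tr_one] at h
  linarith

theorem tr_sq_mul (A B : SL(2, ℝ)) : tr (A * A * B) = tr A * tr (A * B) - tr B := by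
  have h := tr_mul_inv (A * B) A
  rw [tr_mul_comm (A * B) A⁻¹, inv_mul_cancel_left, tr_mul_comm (A * B) A, ← mul_assoc] at h
  linarith

/-- The effect of a half twist on a trace. -/
theorem tr_half_twist (A B C : SL(2, ℝ)) :
    tr (A * B * A⁻¹ * C) =
      tr A * tr (A * B * C) + tr B * tr C - tr (A * B) * tr (A * C) - tr (B * C) := by
  obtain ⟨h1, h2, h3, h4⟩ := inv_entries A
  simp only [tr, mul_entry, h1, h2, h3, h4]
  linear_combination ((B.1 0 0 + B.1 1 1) * (C.1 0 0 + C.1 1 1) - (B.1 0 0 * C.1 0 0 +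
    B.1 0 1 * C.1 1 0 + (B.1 1 0 * C.1 0 1 + B.1 1 1 * C.1 1 1))) * det_eq A

/-- The Fricke relation. -/
theorem fricke (A B C : SL(2, ℝ)) :
    tr (A * B * C) ^ 2 - tr (A * B * C) * (tr A * tr (B * C) + tr B * tr (A * C)
      + tr C * tr (A * B) - tr A * tr B * tr C) + tr (A * B) ^ 2 + tr (B * C) ^ 2 + tr (A * C) ^ 2
      + tr (A * B) * tr (B * C) * tr (A * C) - tr A * tr B * tr (A * B) - tr B * tr C * tr (B * C)
      - tr A * tr C * tr (A * C) + tr A ^ 2 + tr B ^ 2 + tr C ^ 2 - 4 = 0 := by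
  -- The traces of `A B C` and `A C B` are the two roots of the quadratic. Their sum is polynomial
  -- in the other traces. Their product follows from `tr_mul_inv`, because `A B C (A C B)⁻¹` is
  -- conjugate to the commutator of `B` and `C`.
  have hsum : tr (A * C * B) = tr A * tr (B * C) + tr B * tr (A * C)
      + tr C * tr (A * B) - tr A * tr B * tr C - tr (A * B * C) := by
    simp only [tr, mul_entry]; ring
  have hprod := tr_mul_inv (A * B * C) (A * C * B)
  have hcomm : tr (A * B * C * (A * C * B)⁻¹) = tr (B * C * B⁻¹ * C⁻¹) := by
    rw [← tr_conj A (B * C * B⁻¹ * C⁻¹)]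
    congr 1
    group
  have hcomm' : tr (B * C * B⁻¹ * C⁻¹) = tr B ^ 2 + tr C ^ 2 + tr (B * C) ^ 2
      - tr B * tr C * tr (B * C) - 2 := by
    rw [tr_half_twist, mul_inv_cancel_right, mul_inv_cancel, tr_one, tr_mul_inv, tr_inv]
    ring
  have hBAB (X : SL(2, ℝ)) : tr (B * A * B * X) = tr (A * B) * tr (B * X) - tr (A⁻¹ * X) := by
    obtain ⟨h1, h2, h3, h4⟩ := inv_entries A
    simp only [tr, mul_entry, h1, h2, h3, h4]
    linear_combination (-(A.1 1 1 * X.1 0 0) + A.1 0 1 * X.1 1 0 + A.1 1 0 * X.1 0 1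
      - A.1 0 0 * X.1 1 1) * det_eq B
  have hCAC (X : SL(2, ℝ)) : tr (C * A * C * X) = tr (A * C) * tr (C * X) - tr (A⁻¹ * X) := by
    obtain ⟨h1, h2, h3, h4⟩ := inv_entries A
    simp only [tr, mul_entry, h1, h2, h3, h4]
    linear_combination (-(A.1 1 1 * X.1 0 0) + A.1 0 1 * X.1 1 0 + A.1 1 0 * X.1 0 1
      - A.1 0 0 * X.1 1 1) * det_eq C
  have hMN : tr (A * B * C * (A * C * B)) = tr (B * A * B * (C * A * C)) := by
    rw [← tr_conj B (A * B * C * (A * C * B))]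
    congr 1
    group
  have e1 : tr (B * (C * A * C)) = tr (A * C) * tr (B * C) - (tr A * tr B - tr (A * B)) := by
    rw [tr_mul_comm B, hCAC, tr_mul_comm C B, tr_mul_comm A⁻¹, tr_mul_inv, tr_mul_comm B A]
    ring
  have e2 : tr (A⁻¹ * (C * A * C)) = tr (A * C) * (tr A * tr C - tr (A * C)) - (tr A ^ 2 - 2) := by
    have : tr (A⁻¹ * A⁻¹) = tr A ^ 2 - 2 := by rw [tr_sq, tr_inv]
    rw [tr_mul_comm A⁻¹, hCAC, this, tr_mul_inv, tr_mul_comm C A]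
    ring
  rw [hMN, hBAB, e1, e2, hcomm, hcomm', hsum] at hprod
  linear_combination hprod

/-! ### Rotations about a point -/

/-- The lift to `SL(2, ℝ)` of the rotation of angle `ϑ` about `p`. -/
noncomputable def rotAbout (p : ℍ) (ϑ : ℝ) : SL(2, ℝ) :=
  ⟨!![Real.cos (ϑ / 2) - Real.sin (ϑ / 2) * (p.re / p.im),
      Real.sin (ϑ / 2) * ((p.re ^ 2 + p.im ^ 2) / p.im);
      -Real.sin (ϑ / 2) * (1 / p.im),
      Real.cos (ϑ / 2) + Real.sin (ϑ / 2) * (p.re / p.im)], by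
    have := p.im_ne_zero
    rw [Matrix.det_fin_two_of]
    field_simp
    linear_combination p.im ^ 2 * Real.sin_sq_add_cos_sq (ϑ / 2)⟩

theorem rotAbout_entries (p : ℍ) (ϑ : ℝ) :
    (rotAbout p ϑ).1 0 0 = Real.cos (ϑ / 2) - Real.sin (ϑ / 2) * (p.re / p.im) ∧
    (rotAbout p ϑ).1 0 1 = Real.sin (ϑ / 2) * ((p.re ^ 2 + p.im ^ 2) / p.im) ∧
    (rotAbout p ϑ).1 1 0 = -Real.sin (ϑ / 2) * (1 / p.im) ∧
    (rotAbout p ϑ).1 1 1 = Real.cos (ϑ / 2) + Real.sin (ϑ / 2) * (p.re / p.im) := by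
  simp [rotAbout]

theorem rot_eq (ϑ : ℝ) : rot ϑ = rotAbout UpperHalfPlane.I ϑ := by
  apply sl_ext <;> simp [rot, rotAbout]

theorem smul_re_im (h : SL(2, ℝ)) (p : ℍ) :
    0 < (h.1 1 0 * p.re + h.1 1 1) ^ 2 + (h.1 1 0 * p.im) ^ 2 ∧
    (h • p).im = p.im / ((h.1 1 0 * p.re + h.1 1 1) ^ 2 + (h.1 1 0 * p.im) ^ 2) ∧
    (h • p).re = ((h.1 0 0 * p.re + h.1 0 1) * (h.1 1 0 * p.re + h.1 1 1) +
      h.1 0 0 * h.1 1 0 * p.im ^ 2) /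
        ((h.1 1 0 * p.re + h.1 1 1) ^ 2 + (h.1 1 0 * p.im) ^ 2) := by
  have hd := det_eq h
  have hp := p.im_pos
  have hpos : 0 < (h.1 1 0 * p.re + h.1 1 1) ^ 2 + (h.1 1 0 * p.im) ^ 2 := by
    by_cases h0 : h.1 1 0 = 0
    · have : h.1 1 1 ≠ 0 := by rintro h1; rw [h0, h1] at hd; norm_num at hd
      rw [h0, zero_mul, zero_add]; positivity
    · positivity
  have hc := UpperHalfPlane.coe_specialLinearGroup_apply h p
  have hN : Complex.normSq ((h.1 1 0 : ℂ) * p + (h.1 1 1 : ℂ)) =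
      (h.1 1 0 * p.re + h.1 1 1) ^ 2 + (h.1 1 0 * p.im) ^ 2 := by
    simp [Complex.normSq_apply]; ring
  simp only [Algebra.algebraMap_self, RingHom.id_apply] at hc
  refine ⟨hpos, ?_, ?_⟩
  · rw [← UpperHalfPlane.coe_im, hc, Complex.div_im, hN]
    simp only [Complex.add_re, Complex.add_im, Complex.mul_re, Complex.mul_im, Complex.ofReal_re,
      Complex.ofReal_im, UpperHalfPlane.coe_re, UpperHalfPlane.coe_im]
    rw [← sub_div]
    congr 1
    linear_combination p.im * hd
  · rw [← UpperHalfPlane.coe_re, hc, Complex.div_re, hN]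
    simp
    field_simp

theorem conj_rotAbout (h : SL(2, ℝ)) (p : ℍ) (ϑ : ℝ) :
    h * rotAbout p ϑ * h⁻¹ = rotAbout (h • p) ϑ := by
  have hd := det_eq h
  have hp := p.im_pos
  obtain ⟨hpos, him, hre⟩ := smul_re_im h p
  obtain ⟨i1, i2, i3, i4⟩ := inv_entries h
  obtain ⟨e1, e2, e3, e4⟩ := rotAbout_entries p ϑ
  obtain ⟨f1, f2, f3, f4⟩ := rotAbout_entries (h • p) ϑ
  set N := (h.1 1 0 * p.re + h.1 1 1) ^ 2 + (h.1 1 0 * p.im) ^ 2 with hN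
  set R := (h.1 0 0 * p.re + h.1 0 1) * (h.1 1 0 * p.re + h.1 1 1) +
      h.1 0 0 * h.1 1 0 * p.im ^ 2 with hR
  have g1 : (h • p).re / (h • p).im = R / p.im := by
    rw [him, hre]; field_simp
  have g2 : 1 / (h • p).im = N / p.im := by
    rw [him]; field_simp
  have g3 : ((h • p).re ^ 2 + (h • p).im ^ 2) / (h • p).im =
      ((h.1 0 0 * p.re + h.1 0 1) ^ 2 + (h.1 0 0 * p.im) ^ 2) / p.im := by
    -- `R` and `p.im` are the real and imaginary parts of `(a p + b)` times the conjugate of `(c p +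
    -- d)`, where `a, b, c, d` are the entries of `h`; both sides are the squared modulus of this
    -- number.
    have key : R ^ 2 + p.im ^ 2 =
        ((h.1 0 0 * p.re + h.1 0 1) ^ 2 + (h.1 0 0 * p.im) ^ 2) * N := by
      rw [hR, hN]
      linear_combination -(p.im ^ 2 * (h.1 0 0 * h.1 1 1 - h.1 0 1 * h.1 1 0 + 1)) * hd
    rw [him, hre]
    field_simp
    linear_combination key
  rw [g1] at f1 f4
  rw [g2] at f3
  rw [g3] at f2
  apply sl_ext <;> simp only [mul_entry, i1, i2, i3, i4, e1, e2, e3, e4, f1, f2, f3, f4, hN, hR] <;>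
    field_simp
  · linear_combination Real.cos (ϑ / 2) * p.im * hd
  · ring
  · ring
  · linear_combination Real.cos (ϑ / 2) * p.im * hd

theorem tr_rotAbout (p : ℍ) (ϑ : ℝ) : tr (rotAbout p ϑ) = 2 * Real.cos (ϑ / 2) := by
  obtain ⟨e1, e2, e3, e4⟩ := rotAbout_entries p ϑ
  simp only [tr, e1, e4]; ring

theorem rotAbout_mul (p : ℍ) (ϑ φ : ℝ) :
    rotAbout p ϑ * rotAbout p φ = rotAbout p (ϑ + φ) := by
  have hp := p.im_pos
  obtain ⟨e1, e2, e3, e4⟩ := rotAbout_entries p ϑ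
  obtain ⟨f1, f2, f3, f4⟩ := rotAbout_entries p φ
  obtain ⟨g1, g2, g3, g4⟩ := rotAbout_entries p (ϑ + φ)
  simp only [add_div, Real.cos_add, Real.sin_add] at g1 g2 g3 g4
  apply sl_ext <;> simp only [mul_entry, e1, e2, e3, e4, f1, f2, f3, f4, g1, g2, g3, g4] <;>
    field_simp <;> ring

/-- A full turn is trivial in `PSL(2, ℝ)` but changes the sign of the lift; this sign detects the
parity of the Euler class. -/
theorem rotAbout_add_two_pi (p : ℍ) (ϑ : ℝ) : rotAbout p (ϑ + 2 * π) = -rotAbout p ϑ := by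
  obtain ⟨e1, e2, e3, e4⟩ := rotAbout_entries p ϑ
  obtain ⟨g1, g2, g3, g4⟩ := rotAbout_entries p (ϑ + 2 * π)
  have : (ϑ + 2 * π) / 2 = ϑ / 2 + π := by ring
  simp only [this, Real.cos_add_pi, Real.sin_add_pi] at g1 g2 g3 g4
  apply sl_ext <;> simp only [neg_entry, e1, e2, e3, e4, g1, g2, g3, g4] <;> ring

theorem rotAbout_zero (p : ℍ) : rotAbout p 0 = 1 := by
  obtain ⟨e1, e2, e3, e4⟩ := rotAbout_entries p 0
  obtain ⟨g1, g2, g3, g4⟩ := one_entries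
  apply sl_ext <;> simp [e1, e2, e3, e4, g1, g2, g3, g4]

theorem rotAbout_inv (p : ℍ) (ϑ : ℝ) : (rotAbout p ϑ)⁻¹ = rotAbout p (-ϑ) := by
  rw [inv_eq_iff_mul_eq_one, rotAbout_mul, add_neg_cancel, rotAbout_zero]

/-- Rotations by angles in `(0, 2π)` have distinct centres if and only if they are distinct, even
up to sign. -/
theorem center_injective {p q : ℍ} {ϑ φ : ℝ} (hϑ : 0 < Real.sin (ϑ / 2)) (hφ : φ = ϑ)
    (h : rotAbout p ϑ = rotAbout q φ) : p = q := by
  subst hφ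
  obtain ⟨e1, e2, e3, e4⟩ := rotAbout_entries p φ
  obtain ⟨g1, g2, g3, g4⟩ := rotAbout_entries q φ
  rw [h] at e1 e3
  have h3 := e3.symm.trans g3
  have h1 := e1.symm.trans g1
  have hp := p.im_pos
  have hq := q.im_pos
  have him : p.im = q.im := by
    field_simp at h3
    linarith
  have hre : p.re = q.re := by
    rw [him] at h1
    field_simp at h1
    exact mul_left_cancel₀ hϑ.ne' (by linarith)
  exact UpperHalfPlane.ext_re_im hre him

/-- The lower left entry is negative for every rotation of angle in `(0, 2π)`, whatever its centre,
so the canonical lift is never confused with its opposite. -/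
theorem rotAbout_ne_neg {p q : ℍ} {ϑ φ : ℝ} (hϑ : 0 < Real.sin (ϑ / 2))
    (hφ : 0 < Real.sin (φ / 2)) : rotAbout p ϑ ≠ -rotAbout q φ := by
  intro h
  obtain ⟨e1, e2, e3, e4⟩ := rotAbout_entries p ϑ
  obtain ⟨g1, g2, g3, g4⟩ := rotAbout_entries q φ
  rw [h, neg_entry, g3] at e3
  have hp := p.im_pos
  have hq := q.im_pos
  have h1 : 0 < Real.sin (ϑ / 2) * (1 / p.im) := by positivity
  have h2 : 0 < Real.sin (φ / 2) * (1 / q.im) := by positivity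
  linarith

theorem exists_rotAbout_of_tr_eq_zero_of_neg (A : SL(2, ℝ)) (hA : tr A = 0) (hneg : A.1 1 0 < 0) :
    ∃ p : ℍ, A = rotAbout p π := by
  have hd := det_eq A
  have h11 : A.1 1 1 = -A.1 0 0 := by rw [tr] at hA; linarith
  rw [h11] at hd
  -- Read off from the lower left entry `-1 / p.im` and the upper left entry `-p.re / p.im` of a
  -- half turn.
  let p : ℍ := ⟨⟨A.1 0 0 / A.1 1 0, -1 / A.1 1 0⟩, div_pos_of_neg_of_neg (by norm_num) hneg⟩
  have hre : p.re = A.1 0 0 / A.1 1 0 := rfl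
  have him : p.im = -1 / A.1 1 0 := rfl
  have h10 := hneg.ne
  obtain ⟨e1, e2, e3, e4⟩ := rotAbout_entries p π
  simp only [Real.cos_pi_div_two, Real.sin_pi_div_two, hre, him] at e1 e2 e3 e4
  refine ⟨p, sl_ext ?_ ?_ ?_ ?_⟩
  · rw [e1]; field_simp; ring
  · rw [e2]; field_simp; linear_combination -hd
  · rw [e3]; field_simp
  · rw [e4, h11]; field_simp; ring

/-- A traceless element of `SL(2, ℝ)` is, up to sign, a half turn. -/
theorem exists_rotAbout_of_tr_eq_zero (A : SL(2, ℝ)) (hA : tr A = 0) :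
    ∃ p : ℍ, A = rotAbout p π ∨ A = -rotAbout p π := by
  have h10 : A.1 1 0 ≠ 0 := by
    intro h0
    have hd := det_eq A
    have h11 : A.1 1 1 = -A.1 0 0 := by rw [tr] at hA; linarith
    rw [h11, h0] at hd
    nlinarith [sq_nonneg (A.1 0 0)]
  rcases lt_or_gt_of_ne h10 with hneg | hpos
  · obtain ⟨p, hp⟩ := exists_rotAbout_of_tr_eq_zero_of_neg A hA hneg
    exact ⟨p, Or.inl hp⟩
  · obtain ⟨p, hp⟩ := exists_rotAbout_of_tr_eq_zero_of_neg (-A) (by rw [tr_neg, hA, neg_zero])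
      (by rw [neg_entry]; linarith)
    exact ⟨p, Or.inr (by rw [← hp, neg_neg])⟩

/-! ### Lifting along `SL(2, ℝ) → PSL(2, ℝ)` -/

theorem mk_eq_mk_iff (A B : SL(2, ℝ)) :
    (A : PSL(2, ℝ)) = (B : PSL(2, ℝ)) ↔ A = B ∨ A = -B := by
  rw [QuotientGroup.eq, Matrix.SpecialLinearGroup.mem_center_iff]
  constructor
  · rintro ⟨r, hr, h⟩
    rw [Fintype.card_fin] at hr
    rcases sq_eq_one_iff.mp hr with rfl | rfl
    · left
      have : A⁻¹ * B = 1 := by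
        apply Subtype.ext
        rw [← h]; simp
      exact inv_mul_eq_one.mp this
    · right
      have : A⁻¹ * B = -1 := by
        apply Subtype.ext
        rw [← h]
        ext i j
        fin_cases i <;> fin_cases j <;> simp
      rw [inv_mul_eq_iff_eq_mul, mul_neg, mul_one] at this
      rw [this, neg_neg]
  · rintro (rfl | rfl)
    · exact ⟨1, by simp, by simp⟩
    · refine ⟨-1, by simp, ?_⟩
      rw [inv_neg, neg_mul, inv_mul_cancel]
      ext i j
      fin_cases i <;> fin_cases j <;> simp

theorem isRotationAbout_iff (g : PSL(2, ℝ)) (p : ℍ) (ϑ : ℝ) :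
    IsRotationAbout g p ϑ ↔ g = (rotAbout p ϑ : PSL(2, ℝ)) := by
  constructor
  · rintro ⟨h, hp, rfl⟩
    rw [rot_eq, conj_rotAbout, hp]
  · rintro rfl
    obtain ⟨h, hh⟩ := MulAction.exists_smul_eq SL(2, ℝ) UpperHalfPlane.I p
    exact ⟨h, hh, by rw [rot_eq, conj_rotAbout, hh]⟩

/-! ### Lifts to the universal cover of the circle -/

/-- `A` maps the direction of parameter `x` to the direction of parameter `y`. -/
def Moves (A : SL(2, ℝ)) (x y : ℝ) : Prop :=
  ∃ r : ℝ, 0 < r ∧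
    A.1 0 0 * Real.cos (π * x) - A.1 0 1 * Real.sin (π * x) = r * Real.cos (π * y) ∧
    A.1 1 0 * Real.cos (π * x) - A.1 1 1 * Real.sin (π * x) = -(r * Real.sin (π * y))

theorem exists_polar {a b : ℝ} (h : a ≠ 0 ∨ b ≠ 0) :
    ∃ x r : ℝ, 0 < r ∧ a = r * Real.cos (π * x) ∧ b = -(r * Real.sin (π * x)) := by
  set w : ℂ := ⟨a, -b⟩ with hw
  have hw0 : w ≠ 0 := by
    intro h0
    have h1 : a = 0 := congrArg Complex.re h0
    have h2 : -b = 0 := congrArg Complex.im h0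
    rcases h with h | h
    · exact h h1
    · exact h (neg_eq_zero.mp h2)
  have hpi : π * (w.arg / π) = w.arg := by field_simp
  refine ⟨w.arg / π, ‖w‖, norm_pos_iff.mpr hw0, ?_, ?_⟩
  · rw [hpi, Complex.norm_mul_cos_arg]
  · rw [hpi, Complex.norm_mul_sin_arg, neg_neg]

theorem exists_moves (A : SL(2, ℝ)) (x : ℝ) : ∃ y, Moves A x y := by
  have h : A.1 0 0 * Real.cos (π * x) - A.1 0 1 * Real.sin (π * x) ≠ 0 ∨
      A.1 1 0 * Real.cos (π * x) - A.1 1 1 * Real.sin (π * x) ≠ 0 := by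
    by_contra! h
    obtain ⟨h1, h2⟩ := h
    have hd := det_eq A
    have hc : Real.cos (π * x) = 0 := by
      linear_combination A.1 1 1 * h1 - A.1 0 1 * h2 - Real.cos (π * x) * hd
    have hs : Real.sin (π * x) = 0 := by
      linear_combination A.1 1 0 * h1 - A.1 0 0 * h2 - Real.sin (π * x) * hd
    have := Real.sin_sq_add_cos_sq (π * x)
    rw [hc, hs] at this
    norm_num at this
  obtain ⟨y, r, hr, h1, h2⟩ := exists_polar h
  exact ⟨y, r, hr, h1, h2⟩

theorem Moves.mul {A B : SL(2, ℝ)} {x y z : ℝ} (hB : Moves B x y) (hA : Moves A y z) :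
    Moves (A * B) x z := by
  obtain ⟨r, hr, h1, h2⟩ := hB
  obtain ⟨s, hs, h3, h4⟩ := hA
  refine ⟨r * s, mul_pos hr hs, ?_, ?_⟩
  · simp only [mul_entry]
    linear_combination A.1 0 0 * h1 + A.1 0 1 * h2 + r * h3
  · simp only [mul_entry]
    linear_combination A.1 1 0 * h1 + A.1 1 1 * h2 + r * h4

/-- The period is `2`, although the boundary circle has period `1`: since the factor in `Moves` is
positive, directions are followed rather than lines, and the sign of `A` is seen. -/
theorem Moves.unique {A : SL(2, ℝ)} {x y z : ℝ} (hy : Moves A x y) (hz : Moves A x z) :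
    ∃ n : ℤ, z = y + 2 * n := by
  obtain ⟨r, hr, h1, h2⟩ := hy
  obtain ⟨s, hs, h3, h4⟩ := hz
  have hc : r * Real.cos (π * y) = s * Real.cos (π * z) := h1.symm.trans h3
  have hsn : r * Real.sin (π * y) = s * Real.sin (π * z) := neg_injective (h2.symm.trans h4)
  have hrs : r = s := by
    have h5 : r ^ 2 = s ^ 2 := by
      linear_combination (r * Real.cos (π * y) + s * Real.cos (π * z)) * hc +
        (r * Real.sin (π * y) + s * Real.sin (π * z)) * hsn
        - r ^ 2 * Real.sin_sq_add_cos_sq (π * y) + s ^ 2 * Real.sin_sq_add_cos_sq (π * z)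
    exact (pow_left_inj₀ hr.le hs.le two_ne_zero).mp h5
  rw [hrs] at hc hsn
  have hang := Real.Angle.cos_sin_inj (mul_left_cancel₀ hs.ne' hc) (mul_left_cancel₀ hs.ne' hsn)
  obtain ⟨n, hn⟩ := Real.Angle.angle_eq_iff_two_pi_dvd_sub.mp hang
  refine ⟨-n, ?_⟩
  have hpi := Real.pi_pos
  push_cast
  apply mul_left_cancel₀ hpi.ne'
  linarith

theorem Moves.add_one {A : SL(2, ℝ)} {x y : ℝ} (h : Moves A x y) : Moves A (x + 1) (y + 1) := by
  obtain ⟨r, hr, h1, h2⟩ := h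
  refine ⟨r, hr, ?_, ?_⟩ <;>
    simp only [mul_add, mul_one, Real.cos_add_pi, Real.sin_add_pi] <;> linarith

theorem Moves.add_two_mul {A : SL(2, ℝ)} {x y : ℝ} (h : Moves A x y) (n : ℤ) :
    Moves A x (y + 2 * n) := by
  obtain ⟨r, hr, h1, h2⟩ := h
  have e : π * (y + 2 * n) = π * y + n * (2 * π) := by ring
  exact ⟨r, hr, by rw [e, Real.cos_add_int_mul_two_pi, h1],
    by rw [e, Real.sin_add_int_mul_two_pi, h2]⟩

theorem moves_one (x : ℝ) : Moves 1 x x := by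
  obtain ⟨h1, h2, h3, h4⟩ := one_entries
  exact ⟨1, one_pos, by rw [h1, h2]; ring, by rw [h3, h4]; ring⟩

theorem moves_neg_one (x : ℝ) : Moves (-1) x (x + 1) := by
  obtain ⟨h1, h2, h3, h4⟩ := one_entries
  refine ⟨1, one_pos, ?_, ?_⟩ <;>
    simp only [neg_entry, h1, h2, h3, h4, mul_add, mul_one, Real.cos_add_pi, Real.sin_add_pi] <;>
    ring

/-- The quadratic form `v ↦ det (v, A v)`. -/
def qform (A : SL(2, ℝ)) (a b : ℝ) : ℝ :=
  A.1 1 0 * a ^ 2 + (A.1 1 1 - A.1 0 0) * (a * b) - A.1 0 1 * b ^ 2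

/-- The determinant of a direction and its image is a sine. The minus sign comes from the clockwise
parametrization of directions by `(cos, -sin)`. -/
theorem Moves.qform {A : SL(2, ℝ)} {x y : ℝ} (h : Moves A x y) :
    ∃ r : ℝ, 0 < r ∧ qform A (Real.cos (π * x)) (-Real.sin (π * x)) =
      -(r * Real.sin (π * (y - x))) := by
  obtain ⟨r, hr, h1, h2⟩ := h
  refine ⟨r, hr, ?_⟩
  rw [mul_sub, Real.sin_sub, TypeII.qform]
  linear_combination Real.sin (π * x) * h1 + Real.cos (π * x) * h2

/-- A matrix of determinant one preserves the oriented area spanned by two directions; this yields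
the monotonicity of the lifted circle maps. -/
theorem Moves.order {A : SL(2, ℝ)} {x y x' y' : ℝ} (h : Moves A x y) (h' : Moves A x' y') :
    ∃ k : ℝ, 0 < k ∧ Real.sin (π * (x' - x)) = k * Real.sin (π * (y' - y)) := by
  obtain ⟨r, hr, h1, h2⟩ := h
  obtain ⟨s, hs, h3, h4⟩ := h'
  refine ⟨r * s, mul_pos hr hs, ?_⟩
  have hd := det_eq A
  simp only [mul_sub, Real.sin_sub]
  linear_combination (-(Real.sin (π * x') * Real.cos (π * x)) +
    Real.cos (π * x') * Real.sin (π * x)) * hd + s * Real.sin (π * y') * h1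
    + s * Real.cos (π * y') * h2 + (A.1 1 0 * Real.cos (π * x) - A.1 1 1 * Real.sin (π * x)) * h3
    - (A.1 0 0 * Real.cos (π * x) - A.1 0 1 * Real.sin (π * x)) * h4

/-- The form is a negative multiple of `|a - p b|²`, which vanishes only at the origin because `p`
is not real. -/
theorem qform_rotAbout_neg {p : ℍ} {ϑ a b : ℝ} (hϑ : 0 < Real.sin (ϑ / 2))
    (hab : a ≠ 0 ∨ b ≠ 0) : qform (rotAbout p ϑ) a b < 0 := by
  obtain ⟨e1, e2, e3, e4⟩ := rotAbout_entries p ϑ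
  have hp := p.im_pos
  have key : qform (rotAbout p ϑ) a b =
      -(Real.sin (ϑ / 2) / p.im * ((a - p.re * b) ^ 2 + (p.im * b) ^ 2)) := by
    rw [qform, e1, e2, e3, e4]
    field_simp
    ring
  have : 0 < (a - p.re * b) ^ 2 + (p.im * b) ^ 2 := by
    by_cases hb : b = 0
    · subst hb
      have : a ≠ 0 := by simpa using hab
      simp only [mul_zero, sub_zero]
      positivity
    · positivity
  rw [key, neg_lt_zero]
  positivity

theorem cos_sin_ne_zero (t : ℝ) : Real.cos t ≠ 0 ∨ -Real.sin t ≠ 0 := by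
  by_contra! h
  have := Real.sin_sq_add_cos_sq t
  rw [h.1, neg_eq_zero.mp h.2] at this
  norm_num at this

theorem sin_pi_mul_pos_of_moves {p : ℍ} {ϑ x y : ℝ} (hϑ : 0 < Real.sin (ϑ / 2))
    (h : Moves (rotAbout p ϑ) x y) : 0 < Real.sin (π * (y - x)) := by
  obtain ⟨r, hr, h1⟩ := h.qform
  have h2 := qform_rotAbout_neg (p := p) hϑ (cos_sin_ne_zero (π * x))
  rw [h1] at h2
  exact pos_of_mul_pos_right (by linarith : 0 < r * _) hr.le

theorem sin_pi_mul_pos {t : ℝ} (h0 : 0 < t) (h1 : t < 1) : 0 < Real.sin (π * t) := by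
  have := Real.pi_pos
  apply Real.sin_pos_of_pos_of_lt_pi <;> nlinarith

/-- The lift with rotation angle in `(0, 2π)` of a rotation to the universal cover. -/
theorem exists_circleLift (p : ℍ) {ϑ : ℝ} (hϑ : 0 < Real.sin (ϑ / 2)) :
    ∃ f : CircleDeg1Lift, ∀ x, Moves (rotAbout p ϑ) x (f x) ∧ x < f x ∧ f x < x + 1 := by
  have hex : ∀ x, ∃ y, Moves (rotAbout p ϑ) x y ∧ x < y ∧ y < x + 1 := by
    intro x
    obtain ⟨y, hy⟩ := exists_moves (rotAbout p ϑ) x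
    -- Normalizes the image parameter to `[x, x + 2)`; the positive sine then leaves only `(x, x +
    -- 1)`.
    have hy' := hy.add_two_mul (-⌊(y - x) / 2⌋)
    refine ⟨_, hy', ?_⟩
    have hpos := sin_pi_mul_pos_of_moves hϑ hy'
    have h1 := Int.floor_le ((y - x) / 2)
    have h2 := Int.lt_floor_add_one ((y - x) / 2)
    push_cast at *
    set t := y + 2 * -(⌊(y - x) / 2⌋ : ℝ) - x with ht
    have hpi := Real.pi_pos
    have ht0 : 0 ≤ t := by linarith
    have ht2 : t < 2 := by linarith
    constructor
    · rcases ht0.eq_or_lt with h0 | h0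
      · rw [← h0] at hpos; simp at hpos
      · linarith
    · by_contra! h3
      have ht1 : 0 ≤ t - 1 := by linarith
      have : 0 ≤ Real.sin (π * (t - 1)) := by
        apply Real.sin_nonneg_of_nonneg_of_le_pi <;> nlinarith
      rw [mul_sub, mul_one, Real.sin_sub_pi] at this
      linarith
  choose g hg hg1 hg2 using hex
  refine ⟨⟨⟨g, ?_⟩, ?_⟩, fun x => ⟨hg x, hg1 x, hg2 x⟩⟩
  · intro x x' hxx
    -- If the order were reversed, both displacements would still be less than `1`, and the two
    -- sines in `Moves.order` would have opposite signs.
    by_contra! hlt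
    have hlt1 : x' < x + 1 := (hg1 x').trans (hlt.trans (hg2 x))
    obtain ⟨k, hk, hkk⟩ := (hg x').order (hg x)
    have h1 : 0 < Real.sin (π * (g x - g x')) :=
      sin_pi_mul_pos (by linarith) (by linarith [hg1 x', hg2 x])
    have h2 : 0 ≤ Real.sin (π * (x' - x)) := by
      have := Real.pi_pos
      apply Real.sin_nonneg_of_nonneg_of_le_pi <;> nlinarith
    have h3 : Real.sin (π * (x - x')) = -Real.sin (π * (x' - x)) := by
      rw [← Real.sin_neg]; ring_nf
    have : 0 < k * Real.sin (π * (g x - g x')) := mul_pos hk h1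
    linarith
  · intro x
    obtain ⟨n, hn⟩ := (hg (x + 1)).unique (hg x).add_one
    have h1 := hg1 (x + 1)
    have h2 := hg2 (x + 1)
    have h3 := hg1 x
    have h4 := hg2 x
    have hn0 : n = 0 := by
      have : (-1 : ℝ) < n := by linarith
      have : (n : ℝ) < 1 := by linarith
      have : (-1 : ℤ) < n := by exact_mod_cast ‹(-1 : ℝ) < n›
      have : n < (1 : ℤ) := by exact_mod_cast ‹(n : ℝ) < 1›
      omega
    rw [hn0] at hn
    simp only [Int.cast_zero, mul_zero, add_zero] at hn
    exact hn.symm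

/-- A circle lift knows its matrix only up to sign and follows only lines. The bound `x < f x < x +
1` makes the sine positive, and since the form of the canonical lift is negative the scaling factor
has to be positive. -/
theorem moves_of_isCircleLift {p : ℍ} {ϑ : ℝ} (hϑ : 0 < Real.sin (ϑ / 2)) {f : CircleDeg1Lift}
    (hf : IsCircleLift (rotAbout p ϑ : PSL(2, ℝ)) f) (hx : ∀ x : ℝ, x < f x ∧ f x < x + 1) (x : ℝ) :
    Moves (rotAbout p ϑ) x (f x) := by
  obtain ⟨A, hA, hAf⟩ := hf
  obtain ⟨r, hr⟩ := hAf x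
  have hr0 := congrFun hr 0
  have hr1 := congrFun hr 1
  simp [Matrix.mulVec, dotProduct, Fin.sum_univ_two] at hr0 hr1
  have key : ∃ s : ℝ,
      (rotAbout p ϑ).1 0 0 * Real.cos (π * x) - (rotAbout p ϑ).1 0 1 * Real.sin (π * x) =
        s * Real.cos (π * f x) ∧
      (rotAbout p ϑ).1 1 0 * Real.cos (π * x) - (rotAbout p ϑ).1 1 1 * Real.sin (π * x) =
        -(s * Real.sin (π * f x)) := by
    rcases (mk_eq_mk_iff _ _).mp hA with h | h
    · rw [← h]
      exact ⟨r, by linarith, by linarith⟩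
    · refine ⟨-r, ?_, ?_⟩
      · rw [h] at hr0 hr1
        simp only [neg_entry] at hr0 hr1
        linarith
      · rw [h] at hr0 hr1
        simp only [neg_entry] at hr0 hr1
        linarith
  obtain ⟨s, h1, h2⟩ := key
  refine ⟨s, ?_, h1, h2⟩
  have h3 : qform (rotAbout p ϑ) (Real.cos (π * x)) (-Real.sin (π * x)) =
      -(s * Real.sin (π * (f x - x))) := by
    rw [mul_sub, Real.sin_sub, qform]
    linear_combination Real.sin (π * x) * h1 + Real.cos (π * x) * h2
  have h4 := qform_rotAbout_neg (p := p) hϑ (cos_sin_ne_zero (π * x))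
  have h5 := sin_pi_mul_pos (t := f x - x) (by linarith [(hx x).1]) (by linarith [(hx x).2])
  rw [h3] at h4
  exact pos_of_mul_pos_left (by linarith : 0 < s * _) h5.le

theorem isCircleLift_of_moves {A : SL(2, ℝ)} {f : CircleDeg1Lift} (h : ∀ x, Moves A x (f x)) :
    IsCircleLift (A : PSL(2, ℝ)) f := by
  refine ⟨A, rfl, fun x => ?_⟩
  obtain ⟨r, -, h1, h2⟩ := h x
  refine ⟨r, ?_⟩
  ext i
  fin_cases i
  · simp [Matrix.mulVec, dotProduct, Fin.sum_univ_two]; linarith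
  · simp [Matrix.mulVec, dotProduct, Fin.sum_univ_two]; linarith

/-- Two rotations with angles at least `π` compose, in the universal cover, to a map that moves
some point by at least a full turn. -/
theorem exists_add_one_le {p q : ℍ} {ϑ φ : ℝ} (hϑ : 0 < Real.sin (ϑ / 2))
    (hϑ' : Real.cos (ϑ / 2) < 0) (hφ : 0 < Real.sin (φ / 2)) (hφ' : Real.cos (φ / 2) < 0)
    {f g : CircleDeg1Lift} (hf : ∀ x, Moves (rotAbout p ϑ) x (f x) ∧ x < f x ∧ f x < x + 1)
    (hg : ∀ x, Moves (rotAbout q φ) x (g x) ∧ x < g x ∧ g x < x + 1) :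
    ∃ x, x + 1 ≤ f (g x) := by
  by_contra! hcon
  -- If every displacement were less than `1`, the quadratic form of the product would be negative
  -- definite.
  have hneg : ∀ a b : ℝ, (a ≠ 0 ∨ b ≠ 0) → qform (rotAbout p ϑ * rotAbout q φ) a b < 0 := by
    intro a b hab
    obtain ⟨x, r, hr, rfl, rfl⟩ := exists_polar hab
    obtain ⟨s, hs, h1⟩ := ((hg x).1.mul (hf (g x)).1).qform
    have h2 : 0 < Real.sin (π * (f (g x) - x)) :=
      sin_pi_mul_pos (by linarith [(hg x).2.1, (hf (g x)).2.1]) (by linarith [hcon x])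
    have h3 : qform (rotAbout p ϑ * rotAbout q φ) (r * Real.cos (π * x))
        (-(r * Real.sin (π * x))) = r ^ 2 * qform (rotAbout p ϑ * rotAbout q φ)
          (Real.cos (π * x)) (-Real.sin (π * x)) := by
      simp only [qform]; ring
    rw [h3, h1, mul_neg, neg_lt_zero]
    positivity
  have h1 := hneg 1 0 (Or.inl one_ne_zero)
  have h2 := hneg p.re 1 (Or.inr one_ne_zero)
  have hp := p.im_pos
  have hq := q.im_pos
  -- Up to the factor `p.im ^ 2`, this is the trace of the form with respect to the norm `|a - p
  -- b|²`, for which `(1, 0)` and `(p.re, 1)` are orthogonal. Both cosines are negative, so the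
  -- trace is positive, which contradicts definiteness.
  have h3 : p.im ^ 2 * qform (rotAbout p ϑ * rotAbout q φ) 1 0 +
      qform (rotAbout p ϑ * rotAbout q φ) p.re 1 =
      -2 * p.im * (Real.cos (ϑ / 2) * Real.sin (φ / 2) *
        (((p.re - q.re) ^ 2 + p.im ^ 2 + q.im ^ 2) / (2 * p.im * q.im)) +
        Real.sin (ϑ / 2) * Real.cos (φ / 2)) := by
    obtain ⟨e1, e2, e3, e4⟩ := rotAbout_entries p ϑ
    obtain ⟨g1, g2, g3, g4⟩ := rotAbout_entries q φ
    simp only [qform, mul_entry, e1, e2, e3, e4, g1, g2, g3, g4]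
    field_simp
    ring
  have h4 : 0 < ((p.re - q.re) ^ 2 + p.im ^ 2 + q.im ^ 2) / (2 * p.im * q.im) := by positivity
  have h5 : 0 < (-Real.cos (ϑ / 2)) * Real.sin (φ / 2) *
      (((p.re - q.re) ^ 2 + p.im ^ 2 + q.im ^ 2) / (2 * p.im * q.im)) :=
    mul_pos (mul_pos (by linarith) hφ) h4
  have h6 : 0 < Real.sin (ϑ / 2) * (-Real.cos (φ / 2)) := mul_pos hϑ (by linarith)
  nlinarith [mul_pos hp h5, mul_pos hp h6, mul_pos (pow_pos hp 2) (neg_pos.mpr h1)]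

/-! ### Representations of the sphere group -/

theorem c_rel : c 0 * c 1 * c 2 * c 3 = 1 :=
  PresentedGroup.one_of_mem (rels := ({FreeGroup.of 0 * FreeGroup.of 1 * FreeGroup.of 2 *
    FreeGroup.of 3} : Set (FreeGroup (Fin 4)))) (Set.mem_singleton _)

theorem c_three : c 3 = (c 0 * c 1 * c 2)⁻¹ := (inv_eq_of_mul_eq_one_right c_rel).symm

/-- The homomorphism sending `c i` to `g i`, for elements with product one. -/
def ofQuad {G : Type*} [Group G] (g : Fin 4 → G) (h : g 0 * g 1 * g 2 * g 3 = 1) :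
    SphereGroup →* G :=
  PresentedGroup.toGroup (f := g) (by
    intro r hr
    rw [Set.mem_singleton_iff] at hr
    rw [hr]
    simpa using h)

@[simp] theorem ofQuad_c {G : Type*} [Group G] (g : Fin 4 → G) (h : g 0 * g 1 * g 2 * g 3 = 1)
    (i : Fin 4) : ofQuad g h (c i) = g i :=
  PresentedGroup.toGroup.of _

theorem sphere_hom_ext {G : Type*} [Group G] {φ ψ : SphereGroup →* G}
    (h0 : φ (c 0) = ψ (c 0)) (h1 : φ (c 1) = ψ (c 1)) (h2 : φ (c 2) = ψ (c 2)) : φ = ψ := by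
  apply PresentedGroup.ext
  intro i
  change φ (c i) = ψ (c i)
  fin_cases i
  · exact h0
  · exact h1
  · exact h2
  · change φ (c 3) = ψ (c 3)
    simp only [c_three, map_inv, map_mul, h0, h1, h2]

/-- The projection `SL(2, ℝ) → PSL(2, ℝ)`. -/
def proj : SL(2, ℝ) →* PSL(2, ℝ) := QuotientGroup.mk' _

theorem proj_eq_iff (A B : SL(2, ℝ)) : proj A = proj B ↔ A = B ∨ A = -B := mk_eq_mk_iff A B

theorem proj_surjective : Function.Surjective proj := QuotientGroup.mk'_surjective _

theorem proj_neg (A : SL(2, ℝ)) : proj (-A) = proj A := (proj_eq_iff _ _).mpr (Or.inr rfl)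

theorem isRotationAbout_proj (g : PSL(2, ℝ)) (p : ℍ) (ϑ : ℝ) :
    IsRotationAbout g p ϑ ↔ g = proj (rotAbout p ϑ) := isRotationAbout_iff g p ϑ

/-- The angles of a Deroin--Tholozan component all of whose entries exceed `π`. -/
structure Angles (α : Fin 4 → ℝ) : Prop where
  lower : ∀ i, π < α i
  upper : ∀ i, α i < 2 * π
  sum : 6 * π < α 0 + α 1 + α 2 + α 3

namespace Angles

variable {α : Fin 4 → ℝ} (hα : Angles α)
include hα

theorem sin_pos (i : Fin 4) : 0 < Real.sin (α i / 2) := by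
  have h1 := hα.lower i
  have h2 := hα.upper i
  have := Real.pi_pos
  apply Real.sin_pos_of_pos_of_lt_pi <;> linarith

theorem cos_neg (i : Fin 4) : Real.cos (α i / 2) < 0 := by
  have h1 := hα.lower i
  have h2 := hα.upper i
  have := Real.pi_pos
  apply Real.cos_neg_of_pi_div_two_lt_of_lt <;> linarith

end Angles

/-- The lifts to `SL(2, ℝ)` of the representations in the Deroin--Tholozan component. -/
def IsLift (α : Fin 4 → ℝ) (σ : SphereGroup →* SL(2, ℝ)) (C : Fin 4 → ℍ) : Prop :=
  σ (c 0) = rotAbout (C 0) (α 0) ∧ σ (c 1) = rotAbout (C 1) (α 1) ∧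
    σ (c 2) = rotAbout (C 2) (α 2) ∧ σ (c 3) = -rotAbout (C 3) (α 3)

/-- Conjugation of a homomorphism. -/
def conjHom {G H : Type*} [Group G] [Group H] (g : H) (σ : G →* H) : G →* H :=
  (MulAut.conj g).toMonoidHom.comp σ

@[simp] theorem conjHom_apply {G H : Type*} [Group G] [Group H] (g : H) (σ : G →* H) (x : G) :
    conjHom g σ x = g * σ x * g⁻¹ := rfl

theorem IsLift.conj {α : Fin 4 → ℝ} {σ : SphereGroup →* SL(2, ℝ)} {C : Fin 4 → ℍ}
    (h : IsLift α σ C) (g : SL(2, ℝ)) : IsLift α (conjHom g σ) (fun i => g • C i) := by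
  obtain ⟨h0, h1, h2, h3⟩ := h
  refine ⟨?_, ?_, ?_, ?_⟩
  · rw [conjHom_apply, h0, conj_rotAbout]
  · rw [conjHom_apply, h1, conj_rotAbout]
  · rw [conjHom_apply, h2, conj_rotAbout]
  · rw [conjHom_apply, h3, ← conj_rotAbout, mul_neg, neg_mul]

/-- The sign carried by the last generator of a lift amounts to a product `-1` of canonical lifts,
which is the matrix covered by the third power of the full turn. -/
theorem IsLift.prod {α : Fin 4 → ℝ} {σ : SphereGroup →* SL(2, ℝ)} {C : Fin 4 → ℍ}
    (h : IsLift α σ C) : rotAbout (C 0) (α 0) * rotAbout (C 1) (α 1) * rotAbout (C 2) (α 2) *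
      rotAbout (C 3) (α 3) = -1 := by
  obtain ⟨h0, h1, h2, h3⟩ := h
  have := congrArg σ c_rel
  rw [map_mul, map_mul, map_mul, h0, h1, h2, h3, map_one, mul_neg, neg_eq_iff_eq_neg] at this
  exact this

theorem IsLift.isRotationAbout {α : Fin 4 → ℝ} {σ : SphereGroup →* SL(2, ℝ)} {C : Fin 4 → ℍ}
    (h : IsLift α σ C) (i : Fin 4) : IsRotationAbout (proj.comp σ (c i)) (C i) (α i) := by
  obtain ⟨h0, h1, h2, h3⟩ := h
  rw [isRotationAbout_proj, MonoidHom.comp_apply]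
  fin_cases i
  · exact congrArg proj h0
  · exact congrArg proj h1
  · exact congrArg proj h2
  · exact (congrArg proj h3).trans (proj_neg _)

/-- The product `-1` only says that the Euler class is `1` or `3`. One point at which the first two
lifts gain a full turn rules out `1` for a cyclic rotation of the product, and this is carried back
to the original order. -/
theorem hasEulerClass_of_isLift {α : Fin 4 → ℝ} (hα : Angles α) {σ : SphereGroup →* SL(2, ℝ)}
    {C : Fin 4 → ℍ} (h : IsLift α σ C) : HasEulerClass (proj.comp σ) 3 := by
  choose f hf using fun i => exists_circleLift (C i) (hα.sin_pos i)
  have hlt (i : Fin 4) (x : ℝ) : x < f i x := (hf i x).2.1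
  have hgt (i : Fin 4) (x : ℝ) : f i x < x + 1 := (hf i x).2.2
  have hmono (i : Fin 4) {x y : ℝ} (hxy : x ≤ y) : f i x ≤ f i y := (f i).monotone hxy
  have hprod := h.prod
  have hprod' : rotAbout (C 2) (α 2) * rotAbout (C 3) (α 3) * rotAbout (C 0) (α 0) *
      rotAbout (C 1) (α 1) = -1 := by
    have e : (rotAbout (C 0) (α 0) * rotAbout (C 1) (α 1)) *
        (rotAbout (C 2) (α 2) * rotAbout (C 3) (α 3)) = -1 := by rw [← hprod]; group
    have e2 := congrArg (fun X => (rotAbout (C 0) (α 0) * rotAbout (C 1) (α 1))⁻¹ * X *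
      (rotAbout (C 0) (α 0) * rotAbout (C 1) (α 1))) e
    simp only [inv_mul_cancel_left, mul_neg, mul_one, neg_mul, inv_mul_cancel] at e2
    rw [← e2]; group
  -- a self-map of total matrix `-1` moves points by one or three
  have step (i j k l : Fin 4) (hM : rotAbout (C i) (α i) * rotAbout (C j) (α j) *
      rotAbout (C k) (α k) * rotAbout (C l) (α l) = -1) (x : ℝ) :
      f i (f j (f k (f l x))) = x + 1 ∨ f i (f j (f k (f l x))) = x + 3 := by
    have hm := (((hf l x).1.mul (hf k _).1).mul (hf j _).1).mul (hf i _).1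
    rw [← mul_assoc, ← mul_assoc, hM] at hm
    obtain ⟨n, hn⟩ := (moves_neg_one x).unique hm
    have h1 : x < f i (f j (f k (f l x))) := by
      linarith [hlt l x, hlt k (f l x), hlt j (f k (f l x)), hlt i (f j (f k (f l x)))]
    have h2 : f i (f j (f k (f l x))) < x + 4 := by
      linarith [hgt l x, hgt k (f l x), hgt j (f k (f l x)), hgt i (f j (f k (f l x)))]
    have h3 : (-1 : ℤ) < n := by
      have : (-1 : ℝ) < n := by linarith
      exact_mod_cast this
    have h4 : n < 2 := by
      have : (n : ℝ) < 2 := by linarith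
      exact_mod_cast this
    have h5 : n = 0 ∨ n = 1 := by omega
    rcases h5 with rfl | rfl
    · left; rw [hn]; simp
    · right; rw [hn]; push_cast; ring
  obtain ⟨y, hy⟩ := exists_add_one_le (hα.sin_pos 0) (hα.cos_neg 0) (hα.sin_pos 1) (hα.cos_neg 1)
    (hf 0) (hf 1)
  have hy3 : f 2 (f 3 (f 0 (f 1 y))) = y + 3 := by
    rcases step 2 3 0 1 hprod' y with h1 | h1
    · have h2 : f 2 (f 3 (y + 1)) ≤ f 2 (f 3 (f 0 (f 1 y))) := hmono 2 (hmono 3 hy)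
      have := hlt 3 (y + 1)
      have := hlt 2 (f 3 (y + 1))
      linarith
    · exact h1
  -- The cyclically rotated product moves `y` by `3`, so the original product moves the image `z` of
  -- `y` by `3`.
  set z := f 0 (f 1 y) with hz
  have hz3 : f 0 (f 1 (f 2 (f 3 z))) = z + 3 := by
    rw [hy3]
    have e1 : f 1 (y + 3) = f 1 y + 3 := by exact_mod_cast (f 1).map_add_nat y 3
    rw [e1]
    exact_mod_cast (f 0).map_add_nat (f 1 y) 3
  refine ⟨f, fun i => ⟨?_, fun x => ⟨hlt i x, hgt i x⟩⟩, fun x => ?_⟩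
  · have h1 := (isRotationAbout_proj _ _ _).mp (h.isRotationAbout i)
    rw [h1]
    exact isCircleLift_of_moves fun x => (hf i x).1
  · change f 0 (f 1 (f 2 (f 3 x))) = x + ((3 : ℤ) : ℝ)
    push_cast
    rcases step 0 1 2 3 hprod x with h1 | h1
    · exfalso
      -- If `x` moved by `1` only, comparing it by monotonicity with the translate `z + n ≤ x < z +
      -- n + 1`, which moves by `3`, would be contradictory.
      set n := ⌊x - z⌋ with hn
      have hn1 := Int.floor_le (x - z)
      have hn2 := Int.lt_floor_add_one (x - z)
      rw [← hn] at hn1 hn2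
      have hle : z + n ≤ x := by linarith
      have h2 := hmono 0 (hmono 1 (hmono 2 (hmono 3 hle)))
      simp only [CircleDeg1Lift.map_add_int, hz3] at h2
      linarith
    · exact h1

/-- The product of the canonical lifts is `±1`. As it is covered by the translation by `3`, and the
identity is covered only by even translations, it is `-1`; changing the sign of one factor then
gives a homomorphism. -/
theorem exists_isLift_of_mem_DT {α : Fin 4 → ℝ} (hα : Angles α) {ρ : Representation}
    (h : ⟦ρ⟧ ∈ DT α) : ∃ σ C, IsLift α σ C ∧ proj.comp σ = ρ := by
  obtain ⟨⟨ρ₁, hρ₁, hrot⟩, ρ₂, hρ₂, f, hf, hprod⟩ := h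
  choose p hp using hrot
  -- The rotation angles and the Euler class are given on possibly different representatives of the
  -- class, so everything is carried to the second one, and at the end to `ρ`.
  obtain ⟨g₁, hg₁⟩ := Quotient.exact (hρ₁.trans hρ₂.symm)
  obtain ⟨g₂, hg₂⟩ := Quotient.exact hρ₂
  obtain ⟨h₁, rfl⟩ := proj_surjective g₁
  obtain ⟨h₂, rfl⟩ := proj_surjective g₂
  have hrot (i : Fin 4) : ρ₂ (c i) = proj (rotAbout (h₁ • p i) (α i)) := by
    rw [hg₁, (isRotationAbout_proj _ _ _).mp (hp i), ← conj_rotAbout]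
    simp only [map_mul, map_inv]
  have hm (i : Fin 4) (x : ℝ) : Moves (rotAbout (h₁ • p i) (α i)) x (f i x) := by
    refine moves_of_isCircleLift (hα.sin_pos i) ?_ (hf i).2 x
    have := (hf i).1
    rwa [hrot] at this
  have hM : rotAbout (h₁ • p 0) (α 0) * rotAbout (h₁ • p 1) (α 1) * rotAbout (h₁ • p 2) (α 2) *
      rotAbout (h₁ • p 3) (α 3) = -1 := by
    have h1 : proj (rotAbout (h₁ • p 0) (α 0) * rotAbout (h₁ • p 1) (α 1) *
        rotAbout (h₁ • p 2) (α 2) * rotAbout (h₁ • p 3) (α 3)) = proj 1 := by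
      simp only [map_mul, ← hrot, map_one]
      rw [← map_mul, ← map_mul, ← map_mul, c_rel, map_one]
    rcases (proj_eq_iff _ _).mp h1 with h2 | h2
    · exfalso
      have hmm := (((hm 3 0).mul (hm 2 _)).mul (hm 1 _)).mul (hm 0 _)
      rw [← mul_assoc, ← mul_assoc, h2] at hmm
      obtain ⟨n, hn⟩ := (moves_one 0).unique hmm
      have h3 : f 0 (f 1 (f 2 (f 3 0))) = 0 + ((3 : ℤ) : ℝ) := hprod 0
      rw [hn] at h3
      have h4 : 2 * n = 3 := by
        have : (2 : ℝ) * n = 3 := by push_cast at h3; linarith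
        exact_mod_cast this
      omega
    · exact h2
  set A : Fin 4 → SL(2, ℝ) := ![rotAbout (h₁ • p 0) (α 0), rotAbout (h₁ • p 1) (α 1),
    rotAbout (h₁ • p 2) (α 2), -rotAbout (h₁ • p 3) (α 3)] with hA
  have hA1 : A 0 * A 1 * A 2 * A 3 = 1 := by
    have h1 : -(rotAbout (h₁ • p 0) (α 0) * rotAbout (h₁ • p 1) (α 1) * rotAbout (h₁ • p 2) (α 2) *
        rotAbout (h₁ • p 3) (α 3)) = 1 := by rw [hM, neg_neg]
    exact (mul_neg _ _).trans h1
  have hl : IsLift α (ofQuad A hA1) (fun i => h₁ • p i) := by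
    refine ⟨?_, ?_, ?_, ?_⟩ <;> rw [ofQuad_c] <;> rfl
  have hρ : proj.comp (ofQuad A hA1) = ρ₂ := by
    apply sphere_hom_ext <;> rw [MonoidHom.comp_apply, ofQuad_c, hrot] <;> rfl
  refine ⟨conjHom h₂ (ofQuad A hA1), _, hl.conj h₂, ?_⟩
  refine MonoidHom.ext fun x => ?_
  rw [MonoidHom.comp_apply, conjHom_apply, hg₂ x, ← hρ]
  simp only [map_mul, map_inv, MonoidHom.comp_apply]

theorem mem_DT_iff {α : Fin 4 → ℝ} (hα : Angles α) (ρ : Representation) :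
    ⟦ρ⟧ ∈ DT α ↔ ∃ σ C, IsLift α σ C ∧ proj.comp σ = ρ := by
  refine ⟨exists_isLift_of_mem_DT hα, ?_⟩
  rintro ⟨σ, C, h, rfl⟩
  exact ⟨⟨_, rfl, fun i => ⟨C i, h.isRotationAbout i⟩⟩, _, rfl, hasEulerClass_of_isLift hα h⟩

/-- Lifts of conjugate representations are conjugate. -/
theorem IsLift.exists_conj {α : Fin 4 → ℝ} (hα : Angles α) {σ τ : SphereGroup →* SL(2, ℝ)}
    {C D : Fin 4 → ℍ} (hσ : IsLift α σ C) (hτ : IsLift α τ D)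
    (h : (⟦proj.comp σ⟧ : Rep) = ⟦proj.comp τ⟧) : ∃ g, τ = conjHom g σ := by
  obtain ⟨g, hg⟩ := Quotient.exact h
  obtain ⟨k, rfl⟩ := proj_surjective g
  refine ⟨k, ?_⟩
  have hc := hσ.conj k
  have key (i : Fin 4) {A B : SL(2, ℝ)} (hA : A = rotAbout (D i) (α i))
      (hB : B = rotAbout (k • C i) (α i)) (hAB : proj A = proj B) : A = B := by
    rcases (proj_eq_iff _ _).mp hAB with h1 | h1
    · exact h1
    · rw [hA, hB] at h1
      exact absurd h1 (rotAbout_ne_neg (hα.sin_pos i) (hα.sin_pos i))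
  have hp (x : SphereGroup) : proj (τ x) = proj (conjHom k σ x) := by
    have := hg x
    simpa only [MonoidHom.comp_apply, conjHom_apply, map_mul, map_inv] using this
  exact sphere_hom_ext (key 0 hτ.1 hc.1 (hp _)) (key 1 hτ.2.1 hc.2.1 (hp _))
    (key 2 hτ.2.2.1 hc.2.2.1 (hp _))

theorem class_conjHom (g : SL(2, ℝ)) (σ : SphereGroup →* SL(2, ℝ)) :
    (⟦proj.comp (conjHom g σ)⟧ : Rep) = ⟦proj.comp σ⟧ := by
  symm
  refine Quotient.sound ⟨proj g, fun x => ?_⟩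
  simp only [MonoidHom.comp_apply, conjHom_apply, map_mul, map_inv]

/-! ### Configurations of points in the hyperbolic plane -/

/-- The hyperbolic cosine of the distance of two points. -/
noncomputable def chi (p q : ℍ) : ℝ :=
  ((p.re - q.re) ^ 2 + p.im ^ 2 + q.im ^ 2) / (2 * p.im * q.im)

theorem chi_comm (p q : ℍ) : chi p q = chi q p := by
  rw [chi, chi]
  congr 1 <;> ring

theorem one_le_chi (p q : ℍ) : 1 ≤ chi p q := by
  have hp := p.im_pos
  have hq := q.im_pos
  rw [chi, le_div_iff₀ (by positivity)]
  nlinarith [sq_nonneg (p.re - q.re), sq_nonneg (p.im - q.im)]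

theorem chi_eq_one {p q : ℍ} : chi p q = 1 ↔ p = q := by
  have hp := p.im_pos
  have hq := q.im_pos
  constructor
  · intro h
    rw [chi, div_eq_one_iff_eq (by positivity)] at h
    have h1 : (p.re - q.re) ^ 2 + (p.im - q.im) ^ 2 = 0 := by linarith
    have h2 : p.re - q.re = 0 := by nlinarith [sq_nonneg (p.re - q.re), sq_nonneg (p.im - q.im)]
    have h3 : p.im - q.im = 0 := by nlinarith [sq_nonneg (p.re - q.re), sq_nonneg (p.im - q.im)]
    exact UpperHalfPlane.ext_re_im (by linarith) (by linarith)
  · rintro rfl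
    rw [chi, div_eq_one_iff_eq (by positivity)]
    ring

/-- The mixed product of three points on the hyperboloid. -/
noncomputable def trip (p q r : ℍ) : ℝ :=
  tr (rotAbout p π * rotAbout q π * rotAbout r π)

/-- The hyperbolic law of cosines in trace form: for fixed angles the trace of the product and the
distance of the centres determine each other. -/
theorem tr_mul_rotAbout (p q : ℍ) (ϑ φ : ℝ) : tr (rotAbout p ϑ * rotAbout q φ) =
    2 * Real.cos (ϑ / 2) * Real.cos (φ / 2) - 2 * Real.sin (ϑ / 2) * Real.sin (φ / 2) * chi p q := by
  have hp := p.im_pos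
  have hq := q.im_pos
  obtain ⟨e1, e2, e3, e4⟩ := rotAbout_entries p ϑ
  obtain ⟨g1, g2, g3, g4⟩ := rotAbout_entries q φ
  simp only [tr, mul_entry, e1, e2, e3, e4, g1, g2, g3, g4, chi]
  field_simp
  ring

theorem tr_mul_half_turn (p q : ℍ) : tr (rotAbout p π * rotAbout q π) = -2 * chi p q := by
  rw [tr_mul_rotAbout, Real.cos_pi_div_two, Real.sin_pi_div_two]; ring

/-- A rotation is `cos + sin · J` with `J` the half turn about the same centre, so traces of
products expand multilinearly in traces of half turns. -/
theorem rotAbout_entry_decomp (p : ℍ) (ϑ : ℝ) (i j : Fin 2) : (rotAbout p ϑ).1 i j =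
    Real.cos (ϑ / 2) * (1 : Matrix (Fin 2) (Fin 2) ℝ) i j +
      Real.sin (ϑ / 2) * (rotAbout p π).1 i j := by
  obtain ⟨e1, e2, e3, e4⟩ := rotAbout_entries p ϑ
  obtain ⟨g1, g2, g3, g4⟩ := rotAbout_entries p π
  simp only [Real.cos_pi_div_two, Real.sin_pi_div_two] at g1 g2 g3 g4
  fin_cases i <;> fin_cases j
  · change (rotAbout p ϑ).1 0 0 = _ * (1 : Matrix (Fin 2) (Fin 2) ℝ) 0 0 + _ * (rotAbout p π).1 0 0
    rw [e1, g1]; simp; ring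
  · change (rotAbout p ϑ).1 0 1 = _ * (1 : Matrix (Fin 2) (Fin 2) ℝ) 0 1 + _ * (rotAbout p π).1 0 1
    rw [e2, g2]; simp
  · change (rotAbout p ϑ).1 1 0 = _ * (1 : Matrix (Fin 2) (Fin 2) ℝ) 1 0 + _ * (rotAbout p π).1 1 0
    rw [e3, g3]; simp
  · change (rotAbout p ϑ).1 1 1 = _ * (1 : Matrix (Fin 2) (Fin 2) ℝ) 1 1 + _ * (rotAbout p π).1 1 1
    rw [e4, g4]; simp

theorem tr_mul_mul_rotAbout (p q r : ℍ) (ϑ φ ψ : ℝ) :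
    tr (rotAbout p ϑ * rotAbout q φ * rotAbout r ψ) =
      2 * Real.cos (ϑ / 2) * Real.cos (φ / 2) * Real.cos (ψ / 2)
      - 2 * (Real.cos (ϑ / 2) * Real.sin (φ / 2) * Real.sin (ψ / 2) * chi q r
        + Real.sin (ϑ / 2) * Real.cos (φ / 2) * Real.sin (ψ / 2) * chi p r
        + Real.sin (ϑ / 2) * Real.sin (φ / 2) * Real.cos (ψ / 2) * chi p q)
      + Real.sin (ϑ / 2) * Real.sin (φ / 2) * Real.sin (ψ / 2) * trip p q r := by
  have h1 := tr_mul_half_turn q r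
  have h2 := tr_mul_half_turn p r
  have h3 := tr_mul_half_turn p q
  have t1 := tr_rotAbout p π
  have t2 := tr_rotAbout q π
  have t3 := tr_rotAbout r π
  simp only [trip, tr, mul_entry, Real.cos_pi_div_two] at h1 h2 h3 t1 t2 t3 ⊢
  simp only [rotAbout_entry_decomp p ϑ, rotAbout_entry_decomp q φ, rotAbout_entry_decomp r ψ]
  simp only [Matrix.one_apply_eq, Matrix.one_apply_ne (zero_ne_one : (0 : Fin 2) ≠ 1),
    Matrix.one_apply_ne (one_ne_zero : (1 : Fin 2) ≠ 0)]
  linear_combination Real.cos (ϑ / 2) * Real.sin (φ / 2) * Real.sin (ψ / 2) * h1 +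
    Real.sin (ϑ / 2) * Real.cos (φ / 2) * Real.sin (ψ / 2) * h2 +
    Real.sin (ϑ / 2) * Real.sin (φ / 2) * Real.cos (ψ / 2) * h3 +
    Real.sin (ϑ / 2) * Real.cos (φ / 2) * Real.cos (ψ / 2) * t1 +
    Real.cos (ϑ / 2) * Real.sin (φ / 2) * Real.cos (ψ / 2) * t2 +
    Real.cos (ϑ / 2) * Real.cos (φ / 2) * Real.sin (ψ / 2) * t3

theorem chi_smul (h : SL(2, ℝ)) (p q : ℍ) : chi (h • p) (h • q) = chi p q := by
  have h1 := tr_mul_half_turn (h • p) (h • q)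
  rw [← conj_rotAbout, ← conj_rotAbout] at h1
  have h2 : h * rotAbout p π * h⁻¹ * (h * rotAbout q π * h⁻¹) =
      h * (rotAbout p π * rotAbout q π) * h⁻¹ := by group
  rw [h2, tr_conj, tr_mul_half_turn] at h1
  linarith

theorem trip_smul (h : SL(2, ℝ)) (p q r : ℍ) : trip (h • p) (h • q) (h • r) = trip p q r := by
  have h2 : h * rotAbout p π * h⁻¹ * (h * rotAbout q π * h⁻¹) * (h * rotAbout r π * h⁻¹) =
      h * (rotAbout p π * rotAbout q π * rotAbout r π) * h⁻¹ := by group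
  rw [trip, ← conj_rotAbout, ← conj_rotAbout, ← conj_rotAbout, h2, tr_conj, trip]

/-- Two points can be moved to `i` and to a point above `i` on the imaginary axis. -/
theorem exists_smul_normal (p q : ℍ) :
    ∃ h : SL(2, ℝ), h • p = UpperHalfPlane.I ∧ (h • q).re = 0 ∧ 1 ≤ (h • q).im := by
  obtain ⟨g, hg⟩ := MulAction.exists_smul_eq SL(2, ℝ) p UpperHalfPlane.I
  set s := g • q with hs
  have hv := s.im_pos
  -- Up to a positive factor, `w` is the conjugate of the disc coordinate `(s - i) / (s + i)`. The
  -- rotation about `i` by `w.arg` makes that coordinate nonnegative, which puts the point on the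
  -- imaginary axis, at or above `i`.
  set w : ℂ := ⟨s.re ^ 2 + s.im ^ 2 - 1, 2 * s.re⟩ with hw
  have hc : ‖w‖ * Real.cos w.arg = s.re ^ 2 + s.im ^ 2 - 1 := Complex.norm_mul_cos_arg w
  have hsn : ‖w‖ * Real.sin w.arg = 2 * s.re := Complex.norm_mul_sin_arg w
  have hcos : Real.cos w.arg = 2 * Real.cos (w.arg / 2) ^ 2 - 1 := by
    rw [← Real.cos_two_mul]; congr 1; ring
  have hsin : Real.sin w.arg = 2 * Real.sin (w.arg / 2) * Real.cos (w.arg / 2) := by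
    rw [← Real.sin_two_mul]; congr 1; ring
  have hsq := Real.sin_sq_add_cos_sq (w.arg / 2)
  have hI : rot w.arg • UpperHalfPlane.I = UpperHalfPlane.I := by
    have h1 := conj_rotAbout (rot w.arg) UpperHalfPlane.I π
    rw [rot_eq, rotAbout_mul, rotAbout_inv, rotAbout_mul] at h1
    have h2 : w.arg + π + -w.arg = π := by ring
    rw [h2] at h1
    rw [rot_eq]
    exact (center_injective (by rw [Real.sin_pi_div_two]; exact one_pos) rfl h1).symm
  obtain ⟨hpos, him, hre⟩ := smul_re_im (rot w.arg) s
  obtain ⟨e1, e2, e3, e4⟩ := rotAbout_entries UpperHalfPlane.I w.arg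
  rw [← rot_eq] at e1 e2 e3 e4
  simp only [UpperHalfPlane.I_re, UpperHalfPlane.I_im] at e1 e2 e3 e4
  norm_num at e1 e2 e3 e4
  rw [e3, e4] at hpos
  rw [e3, e4] at him
  rw [e1, e2, e3, e4] at hre
  refine ⟨rot w.arg * g, ?_, ?_, ?_⟩
  · rw [mul_smul, hg, hI]
  · rw [mul_smul, ← hs, hre]
    apply div_eq_zero_iff.mpr
    left
    have h0 : 2 * (‖w‖ * Real.sin w.arg * Real.cos w.arg - ‖w‖ * Real.cos w.arg * Real.sin w.arg) = 0 := by
      ring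
    rw [hc, hsn, hcos, hsin] at h0
    linear_combination (1 / 4 : ℝ) * h0 - s.re * hsq
  · rw [mul_smul, ← hs, him, one_le_div hpos]
    have hn : ‖w‖ ^ 2 = (s.re ^ 2 + s.im ^ 2 - 1) ^ 2 + (2 * s.re) ^ 2 := by
      rw [← hc, ← hsn]
      linear_combination -‖w‖ ^ 2 * Real.sin_sq_add_cos_sq w.arg
    have h1 : ‖w‖ = Real.cos w.arg * (s.re ^ 2 + s.im ^ 2 - 1) + Real.sin w.arg * (2 * s.re) := by
      rw [← hc, ← hsn]
      linear_combination -‖w‖ * Real.sin_sq_add_cos_sq w.arg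
    have h2 : (-(Real.sin (w.arg / 2) * s.re) + Real.cos (w.arg / 2)) ^ 2 +
        (-(Real.sin (w.arg / 2) * s.im)) ^ 2 = (1 + s.re ^ 2 + s.im ^ 2 - ‖w‖) / 2 := by
      rw [h1, hcos, hsin]
      linear_combination (s.re ^ 2 + s.im ^ 2) * hsq
    have h3 : 0 ≤ 1 + s.re ^ 2 + s.im ^ 2 - 2 * s.im := by nlinarith [sq_nonneg s.re, sq_nonneg (s.im - 1)]
    have h4 : 1 + s.re ^ 2 + s.im ^ 2 - 2 * s.im ≤ ‖w‖ := by
      apply (pow_le_pow_iff_left₀ h3 (norm_nonneg w) two_ne_zero).mp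
      rw [hn]
      nlinarith
    simp only [neg_mul] at h2 ⊢
    linarith

theorem eq_of_add_inv_eq {y z : ℝ} (hy : 1 ≤ y) (hz : 1 ≤ z)
    (h : (1 + y ^ 2) / (2 * y) = (1 + z ^ 2) / (2 * z)) : y = z := by
  rw [div_eq_div_iff (by positivity) (by positivity)] at h
  have h1 : (y - z) * (y * z - 1) = 0 := by linarith
  rcases mul_eq_zero.mp h1 with h2 | h2
  · linarith
  · nlinarith

theorem chi_I (q : ℍ) (hq : q.re = 0) : chi UpperHalfPlane.I q = (1 + q.im ^ 2) / (2 * q.im) := by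
  rw [chi]
  simp [hq]

/-- Two pairs of points at the same distance are congruent. -/
theorem exists_smul_pair {p q p' q' : ℍ} (h : chi p q = chi p' q') :
    ∃ g : SL(2, ℝ), g • p = p' ∧ g • q = q' := by
  obtain ⟨a, ha, ha0, ha1⟩ := exists_smul_normal p q
  obtain ⟨b, hb, hb0, hb1⟩ := exists_smul_normal p' q'
  rw [← chi_smul a, ← chi_smul b p' q', ha, hb, chi_I _ ha0, chi_I _ hb0] at h
  have h1 : a • q = b • q' := UpperHalfPlane.ext_re_im (ha0.trans hb0.symm) (eq_of_add_inv_eq ha1 hb1 h)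
  exact ⟨b⁻¹ * a, by rw [mul_smul, ha, ← hb, inv_smul_smul], by rw [mul_smul, h1, inv_smul_smul]⟩

/-- Two triples of points with the same distances and orientation are congruent. -/
theorem exists_smul_triple {p q r p' q' r' : ℍ} (h12 : chi p q = chi p' q')
    (h13 : chi p r = chi p' r') (h23 : chi q r = chi q' r') (h123 : trip p q r = trip p' q' r') :
    ∃ g : SL(2, ℝ), g • p = p' ∧ g • q = q' ∧ g • r = r' := by
  by_cases hpq : p = q
  · subst hpq
    have hpq' : p' = q' := by rw [← chi_eq_one, ← h12, chi_eq_one]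
    subst hpq'
    obtain ⟨g, hg, hg'⟩ := exists_smul_pair h13
    exact ⟨g, hg, hg, hg'⟩
  obtain ⟨g, hgp, hgq⟩ := exists_smul_pair h12
  obtain ⟨a, ha, ha0, ha1⟩ := exists_smul_normal p' q'
  refine ⟨g, hgp, hgq, ?_⟩
  have hne : a • q' ≠ UpperHalfPlane.I := by
    rw [← ha]
    intro h0
    have := smul_left_cancel a h0
    rw [← hgp, ← hgq] at this
    exact hpq (smul_left_cancel g this).symm
  rw [← chi_smul g p r, hgp, ← chi_smul a, ← chi_smul a p' r', ha] at h13
  rw [← chi_smul g q r, hgq, ← chi_smul a, ← chi_smul a q' r'] at h23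
  rw [← trip_smul g p q r, hgp, hgq, ← trip_smul a, ← trip_smul a p' q' r', ha] at h123
  set u := a • (g • r) with hu
  set v := a • r' with hv
  set t := a • q' with ht
  have hy1 : t.im ≠ 1 := by
    intro h1
    exact hne (UpperHalfPlane.ext_re_im (by simpa using ha0) (by simpa using h1))
  have hup := u.im_pos
  have hvp := v.im_pos
  have htp := t.im_pos
  have hy2 : t.im ^ 2 - 1 ≠ 0 := by
    intro h0
    have : (t.im - 1) * (t.im + 1) = 0 := by linarith
    rcases mul_eq_zero.mp this with h1 | h1
    · exact hy1 (by linarith)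
    · linarith
  -- With the first point at `i` and the second elsewhere on the imaginary axis, the two distances
  -- leave a reflection in this axis undetermined; the mixed product fixes the sign of the real
  -- part.
  have htrip : ∀ s : ℍ, trip UpperHalfPlane.I t s = s.re / s.im * (1 / t.im - t.im) := by
    intro s
    have hsp := s.im_pos
    obtain ⟨e1, e2, e3, e4⟩ := rotAbout_entries UpperHalfPlane.I π
    obtain ⟨f1, f2, f3, f4⟩ := rotAbout_entries t π
    obtain ⟨g1, g2, g3, g4⟩ := rotAbout_entries s π
    simp only [trip, tr, mul_entry, e1, e2, e3, e4, f1, f2, f3, f4, g1, g2, g3, g4, ha0,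
      Real.cos_pi_div_two, Real.sin_pi_div_two, UpperHalfPlane.I_re, UpperHalfPlane.I_im]
    field_simp
    ring
  rw [htrip, htrip] at h123
  have hre : u.re / u.im = v.re / v.im := by
    apply mul_right_cancel₀ _ h123
    intro h0
    apply hy2
    field_simp at h0
    linarith
  simp only [chi, UpperHalfPlane.I_re, UpperHalfPlane.I_im, ha0] at h13 h23
  have him : u.im = v.im := by
    have h1 : (t.im ^ 2 - 1) / (2 * u.im) = (t.im ^ 2 - 1) / (2 * v.im) := by
      -- This combination of the two distances eliminates the real part and leaves a nonzero
      -- multiple of `1 / s.im`.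
      have e : ∀ s : ℍ, (t.im ^ 2 - 1) / (2 * s.im) =
          t.im * (((0 - s.re) ^ 2 + t.im ^ 2 + s.im ^ 2) / (2 * t.im * s.im)) -
            ((0 - s.re) ^ 2 + 1 ^ 2 + s.im ^ 2) / (2 * 1 * s.im) := by
        intro s
        have hsp := s.im_pos
        field_simp
        ring
      rw [e, e, h13, h23]
    field_simp at h1
    linarith
  have hre' : u.re = v.re := by
    rw [him] at hre
    field_simp at hre
    exact hre
  exact smul_left_cancel a (UpperHalfPlane.ext_re_im hre' him)

/-- The three trace coordinates determine the class of a lift. -/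
theorem IsLift.exists_conj_of_tr {α : Fin 4 → ℝ} (hα : Angles α) {σ τ : SphereGroup →* SL(2, ℝ)}
    {C D : Fin 4 → ℍ} (hσ : IsLift α σ C) (hτ : IsLift α τ D)
    (hx : tr (σ (c 0 * c 1)) = tr (τ (c 0 * c 1))) (hy : tr (σ (c 1 * c 2)) = tr (τ (c 1 * c 2)))
    (hz : tr (σ (c 0 * c 2)) = tr (τ (c 0 * c 2))) : ∃ g, τ = conjHom g σ := by
  have s0 := hα.sin_pos 0
  have s1 := hα.sin_pos 1
  have s2 := hα.sin_pos 2
  -- The orientation of the triple is not among the three coordinates. It comes from this fourth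
  -- trace, which the angle at the last puncture prescribes.
  have hw : tr (σ (c 0 * c 1 * c 2)) = tr (τ (c 0 * c 1 * c 2)) := by
    have e : c 0 * c 1 * c 2 = (c 3)⁻¹ := by rw [c_three, inv_inv]
    rw [e, map_inv, map_inv, tr_inv, tr_inv, hσ.2.2.2, hτ.2.2.2, tr_neg, tr_neg, tr_rotAbout,
      tr_rotAbout]
  obtain ⟨a0, a1, a2, -⟩ := hσ
  obtain ⟨b0, b1, b2, -⟩ := hτ
  simp only [map_mul, a0, a1, a2, b0, b1, b2, tr_mul_rotAbout, tr_mul_mul_rotAbout] at hx hy hz hw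
  have k12 : chi (C 0) (C 1) = chi (D 0) (D 1) := by
    apply mul_left_cancel₀ (mul_pos s0 s1).ne'; linarith
  have k23 : chi (C 1) (C 2) = chi (D 1) (D 2) := by
    apply mul_left_cancel₀ (mul_pos s1 s2).ne'; linarith
  have k13 : chi (C 0) (C 2) = chi (D 0) (D 2) := by
    apply mul_left_cancel₀ (mul_pos s0 s2).ne'; linarith
  have k123 : trip (C 0) (C 1) (C 2) = trip (D 0) (D 1) (D 2) := by
    rw [k12, k23, k13] at hw
    apply mul_left_cancel₀ (mul_pos (mul_pos s0 s1) s2).ne'; linarith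
  obtain ⟨g, g0, g1, g2⟩ := exists_smul_triple k12 k13 k23 k123
  refine ⟨g, sphere_hom_ext ?_ ?_ ?_⟩
  · rw [conjHom_apply, a0, conj_rotAbout, g0, b0]
  · rw [conjHom_apply, a1, conj_rotAbout, g1, b1]
  · rw [conjHom_apply, a2, conj_rotAbout, g2, b2]

/-! ### Artin's reduction for triples of conjugates of free generators -/

section Artin

open FreeGroup

variable {ι : Type*}

theorem mk_true (a : ι) : FreeGroup.mk [(a, true)] = FreeGroup.of a := rfl

theorem mk_false (a : ι) : FreeGroup.mk [(a, false)] = (FreeGroup.of a)⁻¹ := rfl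

/-- Cancellation could only occur at the two junctions, and the hypotheses forbid the inverse
letters there. -/
theorem isReduced_cons_concat {a b : ι} {p : List (ι × Bool)} (hp : IsReduced p)
    (ha : ∀ m, p ≠ (a, false) :: m) (hb : ∀ m, p ≠ m ++ [(b, false)]) :
    IsReduced ([(a, true)] ++ (p ++ [(b, true)])) := by
  refine List.isChain_append.mpr ⟨by simp, List.isChain_append.mpr ⟨hp, by simp, ?_⟩, ?_⟩
  · intro x hx y hy hxy
    simp only [List.head?_cons, Option.mem_def, Option.some.injEq] at hy
    subst hy
    obtain ⟨m, hm⟩ := List.getLast?_eq_some_iff.mp hx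
    by_contra hcon
    apply hb m
    rw [hm]
    congr 2
    exact Prod.ext hxy (by simpa using hcon)
  · intro x hx y hy hxy
    simp only [List.getLast?_singleton, Option.mem_def, Option.some.injEq] at hx
    subst hx
    cases p with
    | nil =>
      simp only [List.nil_append, List.head?_cons, Option.mem_def, Option.some.injEq] at hy
      rw [← hy]
    | cons z p =>
      simp only [List.cons_append, List.head?_cons, Option.mem_def, Option.some.injEq] at hy
      subst hy
      by_contra hcon
      apply ha p
      congr 1
      exact Prod.ext hxy.symm (Bool.eq_false_of_not_eq_true fun h => hcon h.symm)

variable [DecidableEq ι]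

theorem exists_common_prefix {β : Type*} [DecidableEq β] (u v : List β) :
    ∃ l r t : List β, u = l ++ r ∧ v = l ++ t ∧ ∀ x ∈ r.head?, ∀ y ∈ t.head?, x ≠ y := by
  induction u generalizing v with
  | nil => exact ⟨[], [], v, rfl, rfl, by simp⟩
  | cons a u ih =>
    cases v with
    | nil => exact ⟨[], a :: u, [], rfl, rfl, by simp⟩
    | cons b v =>
      by_cases hab : a = b
      · subst hab
        obtain ⟨l, r, t, rfl, rfl, h⟩ := ih v
        exact ⟨a :: l, r, t, rfl, rfl, h⟩
      · exact ⟨[], a :: u, b :: v, rfl, rfl, by simpa using hab⟩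

theorem isReduced_invRev {L : List (ι × Bool)} (h : IsReduced L) : IsReduced (invRev L) := by
  have h1 : (FreeGroup.mk L)⁻¹.toWord = invRev L := by
    rw [toWord_inv, toWord_mk, h.reduce_eq]
  rw [← h1]
  exact isReduced_toWord

/-- If the reduced word of `g⁻¹ h` starts with a letter, then either that letter shortens `g` or
conjugating its inverse by `g` shortens `h`. -/
theorem norm_lt_of_toWord_eq_cons {g h : FreeGroup ι} {a : ι} {s : Bool} {m : List (ι × Bool)}
    (hp : (g⁻¹ * h).toWord = (a, s) :: m) :
    norm (g * FreeGroup.mk [(a, s)]) < norm g ∨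
      norm (g * FreeGroup.mk [(a, !s)] * g⁻¹ * h) < norm h := by
  obtain ⟨l, r, t, hu, hv, hne⟩ := exists_common_prefix g.toWord h.toWord
  have hgr : IsReduced (l ++ r) := hu ▸ isReduced_toWord
  have hht : IsReduced (l ++ t) := hv ▸ isReduced_toWord
  have hr : IsReduced r := hgr.infix ⟨l, [], by simp⟩
  have ht : IsReduced t := hht.infix ⟨l, [], by simp⟩
  have hg : g = FreeGroup.mk l * FreeGroup.mk r := by rw [mul_mk, ← hu, mk_toWord]
  have hh : h = FreeGroup.mk l * FreeGroup.mk t := by rw [mul_mk, ← hv, mk_toWord]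
  have hgn : norm g = l.length + r.length := by rw [FreeGroup.norm, hu, List.length_append]
  have hhn : norm h = l.length + t.length := by rw [FreeGroup.norm, hv, List.length_append]
  -- Once the longest common prefix is removed, nothing cancels between the remainders, so this is
  -- the reduced word of `g⁻¹ h`.
  have hred : IsReduced (invRev r ++ t) := by
    refine List.isChain_append.mpr ⟨isReduced_invRev hr, ht, ?_⟩
    intro x hx y hy hxy
    cases r with
    | nil => simp [invRev] at hx
    | cons z r =>
      simp [invRev] at hx
      have := hne z (by simp) y hy
      rw [← hx] at hxy ⊢
      simp only at hxy ⊢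
      by_contra hcon
      apply this
      refine Prod.ext hxy ?_
      cases hz : z.2 <;> cases hyy : y.2 <;> simp_all
  have hword : (g⁻¹ * h).toWord = invRev r ++ t := by
    have : g⁻¹ * h = FreeGroup.mk (invRev r ++ t) := by
      rw [← mul_mk, ← inv_mk, hg, hh]; group
    rw [this, toWord_mk, hred.reduce_eq]
  rw [hword] at hp
  -- If `r` is empty, the given letter begins the remainder `t` of `h`, and the conjugation removes
  -- it. Otherwise it is the inverse of the last letter of `g`.
  rcases List.eq_nil_or_concat r with rfl | ⟨r', x, rfl⟩
  · right
    simp only [invRev, List.map_nil, List.reverse_nil, List.nil_append] at hp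
    have h1 : g * FreeGroup.mk [(a, !s)] * g⁻¹ * h = FreeGroup.mk (l ++ m) := by
      have h2 : FreeGroup.mk [(a, !s)] * FreeGroup.mk t = FreeGroup.mk m := by
        have h3 : FreeGroup.mk [(a, !s)] = (FreeGroup.mk [(a, s)])⁻¹ := by simp [inv_mk, invRev]
        rw [hp, h3, inv_mul_eq_iff_eq_mul, mul_mk]
        rfl
      have h3 : FreeGroup.mk ([] : List (ι × Bool)) = 1 := rfl
      rw [← mul_mk, ← h2, hg, hh, h3]
      group
    rw [h1, hhn, hp]
    refine norm_mk_le.trans_lt ?_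
    simp
  · left
    simp [invRev] at hp
    obtain ⟨⟨h1, h2⟩, -⟩ := hp
    have h3 : g * FreeGroup.mk [(a, s)] = FreeGroup.mk (l ++ r') := by
      have h4 : FreeGroup.mk [(a, s)] = (FreeGroup.mk [x])⁻¹ := by
        simp [inv_mk, invRev, h1, h2]
      rw [h4, hg, List.concat_eq_append, ← mul_mk, ← mul_mk]
      group
    rw [h3, hgn]
    refine norm_mk_le.trans_lt ?_
    simp

/-- The case `h = 1` of `norm_lt_of_toWord_eq_cons`: the trivial word cannot be shortened, so a
cancellation would shorten `g`. -/
theorem isReduced_cons_toWord_inv {g : FreeGroup ι} {a : ι}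
    (h : norm g ≤ norm (g * FreeGroup.mk [(a, false)])) :
    IsReduced ([(a, true)] ++ g⁻¹.toWord) := by
  refine List.isChain_append.mpr ⟨by simp, isReduced_toWord, ?_⟩
  intro x hx y hy hxy
  simp only [List.getLast?_singleton, Option.mem_def, Option.some.injEq] at hx
  subst hx
  by_contra hcon
  obtain ⟨m, hm⟩ := List.head?_eq_some_iff.mp hy
  have hya : y = (a, false) := 
    Prod.ext hxy.symm (Bool.eq_false_of_not_eq_true fun h => hcon h.symm)
  rw [hya, ← mul_one g⁻¹] at hm
  rcases norm_lt_of_toWord_eq_cons hm with h1 | h1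
  · omega
  · simp at h1

theorem isReduced_toWord_concat {g : FreeGroup ι} {a : ι}
    (h : norm g ≤ norm (g * FreeGroup.mk [(a, true)])) :
    IsReduced (g.toWord ++ [(a, true)]) := by
  refine List.isChain_append.mpr ⟨isReduced_toWord, by simp, ?_⟩
  intro x hx y hy hxy
  simp only [List.head?_cons, Option.mem_def, Option.some.injEq] at hy
  subst hy
  by_contra hcon
  obtain ⟨m, hm⟩ := List.getLast?_eq_some_iff.mp hx
  have hxa : x = (a, false) := Prod.ext hxy (by simpa using hcon)
  have h1 : (g⁻¹ * 1).toWord = (a, true) :: invRev m := by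
    rw [mul_one, toWord_inv, hm, hxa]
    simp [invRev]
  rcases norm_lt_of_toWord_eq_cons h1 with h1 | h1
  · omega
  · simp at h1

/-- A cancellation at either end would allow a shorter conjugator, by changing it on the right or by
a half twist. Under the minimality hypotheses the word between two generators is therefore stable.
-/
theorem isReduced_middle {g h : FreeGroup ι} {a b : ι}
    (hg : norm g ≤ norm (g * FreeGroup.mk [(a, false)]))
    (hh : norm h ≤ norm (h * FreeGroup.mk [(b, true)]))
    (hgh : norm h ≤ norm (g * FreeGroup.mk [(a, true)] * g⁻¹ * h))
    (hhg : norm g ≤ norm (h * FreeGroup.mk [(b, false)] * h⁻¹ * g)) :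
    IsReduced ([(a, true)] ++ ((g⁻¹ * h).toWord ++ [(b, true)])) := by
  refine isReduced_cons_concat isReduced_toWord ?_ ?_
  · intro m hm
    have := norm_lt_of_toWord_eq_cons hm
    simp only [Bool.not_false] at this
    omega
  · intro m hm
    have h1 : (h⁻¹ * g).toWord = (b, true) :: invRev m := by
      have : h⁻¹ * g = (g⁻¹ * h)⁻¹ := by group
      rw [this, toWord_inv, hm]
      simp [invRev]
    have := norm_lt_of_toWord_eq_cons h1
    simp only [Bool.not_true] at this
    omega

/-- Artin's induction: every triple of conjugates of free generators whose product is the product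
of three generators is obtained from these generators by half twists. -/
theorem artin_induction {x y z : ι}
    {P : FreeGroup ι → FreeGroup ι → FreeGroup ι → ι → ι → ι → Prop}
    (base : P (of x) (of y) (of z) x y z)
    (m1 : ∀ A B C i j k, P (A * B * A⁻¹) A C j i k → P A B C i j k)
    (m2 : ∀ A B C i j k, P B (B⁻¹ * A * B) C j i k → P A B C i j k)
    (m3 : ∀ A B C i j k, P A (B * C * B⁻¹) B i k j → P A B C i j k)
    (m4 : ∀ A B C i j k, P A C (C⁻¹ * B * C) i k j → P A B C i j k)
    (f g h : FreeGroup ι) (i j k : ι)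
    (hprod : f * of i * f⁻¹ * (g * of j * g⁻¹) * (h * of k * h⁻¹) = of x * of y * of z) :
    P (f * of i * f⁻¹) (g * of j * g⁻¹) (h * of k * h⁻¹) i j k := by
  induction hn : norm f + norm g + norm h using Nat.strong_induction_on generalizing f g h i j k with
  | _ n ih =>
  -- Multiplying a conjugator on the right by a power of its generator does not change the
  -- conjugate, so shortening it in this way costs no half twist.
  have shift (u : FreeGroup ι) (l : ι) (s : Bool) :
      u * FreeGroup.mk [(l, s)] * of l * (u * FreeGroup.mk [(l, s)])⁻¹ = u * of l * u⁻¹ := by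
    cases s
    · rw [mk_false]; group
    · rw [mk_true]; group
  by_cases f1 : ∃ s, norm (f * FreeGroup.mk [(i, s)]) < norm f
  · obtain ⟨s, hs⟩ := f1
    have := ih _ (by omega) (f * FreeGroup.mk [(i, s)]) g h i j k (by rw [shift, hprod]) rfl
    rwa [shift] at this
  by_cases g1 : ∃ s, norm (g * FreeGroup.mk [(j, s)]) < norm g
  · obtain ⟨s, hs⟩ := g1
    have := ih _ (by omega) f (g * FreeGroup.mk [(j, s)]) h i j k (by rw [shift, hprod]) rfl
    rwa [shift] at this
  by_cases h1 : ∃ s, norm (h * FreeGroup.mk [(k, s)]) < norm h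
  · obtain ⟨s, hs⟩ := h1
    have := ih _ (by omega) f g (h * FreeGroup.mk [(k, s)]) i j k (by rw [shift, hprod]) rfl
    rwa [shift] at this
  -- From here on the conjugators cannot be shortened by themselves; a half twist is made whenever
  -- it lowers their total length.
  by_cases c1 : norm (f * FreeGroup.mk [(i, true)] * f⁻¹ * g) < norm g
  · have := ih _ (by omega) (f * FreeGroup.mk [(i, true)] * f⁻¹ * g) f h j i k
      (by rw [← hprod, mk_true]; group) rfl
    apply m1
    convert this using 1
    rw [mk_true]; group
  by_cases c2 : norm (g * FreeGroup.mk [(j, false)] * g⁻¹ * f) < norm f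
  · have := ih _ (by omega) g (g * FreeGroup.mk [(j, false)] * g⁻¹ * f) h j i k
      (by rw [← hprod, mk_false]; group) rfl
    apply m2
    convert this using 1
    rw [mk_false]; group
  by_cases c3 : norm (g * FreeGroup.mk [(j, true)] * g⁻¹ * h) < norm h
  · have := ih _ (by omega) f (g * FreeGroup.mk [(j, true)] * g⁻¹ * h) g i k j
      (by rw [← hprod, mk_true]; group) rfl
    apply m3
    convert this using 1
    rw [mk_true]; group
  by_cases c4 : norm (h * FreeGroup.mk [(k, false)] * h⁻¹ * g) < norm g
  · have := ih _ (by omega) f h (h * FreeGroup.mk [(k, false)] * h⁻¹ * g) i k j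
      (by rw [← hprod, mk_false]; group) rfl
    apply m4
    convert this using 1
    rw [mk_false]; group
  push Not at f1 g1 h1 c1 c2 c3 c4
  have w0 := isReduced_toWord_concat (f1 true)
  have w1 := isReduced_middle (f1 false) (g1 true) c1 c2
  have w2 := isReduced_middle (g1 false) (h1 true) c3 c4
  have w3 := isReduced_cons_toWord_inv (h1 false)
  -- When no move shortens anything, the reduced pieces overlap in the three generators and glue to
  -- the reduced word of the product. This word has length three, so all the other pieces are empty
  -- and the conjugators are trivial.
  have r1 := (w0.append_overlap w1 (by simp))
  rw [← List.append_assoc] at r1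
  have r2 := r1.append_overlap w2 (by simp)
  rw [← List.append_assoc] at r2
  have r3 := r2.append_overlap w3 (by simp)
  have hw : of x * of y * of z = FreeGroup.mk (f.toWord ++ [(i, true)] ++ (f⁻¹ * g).toWord ++
      [(j, true)] ++ (g⁻¹ * h).toWord ++ [(k, true)] ++ h⁻¹.toWord) := by
    simp only [← mul_mk, mk_toWord, mk_true]
    rw [← hprod]
    group
  have hw' : (of x * of y * of z).toWord = [(x, true), (y, true), (z, true)] := by
    have h5 : of x * of y * of z = FreeGroup.mk [(x, true), (y, true), (z, true)] := rfl
    rw [h5, toWord_mk, IsReduced.reduce_eq]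
    simp [FreeGroup.IsReduced]
  rw [hw, toWord_mk, r3.reduce_eq] at hw'
  have hlen := congrArg List.length hw'
  simp only [List.length_append, List.length_cons, List.length_nil] at hlen
  have hf : f = 1 := by rw [← FreeGroup.norm_eq_zero, FreeGroup.norm]; omega
  have hfg : f⁻¹ * g = 1 := by rw [← FreeGroup.norm_eq_zero, FreeGroup.norm]; omega
  have hgh : g⁻¹ * h = 1 := by rw [← FreeGroup.norm_eq_zero, FreeGroup.norm]; omega
  have hg : g = 1 := by rw [hf] at hfg; simpa using hfg
  have hh : h = 1 := by rw [hg] at hgh; simpa using hgh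
  subst hf hg hh
  simp at hw'
  obtain ⟨rfl, rfl, rfl⟩ := hw'
  simpa using base

end Artin

/-! ### Triples of matrices two of whose pairwise products are traceless -/

/-- Up to the order of the factors, a triple `A`, `B`, `C` with `tr A = -w`, `tr B = tr C = b`,
`tr (A B C) = w` and `tr (A B) = tr (A C) = 0`; the index is the position of `A`. -/
def Role (w b : ℝ) (m : Fin 3) (A B C : SL(2, ℝ)) : Prop :=
  tr (A * B * C) = w ∧
    ((m = 0 ∧ tr A = -w ∧ tr B = b ∧ tr C = b ∧ tr (A * B) = 0 ∧ tr (A * C) = 0) ∨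
     (m = 1 ∧ tr A = b ∧ tr B = -w ∧ tr C = b ∧ tr (A * B) = 0 ∧ tr (B * C) = 0) ∨
     (m = 2 ∧ tr A = b ∧ tr B = b ∧ tr C = -w ∧ tr (B * C) = 0 ∧ tr (A * C) = 0))

/-- The effect of the transposition of the first two positions. -/
def swapFirst : Fin 3 → Fin 3 := ![1, 0, 2]

/-- The effect of the transposition of the last two positions. -/
def swapLast : Fin 3 → Fin 3 := ![0, 2, 1]

/-- The only trace to be computed is given by `tr_half_twist`. There the terms `b w` and `-w b`
cancel because the exceptional trace is the opposite of the total one, and every other term contains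
a vanishing trace. -/
theorem Role.half_twist_first {w b : ℝ} {m : Fin 3} {A B C : SL(2, ℝ)} (h : Role w b m A B C) :
    Role w b (swapFirst m) (A * B * A⁻¹) A C := by
  have h1 := tr_half_twist A B C
  have e1 : A * B * A⁻¹ * A = A * B := by group
  obtain ⟨hw, ⟨rfl, ha, hb, hc, h2, h3⟩ | ⟨rfl, ha, hb, hc, h2, h3⟩ | ⟨rfl, ha, hb, hc, h2, h3⟩⟩ := h
  · refine ⟨by rw [e1, hw], Or.inr (Or.inl ⟨rfl, ?_, ha, hc, ?_, h3⟩)⟩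
    · rw [tr_conj, hb]
    · rw [e1, h2]
  · refine ⟨by rw [e1, hw], Or.inl ⟨rfl, ?_, ha, hc, ?_, ?_⟩⟩
    · rw [tr_conj, hb]
    · rw [e1, h2]
    · rw [h1, hw, ha, hb, hc, h2, h3]; ring
  · refine ⟨by rw [e1, hw], Or.inr (Or.inr ⟨rfl, ?_, ha, hc, h3, ?_⟩)⟩
    · rw [tr_conj, hb]
    · rw [h1, hw, ha, hb, hc, h2, h3]; ring

/-- Cyclic rotation, together with the reversal of inverses below, deduces the other three half
twists from the first. -/
theorem Role.rotate {w b : ℝ} {m : Fin 3} {A B C : SL(2, ℝ)} (h : Role w b m A B C) :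
    Role w b (![2, 0, 1] m) B C A := by
  have e : tr (B * C * A) = tr (A * B * C) := by rw [tr_mul_comm, mul_assoc]
  obtain ⟨hw, ⟨rfl, ha, hb, hc, h2, h3⟩ | ⟨rfl, ha, hb, hc, h2, h3⟩ | ⟨rfl, ha, hb, hc, h2, h3⟩⟩ := h
  · exact ⟨e.trans hw, Or.inr (Or.inr ⟨rfl, hb, hc, ha, by rw [tr_mul_comm, h3],
      by rw [tr_mul_comm, h2]⟩)⟩
  · exact ⟨e.trans hw, Or.inl ⟨rfl, hb, hc, ha, h3, by rw [tr_mul_comm, h2]⟩⟩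
  · exact ⟨e.trans hw, Or.inr (Or.inl ⟨rfl, hb, hc, ha, h2, by rw [tr_mul_comm, h3]⟩)⟩

theorem Role.reverse {w b : ℝ} {m : Fin 3} {A B C : SL(2, ℝ)} (h : Role w b m A B C) :
    Role w b (![2, 1, 0] m) C⁻¹ B⁻¹ A⁻¹ := by
  have e : C⁻¹ * B⁻¹ * A⁻¹ = (A * B * C)⁻¹ := by group
  have e1 : tr (C⁻¹ * B⁻¹) = tr (B * C) := by rw [← mul_inv_rev, tr_inv]
  have e2 : tr (B⁻¹ * A⁻¹) = tr (A * B) := by rw [← mul_inv_rev, tr_inv]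
  have e3 : tr (C⁻¹ * A⁻¹) = tr (A * C) := by rw [← mul_inv_rev, tr_inv]
  rw [Role, e, e1, e2, e3]
  simp only [tr_inv]
  obtain ⟨hw, ⟨rfl, ha, hb, hc, h2, h3⟩ | ⟨rfl, ha, hb, hc, h2, h3⟩ | ⟨rfl, ha, hb, hc, h2, h3⟩⟩ := h
  · exact ⟨hw, Or.inr (Or.inr ⟨rfl, hc, hb, ha, h2, h3⟩)⟩
  · exact ⟨hw, Or.inr (Or.inl ⟨rfl, hc, hb, ha, h3, h2⟩)⟩
  · exact ⟨hw, Or.inl ⟨rfl, hc, hb, ha, h2, h3⟩⟩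

theorem Role.conj {w b : ℝ} {m : Fin 3} {A B C : SL(2, ℝ)} (h : Role w b m A B C) (g : SL(2, ℝ)) :
    Role w b m (g * A * g⁻¹) (g * B * g⁻¹) (g * C * g⁻¹) := by
  have e (X Y : SL(2, ℝ)) : g * X * g⁻¹ * (g * Y * g⁻¹) = g * (X * Y) * g⁻¹ := by group
  simpa only [Role, e, tr_conj] using h

theorem Role.half_twist_last {w b : ℝ} {m : Fin 3} {A B C : SL(2, ℝ)} (h : Role w b m A B C) :
    Role w b (swapLast m) A (B * C * B⁻¹) B := by
  have h1 := h.rotate.half_twist_first.rotate.rotate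
  convert h1 using 1
  fin_cases m <;> rfl

theorem Role.half_twist_first_inv {w b : ℝ} {m : Fin 3} {A B C : SL(2, ℝ)}
    (h : Role w b m A B C) : Role w b (swapFirst m) B (B⁻¹ * A * B) C := by
  have h1 := h.reverse.half_twist_last.reverse
  simp only [inv_inv, mul_inv_rev] at h1
  rw [← mul_assoc] at h1
  convert h1 using 1
  fin_cases m <;> rfl

theorem Role.half_twist_last_inv {w b : ℝ} {m : Fin 3} {A B C : SL(2, ℝ)}
    (h : Role w b m A B C) : Role w b (swapLast m) A C (C⁻¹ * B * C) := by
  have h1 := h.reverse.half_twist_first.reverse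
  simp only [inv_inv, mul_inv_rev] at h1
  rw [← mul_assoc] at h1
  convert h1 using 1
  fin_cases m <;> rfl

/-- The peripheral images of `σ` form a triple as in `Role`. -/
def HasRole (m : Fin 3) (σ : SphereGroup →* SL(2, ℝ)) : Prop :=
  ∃ w b : ℝ, Role w b m (σ (c 0)) (σ (c 1)) (σ (c 2))

/-- The isomorphism with the free group on the first three peripheral generators. -/
def toFree : SphereGroup →* FreeGroup (Fin 3) :=
  ofQuad ![FreeGroup.of 0, FreeGroup.of 1, FreeGroup.of 2,
    (FreeGroup.of 0 * FreeGroup.of 1 * FreeGroup.of 2)⁻¹] (mul_inv_cancel _)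

/-- The inverse of `toFree`. -/
def ofFree : FreeGroup (Fin 3) →* SphereGroup := FreeGroup.lift ![c 0, c 1, c 2]

theorem ofFree_toFree (x : SphereGroup) : ofFree (toFree x) = x := by
  have : ofFree.comp toFree = MonoidHom.id _ := by
    apply sphere_hom_ext <;> simp [toFree, ofFree]
  exact DFunLike.congr_fun this x

/-- Pure automorphisms preserve the position of the exceptional generator. -/
theorem HasRole.comp {m : Fin 3} {σ : SphereGroup →* SL(2, ℝ)} (h : HasRole m σ)
    {φ : MulAut SphereGroup} (hφ : φ ∈ pureAut) : HasRole m (σ.comp φ.toMonoidHom) := by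
  obtain ⟨w, b, h⟩ := h
  choose k hk using fun i => isConj_iff.mp (hφ i)
  refine ⟨w, b, ?_⟩
  set σ' : FreeGroup (Fin 3) →* SL(2, ℝ) := σ.comp ofFree with hσ'
  have hF (x : SphereGroup) : σ' (toFree x) = σ x := by
    rw [hσ', MonoidHom.comp_apply, ofFree_toFree]
  have hT (i : Fin 3) : toFree (![c 0, c 1, c 2] i) = FreeGroup.of i := by
    fin_cases i <;> simp [toFree]
  -- Conjugating by `(k 3)⁻¹` makes the automorphism fix `c 3`, and so the product of the first
  -- three generators, as Artin's induction requires.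
  have hprod : toFree ((k 3)⁻¹ * k 0) * FreeGroup.of 0 * (toFree ((k 3)⁻¹ * k 0))⁻¹ *
      (toFree ((k 3)⁻¹ * k 1) * FreeGroup.of 1 * (toFree ((k 3)⁻¹ * k 1))⁻¹) *
      (toFree ((k 3)⁻¹ * k 2) * FreeGroup.of 2 * (toFree ((k 3)⁻¹ * k 2))⁻¹) =
      FreeGroup.of 0 * FreeGroup.of 1 * FreeGroup.of 2 := by
    rw [← hT 0, ← hT 1, ← hT 2]
    simp only [← map_mul, ← map_inv]
    congr 1
    change (k 3)⁻¹ * k 0 * c 0 * ((k 3)⁻¹ * k 0)⁻¹ * ((k 3)⁻¹ * k 1 * c 1 * ((k 3)⁻¹ * k 1)⁻¹) *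
      ((k 3)⁻¹ * k 2 * c 2 * ((k 3)⁻¹ * k 2)⁻¹) = c 0 * c 1 * c 2
    have e1 : (k 3)⁻¹ * k 0 * c 0 * ((k 3)⁻¹ * k 0)⁻¹ * ((k 3)⁻¹ * k 1 * c 1 * ((k 3)⁻¹ * k 1)⁻¹) *
      ((k 3)⁻¹ * k 2 * c 2 * ((k 3)⁻¹ * k 2)⁻¹) = (k 3)⁻¹ * ((k 0 * c 0 * (k 0)⁻¹) *
      (k 1 * c 1 * (k 1)⁻¹) * (k 2 * c 2 * (k 2)⁻¹)) * k 3 := by group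
    have e2 : φ (c 0 * c 1 * c 2) = (φ (c 3))⁻¹ := by rw [c_three, map_inv, inv_inv]
    rw [e1, hk, hk, hk, ← map_mul, ← map_mul, e2, ← hk 3, c_three]
    group
  -- The predicate follows the exceptional generator by its label while half twists change its
  -- position. Purity gives the final labels `0, 1, 2`, so the position is again `m`.
  have key := artin_induction (x := (0 : Fin 3)) (y := 1) (z := 2)
    (P := fun A B C i j k => ∃ n : Fin 3, ![i, j, k] n = m ∧ Role w b n (σ' A) (σ' B) (σ' C))
    ?_ ?_ ?_ ?_ ?_ _ _ _ 0 1 2 hprod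
  · obtain ⟨n, hn, hR⟩ := key
    have hnm : n = m := by rw [← hn]; fin_cases n <;> rfl
    rw [hnm] at hR
    have hR' := hR.conj (σ (k 3))
    have e (i : Fin 3) (j : Fin 4) (hij : FreeGroup.of i = toFree (c j)) :
        σ (k 3) * σ' (toFree ((k 3)⁻¹ * k j) * FreeGroup.of i * (toFree ((k 3)⁻¹ * k j))⁻¹) *
        (σ (k 3))⁻¹ = σ.comp φ.toMonoidHom (c j) := by
      rw [hij, ← map_inv toFree, ← map_mul, ← map_mul, hF]
      change _ = σ (φ (c j))
      rw [← hk j, ← map_inv, ← map_mul, ← map_mul]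
      congr 1
      group
    rw [e 0 0 (hT 0).symm, e 1 1 (hT 1).symm, e 2 2 (hT 2).symm] at hR'
    exact hR'
  · refine ⟨m, by fin_cases m <;> rfl, ?_⟩
    rw [← hT 0, ← hT 1, ← hT 2, hF, hF, hF]
    exact h
  · rintro A B C i j k ⟨n, hn, hR⟩
    refine ⟨swapFirst n, by rw [← hn]; fin_cases n <;> rfl, ?_⟩
    have := hR.half_twist_first_inv
    simp only [map_mul, map_inv] at this
    convert this using 1
    group
  · rintro A B C i j k ⟨n, hn, hR⟩
    refine ⟨swapFirst n, by rw [← hn]; fin_cases n <;> rfl, ?_⟩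
    have := hR.half_twist_first
    simp only [map_mul, map_inv] at this
    convert this using 1
    group
  · rintro A B C i j k ⟨n, hn, hR⟩
    refine ⟨swapLast n, by rw [← hn]; fin_cases n <;> rfl, ?_⟩
    have := hR.half_twist_last_inv
    simp only [map_mul, map_inv] at this
    convert this using 1
    group
  · rintro A B C i j k ⟨n, hn, hR⟩
    refine ⟨swapLast n, by rw [← hn]; fin_cases n <;> rfl, ?_⟩
    have := hR.half_twist_last
    simp only [map_mul, map_inv] at this
    convert this using 1
    group

/-! ### The action on lifts -/

theorem IsLift.comp {α : Fin 4 → ℝ} {σ : SphereGroup →* SL(2, ℝ)} {C : Fin 4 → ℍ}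
    (h : IsLift α σ C) {φ : MulAut SphereGroup} (hφ : φ ∈ pureAut) :
    ∃ D, IsLift α (σ.comp φ.toMonoidHom) D := by
  choose k hk using fun i => isConj_iff.mp (hφ i)
  obtain ⟨h0, h1, h2, h3⟩ := h
  have e (i : Fin 4) : σ.comp φ.toMonoidHom (c i) = σ (k i) * σ (c i) * (σ (k i))⁻¹ := by
    rw [← map_inv, ← map_mul, ← map_mul, hk]; rfl
  refine ⟨fun i => σ (k i) • C i, ?_, ?_, ?_, ?_⟩
  · rw [e, h0, conj_rotAbout]
  · rw [e, h1, conj_rotAbout]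
  · rw [e, h2, conj_rotAbout]
  · rw [e, h3, ← conj_rotAbout, mul_neg, neg_mul]

/-- The points of the component whose lifts satisfy `HasRole m`. -/
def typeSet (α : Fin 4 → ℝ) (m : Fin 3) : Set Rep :=
  {x | ∃ σ C, IsLift α σ C ∧ (⟦proj.comp σ⟧ : Rep) = x ∧ HasRole m σ}

/-- The action precomposes with the inverse; with `φ⁻¹` acting this is precomposition with `φ`,
hence the inverse twists below. -/
theorem smul_class (φ : pureAut) (σ : SphereGroup →* SL(2, ℝ)) :
    φ⁻¹ • (⟦proj.comp σ⟧ : Rep) = ⟦proj.comp (σ.comp (φ : MulAut SphereGroup).toMonoidHom)⟧ := by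
  have h : φ⁻¹ • (⟦proj.comp σ⟧ : Rep) = ⟦(proj.comp σ).comp
    (((φ⁻¹ : pureAut) : MulAut SphereGroup)⁻¹ : MulAut SphereGroup).toMonoidHom⟧ := rfl
  rw [h]
  have e : (((φ⁻¹ : pureAut) : MulAut SphereGroup)⁻¹ : MulAut SphereGroup) = φ := by simp
  rw [e]
  rfl

theorem smul_mem_typeSet {α : Fin 4 → ℝ} {m : Fin 3} (φ : pureAut) {x : Rep}
    (hx : x ∈ typeSet α m) : φ • x ∈ typeSet α m := by
  obtain ⟨σ, C, hσ, rfl, hm⟩ := hx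
  have h := smul_class φ⁻¹ σ
  rw [inv_inv] at h
  rw [h]
  obtain ⟨D, hD⟩ := hσ.comp (φ⁻¹).2
  exact ⟨_, D, hD, rfl, hm.comp (φ⁻¹).2⟩

theorem orbit_eq (x : Rep) : MulAction.orbit PMod x = MulAction.orbit pureAut x := by
  ext y
  constructor
  · rintro ⟨g, rfl⟩
    obtain ⟨φ, rfl⟩ := QuotientGroup.mk_surjective g
    exact ⟨φ, rfl⟩
  · rintro ⟨φ, rfl⟩
    exact ⟨(φ : PMod), rfl⟩

/-! ### Dehn twists -/

/-- The automorphism that conjugates `c₁` and `c₂` by `w` and fixes `c₃`, `c₄`. -/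
def twistFirstHom (w : SphereGroup) (hw : Commute w (c 0 * c 1)) : SphereGroup →* SphereGroup :=
  ofQuad ![w * c 0 * w⁻¹, w * c 1 * w⁻¹, c 2, c 3] (by
    change w * c 0 * w⁻¹ * (w * c 1 * w⁻¹) * c 2 * c 3 = 1
    have e : w * c 0 * w⁻¹ * (w * c 1 * w⁻¹) = w * (c 0 * c 1) * w⁻¹ := by group
    rw [e, hw.eq, mul_inv_cancel_right, c_rel])

/-- The automorphism that conjugates `c₂` and `c₃` by `w` and fixes `c₁`, `c₄`. -/
def twistMiddleHom (w : SphereGroup) (hw : Commute w (c 1 * c 2)) : SphereGroup →* SphereGroup :=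
  ofQuad ![c 0, w * c 1 * w⁻¹, w * c 2 * w⁻¹, c 3] (by
    change c 0 * (w * c 1 * w⁻¹) * (w * c 2 * w⁻¹) * c 3 = 1
    have e : c 0 * (w * c 1 * w⁻¹) * (w * c 2 * w⁻¹) = c 0 * (w * (c 1 * c 2) * w⁻¹) := by group
    rw [e, hw.eq, mul_inv_cancel_right, ← mul_assoc, c_rel])

theorem twistFirstHom_c (w : SphereGroup) (hw : Commute w (c 0 * c 1)) :
    twistFirstHom w hw (c 0) = w * c 0 * w⁻¹ ∧ twistFirstHom w hw (c 1) = w * c 1 * w⁻¹ ∧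
      twistFirstHom w hw (c 2) = c 2 ∧ twistFirstHom w hw (c 3) = c 3 := by
  refine ⟨?_, ?_, ?_, ?_⟩ <;> exact ofQuad_c _ _ _

theorem twistMiddleHom_c (w : SphereGroup) (hw : Commute w (c 1 * c 2)) :
    twistMiddleHom w hw (c 0) = c 0 ∧ twistMiddleHom w hw (c 1) = w * c 1 * w⁻¹ ∧
      twistMiddleHom w hw (c 2) = w * c 2 * w⁻¹ ∧ twistMiddleHom w hw (c 3) = c 3 := by
  refine ⟨?_, ?_, ?_, ?_⟩ <;> exact ofQuad_c _ _ _

theorem mem_pureAut {φ : MulAut SphereGroup} (h0 : IsConj (c 0) (φ (c 0)))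
    (h1 : IsConj (c 1) (φ (c 1))) (h2 : IsConj (c 2) (φ (c 2))) (h3 : IsConj (c 3) (φ (c 3))) :
    φ ∈ pureAut := by
  intro i
  match i with
  | 0 => exact h0
  | 1 => exact h1
  | 2 => exact h2
  | 3 => exact h3

theorem twistFirstHom_comp (v w : SphereGroup) (hv : Commute v (c 0 * c 1))
    (hw : Commute w (c 0 * c 1)) (hwv : twistFirstHom v hv w = w) (h : w * v = 1) :
    (twistFirstHom v hv).comp (twistFirstHom w hw) = MonoidHom.id SphereGroup := by
  obtain ⟨a0, a1, a2, -⟩ := twistFirstHom_c w hw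
  obtain ⟨b0, b1, b2, -⟩ := twistFirstHom_c v hv
  have e (x : SphereGroup) : w * (v * x * v⁻¹) * w⁻¹ = x := by
    have e1 : w * (v * x * v⁻¹) * w⁻¹ = (w * v) * x * (w * v)⁻¹ := by group
    rw [e1, h, one_mul, inv_one, mul_one]
  apply sphere_hom_ext
  · rw [MonoidHom.comp_apply, a0, map_mul, map_mul, map_inv, hwv, b0, e, MonoidHom.id_apply]
  · rw [MonoidHom.comp_apply, a1, map_mul, map_mul, map_inv, hwv, b1, e, MonoidHom.id_apply]
  · rw [MonoidHom.comp_apply, a2, b2, MonoidHom.id_apply]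

theorem twistFirstHom_self (v : SphereGroup) (hv : Commute v (c 0 * c 1)) :
    twistFirstHom v hv (c 0 * c 1) = c 0 * c 1 := by
  obtain ⟨b0, b1, b2, -⟩ := twistFirstHom_c v hv
  have e : v * c 0 * v⁻¹ * (v * c 1 * v⁻¹) = v * (c 0 * c 1) * v⁻¹ := by group
  rw [map_mul, b0, b1, e, hv.eq, mul_inv_cancel_right]

/-- The Dehn twist along the curve around the first two punctures. -/
def twistFirstEquiv : MulAut SphereGroup :=
  MonoidHom.toMulEquiv (twistFirstHom (c 0 * c 1) (Commute.refl _))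
    (twistFirstHom (c 0 * c 1)⁻¹ (Commute.refl _).inv_left)
    (twistFirstHom_comp _ _ _ _ (twistFirstHom_self _ _) (mul_inv_cancel _))
    (twistFirstHom_comp _ _ _ _ (by rw [map_inv, twistFirstHom_self]) (inv_mul_cancel _))

theorem twistFirstEquiv_apply (x : SphereGroup) :
    twistFirstEquiv x = twistFirstHom (c 0 * c 1) (Commute.refl _) x := rfl

/-- The Dehn twist along the curve around the first two punctures. -/
def twistFirst : pureAut :=
  ⟨twistFirstEquiv, by
    obtain ⟨a0, a1, a2, a3⟩ := twistFirstHom_c (c 0 * c 1) (Commute.refl _)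
    apply mem_pureAut <;> rw [twistFirstEquiv_apply, isConj_iff]
    · exact ⟨_, a0.symm⟩
    · exact ⟨_, a1.symm⟩
    · exact ⟨1, by rw [a2, one_mul, inv_one, mul_one]⟩
    · exact ⟨1, by rw [a3, one_mul, inv_one, mul_one]⟩⟩

theorem comp_twistFirst_apply {G : Type*} [Group G] (σ : SphereGroup →* G) (x : SphereGroup) :
    σ.comp (twistFirst : MulAut SphereGroup).toMonoidHom x =
      σ (twistFirstHom (c 0 * c 1) (Commute.refl _) x) := rfl

theorem twistMiddleHom_comp (v w : SphereGroup) (hv : Commute v (c 1 * c 2))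
    (hw : Commute w (c 1 * c 2)) (hwv : twistMiddleHom v hv w = w) (h : w * v = 1) :
    (twistMiddleHom v hv).comp (twistMiddleHom w hw) = MonoidHom.id SphereGroup := by
  obtain ⟨a0, a1, a2, -⟩ := twistMiddleHom_c w hw
  obtain ⟨b0, b1, b2, -⟩ := twistMiddleHom_c v hv
  have e (x : SphereGroup) : w * (v * x * v⁻¹) * w⁻¹ = x := by
    have e1 : w * (v * x * v⁻¹) * w⁻¹ = (w * v) * x * (w * v)⁻¹ := by group
    rw [e1, h, one_mul, inv_one, mul_one]
  apply sphere_hom_ext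
  · rw [MonoidHom.comp_apply, a0, b0, MonoidHom.id_apply]
  · rw [MonoidHom.comp_apply, a1, map_mul, map_mul, map_inv, hwv, b1, e, MonoidHom.id_apply]
  · rw [MonoidHom.comp_apply, a2, map_mul, map_mul, map_inv, hwv, b2, e, MonoidHom.id_apply]

theorem twistMiddleHom_self (v : SphereGroup) (hv : Commute v (c 1 * c 2)) :
    twistMiddleHom v hv (c 1 * c 2) = c 1 * c 2 := by
  obtain ⟨b0, b1, b2, -⟩ := twistMiddleHom_c v hv
  have e : v * c 1 * v⁻¹ * (v * c 2 * v⁻¹) = v * (c 1 * c 2) * v⁻¹ := by group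
  rw [map_mul, b1, b2, e, hv.eq, mul_inv_cancel_right]

/-- The Dehn twist along the curve around the second and third punctures. -/
def twistMiddleEquiv : MulAut SphereGroup :=
  MonoidHom.toMulEquiv (twistMiddleHom (c 1 * c 2) (Commute.refl _))
    (twistMiddleHom (c 1 * c 2)⁻¹ (Commute.refl _).inv_left)
    (twistMiddleHom_comp _ _ _ _ (twistMiddleHom_self _ _) (mul_inv_cancel _))
    (twistMiddleHom_comp _ _ _ _ (by rw [map_inv, twistMiddleHom_self]) (inv_mul_cancel _))

theorem twistMiddleEquiv_apply (x : SphereGroup) :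
    twistMiddleEquiv x = twistMiddleHom (c 1 * c 2) (Commute.refl _) x := rfl

/-- The Dehn twist along the curve around the second and third punctures. -/
def twistMiddle : pureAut :=
  ⟨twistMiddleEquiv, by
    obtain ⟨a0, a1, a2, a3⟩ := twistMiddleHom_c (c 1 * c 2) (Commute.refl _)
    apply mem_pureAut <;> rw [twistMiddleEquiv_apply, isConj_iff]
    · exact ⟨1, by rw [a0, one_mul, inv_one, mul_one]⟩
    · exact ⟨_, a1.symm⟩
    · exact ⟨_, a2.symm⟩
    · exact ⟨1, by rw [a3, one_mul, inv_one, mul_one]⟩⟩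

theorem comp_twistMiddle_apply {G : Type*} [Group G] (σ : SphereGroup →* G) (x : SphereGroup) :
    σ.comp (twistMiddle : MulAut SphereGroup).toMonoidHom x =
      σ (twistMiddleHom (c 1 * c 2) (Commute.refl _) x) := rfl

/-- The trace coordinates. -/
def trX (σ : SphereGroup →* SL(2, ℝ)) : ℝ := tr (σ (c 0 * c 1))

/-- The trace coordinates. -/
def trY (σ : SphereGroup →* SL(2, ℝ)) : ℝ := tr (σ (c 1 * c 2))

/-- The trace coordinates. -/
def trZ (σ : SphereGroup →* SL(2, ℝ)) : ℝ := tr (σ (c 0 * c 2))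

/-- The trace of the product of the first three peripheral elements. -/
def trW (σ : SphereGroup →* SL(2, ℝ)) : ℝ := tr (σ (c 0 * c 1 * c 2))

/-- A Dehn twist is the square of a half twist, so `tr_half_twist` is used twice, the second time
with the already updated `trY τ`. -/
theorem tr_twistFirst (σ : SphereGroup →* SL(2, ℝ)) :
    let τ := σ.comp (twistFirst : MulAut SphereGroup).toMonoidHom
    trX τ = trX σ ∧
    trY τ = tr (σ (c 0)) * trW σ + tr (σ (c 1)) * tr (σ (c 2)) - trX σ * trZ σ - trY σ ∧
    trZ τ = tr (σ (c 1)) * trW σ + tr (σ (c 0)) * tr (σ (c 2)) - trX σ * trY τ - trZ σ := by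
  intro τ
  have hτ : τ = _ := rfl
  obtain ⟨a0, a1, a2, -⟩ := twistFirstHom_c (c 0 * c 1) (Commute.refl _)
  have t0 : τ (c 0) = σ (c 0) * σ (c 1) * σ (c 0) * (σ (c 0) * σ (c 1))⁻¹ := by
    rw [hτ, comp_twistFirst_apply, a0]; simp only [map_mul, map_inv]
  have t1 : τ (c 1) = σ (c 0) * σ (c 1) * (σ (c 0))⁻¹ := by
    rw [hτ, comp_twistFirst_apply, a1]; simp only [map_mul, map_inv]; group
  have t2 : τ (c 2) = σ (c 2) := by
    rw [hτ, comp_twistFirst_apply, a2]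
  have hY : trY τ = tr (σ (c 0)) * trW σ + tr (σ (c 1)) * tr (σ (c 2)) - trX σ * trZ σ - trY σ := by
    simp only [trY, trW, trX, trZ, map_mul, t1, t2]
    rw [tr_half_twist]
  refine ⟨?_, hY, ?_⟩
  · simp only [trX, map_mul, t0, t1]
    rw [← tr_conj (σ (c 0) * σ (c 1)) (σ (c 0) * σ (c 1))]
    congr 1
    group
  · have e : τ (c 0) * τ (c 2) = τ (c 1) * σ (c 0) * (τ (c 1))⁻¹ * σ (c 2) := by
      rw [t0, t1, t2]; group
    have e1 : τ (c 1) * σ (c 0) = σ (c 0) * σ (c 1) := by rw [t1]; group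
    have e2 : tr (τ (c 1)) = tr (σ (c 1)) := by rw [t1, tr_conj]
    have e3 : τ (c 1) * σ (c 2) = τ (c 1) * τ (c 2) := by rw [t2]
    simp only [trZ, trW, trX, trY, map_mul]
    rw [e, tr_half_twist, e1, e2, e3]

theorem tr_twistMiddle (σ : SphereGroup →* SL(2, ℝ)) :
    let τ := σ.comp (twistMiddle : MulAut SphereGroup).toMonoidHom
    trY τ = trY σ ∧
    trZ τ = tr (σ (c 1)) * trW σ + tr (σ (c 0)) * tr (σ (c 2)) - trX σ * trY σ - trZ σ ∧
    trX τ = tr (σ (c 2)) * trW σ + tr (σ (c 0)) * tr (σ (c 1)) - trY σ * trZ τ - trX σ := by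
  intro τ
  have hτ : τ = _ := rfl
  obtain ⟨a0, a1, a2, -⟩ := twistMiddleHom_c (c 1 * c 2) (Commute.refl _)
  have t0 : τ (c 0) = σ (c 0) := by
    rw [hτ, comp_twistMiddle_apply, a0]
  have t1 : τ (c 1) = σ (c 1) * σ (c 2) * σ (c 1) * (σ (c 1) * σ (c 2))⁻¹ := by
    rw [hτ, comp_twistMiddle_apply, a1]; simp only [map_mul, map_inv]
  have t2 : τ (c 2) = σ (c 1) * σ (c 2) * (σ (c 1))⁻¹ := by
    rw [hτ, comp_twistMiddle_apply, a2]; simp only [map_mul, map_inv]; group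
  have cyc : tr (σ (c 1) * σ (c 2) * σ (c 0)) = trW σ := by
    rw [trW, map_mul, map_mul, tr_mul_comm (σ (c 1) * σ (c 2)),
      mul_assoc (σ (c 0)) (σ (c 1)) (σ (c 2))]
  have hZ : trZ τ = tr (σ (c 1)) * trW σ + tr (σ (c 0)) * tr (σ (c 2)) - trX σ * trY σ - trZ σ := by
    simp only [trZ, map_mul, t0, t2]
    rw [tr_mul_comm, tr_half_twist, cyc]
    simp only [trX, trY, map_mul]
    rw [tr_mul_comm (σ (c 1)) (σ (c 0)), tr_mul_comm (σ (c 2)) (σ (c 0))]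
    ring
  refine ⟨?_, hZ, ?_⟩
  · simp only [trY, map_mul, t1, t2]
    rw [← tr_conj (σ (c 1) * σ (c 2)) (σ (c 1) * σ (c 2))]
    congr 1
    group
  · have e : τ (c 1) = τ (c 2) * σ (c 1) * (τ (c 2))⁻¹ := by
      rw [t1, t2]; group
    have e1 : τ (c 2) * σ (c 1) = σ (c 1) * σ (c 2) := by rw [t2]; group
    have e2 : tr (τ (c 2)) = tr (σ (c 2)) := by rw [t2, tr_conj]
    have e3 : tr (τ (c 2) * σ (c 0)) = trZ τ := by
      rw [trZ, map_mul, t0, tr_mul_comm]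
    have e4 : trX τ = tr (τ (c 1) * σ (c 0)) := by
      rw [trX, map_mul, t0, tr_mul_comm]
    have e5 : tr (σ (c 1) * σ (c 0)) = trX σ := by
      rw [trX, map_mul, tr_mul_comm]
    rw [e4, e, tr_half_twist, e1, e2, e3, cyc, e5]
    simp only [trY, map_mul]
    ring

/-! ### Fixed points of Dehn twists -/

theorem eq_of_commute {p q : ℍ} {ϑ φ : ℝ} (hϑ : 0 < Real.sin (ϑ / 2)) (hφ : 0 < Real.sin (φ / 2))
    (h : Commute (rotAbout p ϑ) (rotAbout q φ)) : p = q := by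
  have h1 := conj_rotAbout (rotAbout p ϑ) q φ
  have h2 : rotAbout p ϑ * rotAbout q φ * (rotAbout p ϑ)⁻¹ = rotAbout q φ := by
    rw [h.eq, mul_inv_cancel_right]
  rw [h2] at h1
  have hfix := center_injective hφ rfl h1
  have hp := p.im_pos
  have hq := q.im_pos
  obtain ⟨e1, e2, e3, e4⟩ := rotAbout_entries p ϑ
  obtain ⟨g1, g2, g3, g4⟩ := rotAbout_entries q φ
  have k1 : (rotAbout p ϑ * rotAbout q φ).1 0 0 = (rotAbout q φ * rotAbout p ϑ).1 0 0 := by rw [h.eq]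
  have k2 : (rotAbout p ϑ * rotAbout q φ).1 1 0 = (rotAbout q φ * rotAbout p ϑ).1 1 0 := by rw [h.eq]
  simp only [mul_entry, e1, e2, e3, e4, g1, g2, g3, g4] at k1 k2
  have hs : Real.sin (ϑ / 2) * Real.sin (φ / 2) ≠ 0 := (mul_pos hϑ hφ).ne'
  have l1 : (q.re - p.re) = 0 := by
    field_simp at k2
    apply (mul_eq_zero.mp (_ : (Real.sin (ϑ / 2) * Real.sin (φ / 2)) * (q.re - p.re) = 0)).resolve_left hs
    linarith
  have hre : p.re = q.re := by linarith
  have l2 : p.im ^ 2 - q.im ^ 2 = 0 := by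
    rw [hre] at k1
    field_simp at k1
    apply (mul_eq_zero.mp (_ : (Real.sin (ϑ / 2) * Real.sin (φ / 2)) * (p.im ^ 2 - q.im ^ 2) = 0)).resolve_left hs
    linarith
  have him : p.im = q.im := by nlinarith
  exact UpperHalfPlane.ext_re_im hre him

/-- The fixed-point equation is quadratic with real coefficients. It has at most one root in the
upper half-plane, unless it vanishes identically. -/
theorem eq_one_or_neg_one_of_fixes {p q : ℍ} (hpq : p ≠ q) {g : SL(2, ℝ)} (hp : g • p = p)
    (hq : g • q = q) : g = 1 ∨ g = -1 := by
  have key (s : ℍ) (hs : g • s = s) : g.1 0 1 = -((s.re ^ 2 + s.im ^ 2) * g.1 1 0) ∧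
      g.1 0 0 - g.1 1 1 = 2 * s.re * g.1 1 0 := by
    have h1 := conj_rotAbout g s π
    rw [hs, mul_inv_eq_iff_eq_mul] at h1
    have k1 : (g * rotAbout s π).1 0 0 = (rotAbout s π * g).1 0 0 := by rw [h1]
    have k2 : (g * rotAbout s π).1 1 0 = (rotAbout s π * g).1 1 0 := by rw [h1]
    obtain ⟨e1, e2, e3, e4⟩ := rotAbout_entries s π
    have hsp := s.im_pos
    simp only [mul_entry, e1, e2, e3, e4, Real.cos_pi_div_two, Real.sin_pi_div_two] at k1 k2
    field_simp at k1 k2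
    exact ⟨by linarith, by linarith⟩
  obtain ⟨p1, p2⟩ := key p hp
  obtain ⟨q1, q2⟩ := key q hq
  have hd := det_eq g
  have h10 : g.1 1 0 = 0 := by
    by_contra h0
    apply hpq
    have hre : p.re = q.re := by
      apply mul_right_cancel₀ h0; linarith
    have hsq : p.im ^ 2 = q.im ^ 2 := by
      rw [hre] at p1
      apply mul_right_cancel₀ h0; linarith
    have hp0 := p.im_pos
    have hq0 := q.im_pos
    exact UpperHalfPlane.ext_re_im hre ((pow_left_inj₀ hp0.le hq0.le two_ne_zero).mp hsq)
  have h01 : g.1 0 1 = 0 := by rw [p1, h10]; ring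
  have h11 : g.1 1 1 = g.1 0 0 := by rw [h10] at p2; linarith
  rw [h10, h11] at hd
  have hsq : (g.1 0 0 - 1) * (g.1 0 0 + 1) = 0 := by linarith
  obtain ⟨o1, o2, o3, o4⟩ := one_entries
  rcases mul_eq_zero.mp hsq with h1 | h1
  · left
    apply sl_ext <;> simp only [o1, o2, o3, o4] <;> linarith
  · right
    apply sl_ext <;> simp only [neg_entry, o1, o2, o3, o4] <;> linarith

theorem smul_eq_self_of_conj_eq {g : SL(2, ℝ)} {p : ℍ} {ϑ : ℝ} (hϑ : 0 < Real.sin (ϑ / 2))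
    (h : g * rotAbout p ϑ * g⁻¹ = rotAbout p ϑ) : g • p = p := by
  rw [conj_rotAbout] at h
  exact center_injective hϑ rfl h

theorem eq_of_commute_mul {p q : ℍ} {ϑ φ : ℝ} (hϑ : 0 < Real.sin (ϑ / 2))
    (hφ : 0 < Real.sin (φ / 2)) (h : rotAbout p ϑ * rotAbout q φ * rotAbout p ϑ *
      (rotAbout p ϑ * rotAbout q φ)⁻¹ = rotAbout p ϑ) : p = q := by
  apply eq_of_commute hϑ hφ
  have h1 := mul_inv_eq_iff_eq_mul.mp h
  rw [mul_assoc (rotAbout p ϑ) (rotAbout q φ) (rotAbout p ϑ)] at h1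
  exact (mul_left_cancel h1).symm

/-- The twist leaves `c 2` and `c 3` alone, so a matrix realizing the equality of classes fixes both
of their centres. If these differ it is `±1`, the twist acts trivially on `σ (c 0)`, and the first
two rotations commute. -/
theorem centers_of_twistFirst {α : Fin 4 → ℝ} (hα : Angles α) {σ : SphereGroup →* SL(2, ℝ)}
    {C : Fin 4 → ℍ} (hσ : IsLift α σ C)
    (h : twistFirst⁻¹ • (⟦proj.comp σ⟧ : Rep) = ⟦proj.comp σ⟧) : C 0 = C 1 ∨ C 2 = C 3 := by
  rw [smul_class] at h
  obtain ⟨D, hD⟩ := hσ.comp twistFirst.2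
  obtain ⟨g, hg⟩ := hσ.exists_conj hα hD h.symm
  obtain ⟨a0, a1, a2, a3⟩ := twistFirstHom_c (c 0 * c 1) (Commute.refl _)
  have t0 : g * σ (c 0) * g⁻¹ = σ (c 0 * c 1 * c 0 * (c 0 * c 1)⁻¹) := by
    rw [← a0, ← conjHom_apply, ← hg]; rfl
  have t2 : g * σ (c 2) * g⁻¹ = σ (c 2) := by
    conv_rhs => rw [← a2]
    rw [← conjHom_apply, ← hg]; rfl
  have t3 : g * σ (c 3) * g⁻¹ = σ (c 3) := by
    conv_rhs => rw [← a3]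
    rw [← conjHom_apply, ← hg]; rfl
  obtain ⟨h0, h1, h2, h3⟩ := hσ
  by_cases h23 : C 2 = C 3
  · exact Or.inr h23
  left
  rw [h2] at t2
  rw [h3, mul_neg, neg_mul, neg_inj] at t3
  have hg1 := eq_one_or_neg_one_of_fixes h23 (smul_eq_self_of_conj_eq (hα.sin_pos 2) t2)
    (smul_eq_self_of_conj_eq (hα.sin_pos 3) t3)
  apply eq_of_commute_mul (hα.sin_pos 0) (hα.sin_pos 1)
  rw [← h0, ← h1]
  simp only [map_mul, map_inv] at t0
  rw [← t0]
  rcases hg1 with rfl | rfl <;> simp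

theorem centers_of_twistMiddle {α : Fin 4 → ℝ} (hα : Angles α) {σ : SphereGroup →* SL(2, ℝ)}
    {C : Fin 4 → ℍ} (hσ : IsLift α σ C)
    (h : twistMiddle⁻¹ • (⟦proj.comp σ⟧ : Rep) = ⟦proj.comp σ⟧) : C 1 = C 2 ∨ C 3 = C 0 := by
  rw [smul_class] at h
  obtain ⟨D, hD⟩ := hσ.comp twistMiddle.2
  obtain ⟨g, hg⟩ := hσ.exists_conj hα hD h.symm
  obtain ⟨a0, a1, a2, a3⟩ := twistMiddleHom_c (c 1 * c 2) (Commute.refl _)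
  have t1 : g * σ (c 1) * g⁻¹ = σ (c 1 * c 2 * c 1 * (c 1 * c 2)⁻¹) := by
    rw [← a1, ← conjHom_apply, ← hg]; rfl
  have t0 : g * σ (c 0) * g⁻¹ = σ (c 0) := by
    conv_rhs => rw [← a0]
    rw [← conjHom_apply, ← hg]; rfl
  have t3 : g * σ (c 3) * g⁻¹ = σ (c 3) := by
    conv_rhs => rw [← a3]
    rw [← conjHom_apply, ← hg]; rfl
  obtain ⟨h0, h1, h2, h3⟩ := hσ
  by_cases h30 : C 3 = C 0
  · exact Or.inr h30
  left
  rw [h0] at t0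
  rw [h3, mul_neg, neg_mul, neg_inj] at t3
  have hg1 := eq_one_or_neg_one_of_fixes h30 (smul_eq_self_of_conj_eq (hα.sin_pos 3) t3)
    (smul_eq_self_of_conj_eq (hα.sin_pos 0) t0)
  apply eq_of_commute_mul (hα.sin_pos 1) (hα.sin_pos 2)
  rw [← h1, ← h2]
  simp only [map_mul, map_inv] at t1
  rw [← t1]
  rcases hg1 with rfl | rfl <;> simp

/-- Three of the four centres of a lift cannot coincide. -/
theorem not_three_centers {p q : ℍ} {a b d e : ℝ} (ha : 0 < Real.sin (a / 2))
    (he : 0 < Real.sin (e / 2)) (hs1 : 6 * π < a + b + d + e) (hs2 : a + b + d + e < 8 * π)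
    (h : rotAbout p a * rotAbout p b * rotAbout p d * rotAbout q e = -1) : False := by
  rw [rotAbout_mul, rotAbout_mul] at h
  -- The last rotation is, up to sign, a rotation about `p` too; it commutes with the first, which
  -- forces `q = p`.
  have hq : rotAbout q e = -rotAbout p (-(a + b + d)) := by
    rw [← rotAbout_inv, eq_comm, ← mul_one (-_), neg_mul_comm, inv_mul_eq_iff_eq_mul, h]
  have hpq : p = q := by
    apply eq_of_commute ha he
    rw [hq]
    apply Commute.neg_right
    rw [Commute, SemiconjBy, rotAbout_mul, rotAbout_mul, add_comm]
  subst hpq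
  rw [rotAbout_mul] at h
  have h10 : (rotAbout p (a + b + d + e)).1 1 0 = 0 := by
    rw [h, neg_entry, one_entries.2.2.1, neg_zero]
  rw [(rotAbout_entries p (a + b + d + e)).2.2.1] at h10
  have hp := p.im_pos
  have hsin : Real.sin ((a + b + d + e) / 2) = 0 := by
    rcases mul_eq_zero.mp h10 with h1 | h1
    · linarith
    · exact absurd h1 (by positivity)
  -- The half sum of the angles lies strictly between `3π` and `4π`, where the sine does not vanish.
  have hpos : 0 < Real.sin ((a + b + d + e) / 2 - 3 * π) := by
    apply Real.sin_pos_of_pos_of_lt_pi <;> linarith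
  have : (a + b + d + e) / 2 - 3 * π = (a + b + d + e) / 2 - π - 2 * π := by ring
  rw [this, Real.sin_sub_two_pi, Real.sin_sub_pi, hsin] at hpos
  norm_num at hpos

theorem cycle_neg_one {A B C D : SL(2, ℝ)} (h : A * B * C * D = -1) : B * C * D * A = -1 := by
  have e : B * C * D * A = A⁻¹ * (A * B * C * D) * A := by group
  rw [e, h, mul_neg, mul_one, neg_mul, inv_mul_cancel]

/-- Each twist makes two cyclically adjacent centres coincide, and the two coincidences share a
centre. After a cyclic rotation of the relation, three equal centres come first. -/
theorem not_fixed_by_both {α : Fin 4 → ℝ} (hα : Angles α) {σ : SphereGroup →* SL(2, ℝ)}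
    {C : Fin 4 → ℍ} (hσ : IsLift α σ C)
    (h1 : twistFirst⁻¹ • (⟦proj.comp σ⟧ : Rep) = ⟦proj.comp σ⟧)
    (h2 : twistMiddle⁻¹ • (⟦proj.comp σ⟧ : Rep) = ⟦proj.comp σ⟧) : False := by
  have p0 := hσ.prod
  have p1 := cycle_neg_one p0
  have p2 := cycle_neg_one p1
  have p3 := cycle_neg_one p2
  have hs := hα.sum
  have u (i : Fin 4) := hα.upper i
  have s (i : Fin 4) := hα.sin_pos i
  rcases centers_of_twistFirst hα hσ h1 with h01 | h23 <;>
    rcases centers_of_twistMiddle hα hσ h2 with h12 | h30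
  · rw [h01, h12] at p0
    exact not_three_centers (s 0) (s 3) (by linarith) (by linarith [u 0, u 1, u 2, u 3]) p0
  · rw [h30, h01] at p3
    exact not_three_centers (s 3) (s 2) (by linarith) (by linarith [u 0, u 1, u 2, u 3]) p3
  · rw [h12, h23] at p1
    exact not_three_centers (s 1) (s 0) (by linarith) (by linarith [u 0, u 1, u 2, u 3]) p1
  · rw [h23, h30] at p2
    exact not_three_centers (s 2) (s 1) (by linarith) (by linarith [u 0, u 1, u 2, u 3]) p2

/-! ### Trace coordinates of lifts -/

/-- The trace of the canonical lift of a rotation of angle `α i`. -/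
noncomputable def trc (α : Fin 4 → ℝ) (i : Fin 4) : ℝ := 2 * Real.cos (α i / 2)

theorem IsLift.traces {α : Fin 4 → ℝ} {σ : SphereGroup →* SL(2, ℝ)} {C : Fin 4 → ℍ}
    (h : IsLift α σ C) : tr (σ (c 0)) = trc α 0 ∧ tr (σ (c 1)) = trc α 1 ∧
      tr (σ (c 2)) = trc α 2 ∧ trW σ = -trc α 3 := by
  obtain ⟨h0, h1, h2, h3⟩ := h
  have e : c 0 * c 1 * c 2 = (c 3)⁻¹ := by rw [c_three, inv_inv]
  refine ⟨?_, ?_, ?_, ?_⟩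
  · rw [h0, tr_rotAbout, trc]
  · rw [h1, tr_rotAbout, trc]
  · rw [h2, tr_rotAbout, trc]
  · rw [trW, e, map_inv, tr_inv, h3, tr_neg, tr_rotAbout, trc]

theorem Angles.trc_neg {α : Fin 4 → ℝ} (hα : Angles α) (i : Fin 4) : trc α i < 0 := by
  have := hα.cos_neg i
  rw [trc]; linarith

theorem Angles.trc_inj {α : Fin 4 → ℝ} (hα : Angles α) {i j : Fin 4} (h : trc α i = trc α j) :
    α i = α j := by
  have hpi := Real.pi_pos
  have i1 := hα.lower i
  have i2 := hα.upper i
  have j1 := hα.lower j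
  have j2 := hα.upper j
  have h1 : Real.cos (α i / 2) = Real.cos (α j / 2) := by rw [trc, trc] at h; linarith
  have := Real.injOn_cos ⟨by linarith, by linarith⟩ ⟨by linarith, by linarith⟩ h1
  linarith

theorem coords_of_class_eq {α : Fin 4 → ℝ} (hα : Angles α) {σ τ : SphereGroup →* SL(2, ℝ)}
    {C D : Fin 4 → ℍ} (hσ : IsLift α σ C) (hτ : IsLift α τ D)
    (h : (⟦proj.comp σ⟧ : Rep) = ⟦proj.comp τ⟧) :
    trX σ = trX τ ∧ trY σ = trY τ ∧ trZ σ = trZ τ := by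
  obtain ⟨g, rfl⟩ := hσ.exists_conj hα hτ h
  simp only [trX, trY, trZ, conjHom_apply, tr_conj, and_self]

theorem class_eq_of_coords {α : Fin 4 → ℝ} (hα : Angles α) {σ τ : SphereGroup →* SL(2, ℝ)}
    {C D : Fin 4 → ℍ} (hσ : IsLift α σ C) (hτ : IsLift α τ D)
    (hx : trX σ = trX τ) (hy : trY σ = trY τ) (hz : trZ σ = trZ τ) :
    (⟦proj.comp σ⟧ : Rep) = ⟦proj.comp τ⟧ := by
  obtain ⟨g, rfl⟩ := hσ.exists_conj_of_tr hα hτ hx hy hz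
  exact (class_conjHom g σ).symm

theorem coords_twistFirst {α : Fin 4 → ℝ} (hα : Angles α) {σ τ : SphereGroup →* SL(2, ℝ)}
    {C D : Fin 4 → ℍ} (hσ : IsLift α σ C) (hτ : IsLift α τ D)
    (h : twistFirst⁻¹ • (⟦proj.comp σ⟧ : Rep) = ⟦proj.comp τ⟧) :
    trX τ = trX σ ∧
    trY τ = -trc α 0 * trc α 3 + trc α 1 * trc α 2 - trX σ * trZ σ - trY σ ∧
    trZ τ = -trc α 1 * trc α 3 + trc α 0 * trc α 2 - trX σ * trY τ - trZ σ := by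
  rw [smul_class] at h
  obtain ⟨E, hE⟩ := hσ.comp twistFirst.2
  obtain ⟨e1, e2, e3⟩ := coords_of_class_eq hα hE hτ h
  obtain ⟨t0, t1, t2, t3⟩ := hσ.traces
  obtain ⟨f1, f2, f3⟩ := tr_twistFirst σ
  rw [e2, t0, t1, t2, t3] at f2
  rw [e2, e3, t0, t1, t2, t3] at f3
  exact ⟨e1.symm.trans f1, by rw [f2]; ring, by rw [f3]; ring⟩

theorem coords_twistMiddle {α : Fin 4 → ℝ} (hα : Angles α) {σ τ : SphereGroup →* SL(2, ℝ)}
    {C D : Fin 4 → ℍ} (hσ : IsLift α σ C) (hτ : IsLift α τ D)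
    (h : twistMiddle⁻¹ • (⟦proj.comp σ⟧ : Rep) = ⟦proj.comp τ⟧) :
    trY τ = trY σ ∧
    trZ τ = -trc α 1 * trc α 3 + trc α 0 * trc α 2 - trX σ * trY σ - trZ σ ∧
    trX τ = -trc α 2 * trc α 3 + trc α 0 * trc α 1 - trY σ * trZ τ - trX σ := by
  rw [smul_class] at h
  obtain ⟨E, hE⟩ := hσ.comp twistMiddle.2
  obtain ⟨e1, e2, e3⟩ := coords_of_class_eq hα hE hτ h
  obtain ⟨t0, t1, t2, t3⟩ := hσ.traces
  obtain ⟨f1, f2, f3⟩ := tr_twistMiddle σ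
  rw [e3, t0, t1, t2, t3] at f2
  rw [e1, e3, t0, t1, t2, t3] at f3
  exact ⟨e2.symm.trans f1, by rw [f2]; ring, by rw [f3]; ring⟩

/-! ### The exceptional points -/

/-- The angles are equal in two pairs, one of which is formed by the last puncture and by the
puncture `m`. -/
def Pat (m : Fin 3) (α : Fin 4 → ℝ) : Prop :=
  match m with
  | 0 => α 0 = α 3 ∧ α 1 = α 2
  | 1 => α 1 = α 3 ∧ α 0 = α 2
  | 2 => α 2 = α 3 ∧ α 0 = α 1

/-- The trace coordinates that vanish on `typeSet α m`. -/
def Zeros (m : Fin 3) (σ : SphereGroup →* SL(2, ℝ)) : Prop :=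
  match m with
  | 0 => trX σ = 0 ∧ trZ σ = 0
  | 1 => trX σ = 0 ∧ trY σ = 0
  | 2 => trY σ = 0 ∧ trZ σ = 0

/-- The remaining trace coordinate on `typeSet α m`. -/
def freeTr (m : Fin 3) (σ : SphereGroup →* SL(2, ℝ)) : ℝ :=
  match m with
  | 0 => trY σ
  | 1 => trZ σ
  | 2 => trX σ

/-- The value of the remaining trace coordinate at one point of `typeSet α m`. -/
noncomputable def rootFst (m : Fin 3) (α : Fin 4 → ℝ) : ℝ :=
  match m with
  | 0 => trc α 1 ^ 2 - 2
  | 1 => trc α 0 ^ 2 - 2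
  | 2 => trc α 0 ^ 2 - 2

/-- The value of the remaining trace coordinate at the other point of `typeSet α m`. -/
noncomputable def rootSnd (m : Fin 3) (α : Fin 4 → ℝ) : ℝ :=
  match m with
  | 0 => 2 - trc α 0 ^ 2
  | 1 => 2 - trc α 1 ^ 2
  | 2 => 2 - trc α 2 ^ 2

/-- This links the conditions stable under half twists to those seen by the coordinates. Here `w =
-trc α 3`, so `tr A = -w` says that the exceptional angle equals the last one. -/
theorem hasRole_iff {α : Fin 4 → ℝ} (hα : Angles α) {σ : SphereGroup →* SL(2, ℝ)}
    {C : Fin 4 → ℍ} (hσ : IsLift α σ C) (m : Fin 3) : HasRole m σ ↔ Pat m α ∧ Zeros m σ := by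
  obtain ⟨t0, t1, t2, t3⟩ := hσ.traces
  have hx : tr (σ (c 0) * σ (c 1)) = trX σ := by rw [trX, map_mul]
  have hy : tr (σ (c 1) * σ (c 2)) = trY σ := by rw [trY, map_mul]
  have hz : tr (σ (c 0) * σ (c 2)) = trZ σ := by rw [trZ, map_mul]
  have hw : tr (σ (c 0) * σ (c 1) * σ (c 2)) = trW σ := by rw [trW, map_mul, map_mul]
  simp only [HasRole, Role, hx, hy, hz, hw, t0, t1, t2, t3]
  match m with
  | 0 =>
    constructor
    · rintro ⟨w, b, hw, ⟨-, h1, h2, h3, h4, h5⟩ | ⟨h, -⟩ | ⟨h, -⟩⟩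
      · exact ⟨⟨hα.trc_inj (by linarith), hα.trc_inj (by linarith)⟩, h4, h5⟩
      · exact absurd h (by decide)
      · exact absurd h (by decide)
    · rintro ⟨⟨h1, h2⟩, h3, h4⟩
      refine ⟨_, trc α 1, rfl, Or.inl ⟨rfl, ?_, rfl, ?_, h3, h4⟩⟩
      · rw [neg_neg, trc, trc, h1]
      · rw [trc, trc, h2]
  | 1 =>
    constructor
    · rintro ⟨w, b, hw, ⟨h, -⟩ | ⟨-, h1, h2, h3, h4, h5⟩ | ⟨h, -⟩⟩
      · exact absurd h (by decide)
      · exact ⟨⟨hα.trc_inj (by linarith), hα.trc_inj (by linarith)⟩, h4, h5⟩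
      · exact absurd h (by decide)
    · rintro ⟨⟨h1, h2⟩, h3, h4⟩
      refine ⟨_, trc α 0, rfl, Or.inr (Or.inl ⟨rfl, rfl, ?_, ?_, h3, h4⟩)⟩
      · rw [neg_neg, trc, trc, h1]
      · rw [trc, trc, h2]
  | 2 =>
    constructor
    · rintro ⟨w, b, hw, ⟨h, -⟩ | ⟨h, -⟩ | ⟨-, h1, h2, h3, h4, h5⟩⟩
      · exact absurd h (by decide)
      · exact absurd h (by decide)
      · exact ⟨⟨hα.trc_inj (by linarith), hα.trc_inj (by linarith)⟩, h4, h5⟩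
    · rintro ⟨⟨h1, h2⟩, h3, h4⟩
      refine ⟨_, trc α 0, rfl, Or.inr (Or.inr ⟨rfl, rfl, ?_, ?_, h3, h4⟩)⟩
      · rw [trc, trc, h2]
      · rw [neg_neg, trc, trc, h1]

/-- With two vanishing coordinates and the angles equal in pairs, the Fricke relation factors into
two linear terms in the third coordinate. -/
theorem freeTr_eq {α : Fin 4 → ℝ} {σ : SphereGroup →* SL(2, ℝ)} {C : Fin 4 → ℍ}
    (hσ : IsLift α σ C) {m : Fin 3} (hp : Pat m α) (hz : Zeros m σ) :
    freeTr m σ = rootFst m α ∨ freeTr m σ = rootSnd m α := by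
  obtain ⟨t0, t1, t2, t3⟩ := hσ.traces
  have hF := fricke (σ (c 0)) (σ (c 1)) (σ (c 2))
  have hx : tr (σ (c 0) * σ (c 1)) = trX σ := by rw [trX, map_mul]
  have hy : tr (σ (c 1) * σ (c 2)) = trY σ := by rw [trY, map_mul]
  have hz' : tr (σ (c 0) * σ (c 2)) = trZ σ := by rw [trZ, map_mul]
  have hw : tr (σ (c 0) * σ (c 1) * σ (c 2)) = trW σ := by rw [trW, map_mul, map_mul]
  rw [hx, hy, hz', hw, t0, t1, t2, t3] at hF
  rw [← sub_eq_zero, ← sub_eq_zero (a := freeTr m σ) (b := rootSnd m α), ← mul_eq_zero]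
  match m with
  | 0 =>
    obtain ⟨h1, h2⟩ := hp
    obtain ⟨h3, h4⟩ := hz
    have e1 : trc α 3 = trc α 0 := by rw [trc, trc, h1]
    have e2 : trc α 2 = trc α 1 := by rw [trc, trc, h2]
    simp only [freeTr, rootFst, rootSnd]
    rw [h3, h4, e1, e2] at hF
    linarith
  | 1 =>
    obtain ⟨h1, h2⟩ := hp
    obtain ⟨h3, h4⟩ := hz
    have e1 : trc α 3 = trc α 1 := by rw [trc, trc, h1]
    have e2 : trc α 2 = trc α 0 := by rw [trc, trc, h2]
    simp only [freeTr, rootFst, rootSnd]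
    rw [h3, h4, e1, e2] at hF
    linarith
  | 2 =>
    obtain ⟨h1, h2⟩ := hp
    obtain ⟨h3, h4⟩ := hz
    have e1 : trc α 3 = trc α 2 := by rw [trc, trc, h1]
    have e2 : trc α 1 = trc α 0 := by rw [trc, trc, h2]
    simp only [freeTr, rootFst, rootSnd]
    rw [h3, h4, e1, e2] at hF
    linarith

theorem class_eq_of_freeTr_eq {α : Fin 4 → ℝ} (hα : Angles α) {σ τ : SphereGroup →* SL(2, ℝ)}
    {C D : Fin 4 → ℍ} (hσ : IsLift α σ C) (hτ : IsLift α τ D) {m : Fin 3} (h1 : Zeros m σ)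
    (h2 : Zeros m τ) (h : freeTr m σ = freeTr m τ) :
    (⟦proj.comp σ⟧ : Rep) = ⟦proj.comp τ⟧ := by
  match m with
  | 0 => exact class_eq_of_coords hα hσ hτ (h1.1.trans h2.1.symm) h (h1.2.trans h2.2.symm)
  | 1 => exact class_eq_of_coords hα hσ hτ (h1.1.trans h2.1.symm) (h1.2.trans h2.2.symm) h
  | 2 => exact class_eq_of_coords hα hσ hτ h (h1.1.trans h2.1.symm) (h1.2.trans h2.2.symm)

/-- The difference of the equations is `(x - y)(u + w) = 0` up to sign, and negativity excludes `u +
w = 0`. -/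
theorem coords_zero_or {x y u w : ℝ} (hx : x < 0) (hy : y < 0) (hu : u < 0) (hw : w < 0)
    (h1 : -x * w + y * u = 0) (h2 : -y * w + x * u = 0) : x = y ∧ u = w := by
  have h3 : (x - y) * (u + w) = 0 := by linarith
  have h4 : x = y := by
    rcases mul_eq_zero.mp h3 with h | h
    · linarith
    · linarith
  refine ⟨h4, ?_⟩
  subst h4
  have h5 : x * (u - w) = 0 := by linarith
  rcases mul_eq_zero.mp h5 with h | h
  · linarith
  · linarith

/-- The points of an orbit of length two are exceptional. -/
theorem exists_subset_typeSet {α : Fin 4 → ℝ} (hα : Angles α) {O : Set Rep}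
    (hO : IsTypeIIOrbit α O) : ∃ m, Pat m α ∧ O ⊆ typeSet α m := by
  obtain ⟨hDT, ⟨x₀, hx₀⟩, hcard⟩ := hO
  have hinv (φ : pureAut) {x : Rep} (hx : x ∈ O) : φ • x ∈ O := by
    rw [hx₀, orbit_eq] at hx ⊢
    exact MulAction.mem_orbit_of_mem_orbit φ hx
  obtain ⟨P, Q, hPQ, rfl⟩ := Set.ncard_eq_two.mp hcard
  obtain ⟨ρ, rfl⟩ := Quotient.exists_rep P
  obtain ⟨ρ', rfl⟩ := Quotient.exists_rep Q
  obtain ⟨σ, C, hσ, rfl⟩ := exists_isLift_of_mem_DT hα (hDT (Or.inl rfl))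
  obtain ⟨τ, D, hτ, rfl⟩ := exists_isLift_of_mem_DT hα (hDT (Or.inr rfl))
  -- An automorphism permutes the two points of the orbit, so it fixes both or exchanges them.
  have two (φ : pureAut) : (φ • (⟦proj.comp σ⟧ : Rep) = ⟦proj.comp σ⟧ ∧
      φ • (⟦proj.comp τ⟧ : Rep) = ⟦proj.comp τ⟧) ∨
      (φ • (⟦proj.comp σ⟧ : Rep) = ⟦proj.comp τ⟧ ∧
      φ • (⟦proj.comp τ⟧ : Rep) = ⟦proj.comp σ⟧) := by
    rcases hinv φ (Or.inl rfl : (⟦proj.comp σ⟧ : Rep) ∈ _) with h1 | h1 <;>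
      rcases hinv φ (Or.inr rfl : (⟦proj.comp τ⟧ : Rep) ∈ _) with h2 | h2
    · exact absurd (smul_left_cancel φ (h1.trans h2.symm)) hPQ
    · exact Or.inl ⟨h1, h2⟩
    · exact Or.inr ⟨h1, h2⟩
    · exact absurd (smul_left_cancel φ (h1.trans h2.symm)) hPQ
  have n0 := hα.trc_neg 0
  have n1 := hα.trc_neg 1
  have n2 := hα.trc_neg 2
  have n3 := hα.trc_neg 3
  have fin (m : Fin 3) (hp : Pat m α) (h1 : Zeros m σ) (h2 : Zeros m τ) :
      ∃ m, Pat m α ∧ ({⟦proj.comp σ⟧, ⟦proj.comp τ⟧} : Set Rep) ⊆ typeSet α m := by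
    refine ⟨m, hp, ?_⟩
    rintro y (rfl | rfl)
    · exact ⟨σ, C, hσ, rfl, (hasRole_iff hα hσ m).mpr ⟨hp, h1⟩⟩
    · exact ⟨τ, D, hτ, rfl, (hasRole_iff hα hτ m).mpr ⟨hp, h2⟩⟩
  have hne : trX σ = trX τ → trY σ = trY τ → trZ σ = trZ τ → False := fun hx hy hz =>
    hPQ (class_eq_of_coords hα hσ hτ hx hy hz)
  rcases two twistFirst⁻¹ with ⟨f1, f2⟩ | ⟨f1, f2⟩ <;>
    rcases two twistMiddle⁻¹ with ⟨g1, g2⟩ | ⟨g1, g2⟩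
  · exact (not_fixed_by_both hα hσ f1 g1).elim
  · obtain ⟨-, a1, a2⟩ := coords_twistFirst hα hσ hσ f1
    obtain ⟨-, b1, b2⟩ := coords_twistFirst hα hτ hτ f2
    obtain ⟨d1, d2, d3⟩ := coords_twistMiddle hα hσ hτ g1
    -- The first twist fixes the points and the second exchanges them. Thus `Y` and `Z` agree at
    -- both points and `X` differs; subtracting the formulas of the fixing twist makes `Z` and `Y`
    -- vanish. The two other cases are analogous.
    have hz : trZ τ = trZ σ := by linarith
    have hx : trX σ - trX τ ≠ 0 := fun h => hne (by linarith) d1.symm hz.symm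
    rw [d1, hz] at b1 b2
    have z0 : trZ σ = 0 := (mul_eq_zero.mp (by linarith : (trX σ - trX τ) * trZ σ = 0)).resolve_left hx
    have y0 : trY σ = 0 := (mul_eq_zero.mp (by linarith : (trX σ - trX τ) * trY σ = 0)).resolve_left hx
    rw [z0, y0] at a1 a2
    obtain ⟨e1, e2⟩ := coords_zero_or n0 n1 n2 n3 (by linarith) (by linarith)
    exact fin 2 ⟨hα.trc_inj e2, hα.trc_inj e1⟩ ⟨y0, z0⟩ ⟨d1.trans y0, hz.trans z0⟩
  · obtain ⟨d1, d2, d3⟩ := coords_twistFirst hα hσ hτ f1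
    obtain ⟨-, a1, a2⟩ := coords_twistMiddle hα hσ hσ g1
    obtain ⟨-, b1, b2⟩ := coords_twistMiddle hα hτ hτ g2
    have hz : trZ τ = trZ σ := by rw [d1] at b1; linarith
    have hy : trY σ - trY τ ≠ 0 := fun h => hne d1.symm (by linarith) hz.symm
    rw [d1, hz] at b1 b2
    have z0 : trZ σ = 0 := (mul_eq_zero.mp (by linarith : (trY σ - trY τ) * trZ σ = 0)).resolve_left hy
    have x0 : trX σ = 0 := (mul_eq_zero.mp (by linarith : (trY σ - trY τ) * trX σ = 0)).resolve_left hy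
    rw [z0, x0] at a1 a2
    obtain ⟨e1, e2⟩ := coords_zero_or n1 n2 n0 n3 (by linarith) (by linarith)
    exact fin 0 ⟨hα.trc_inj e2, hα.trc_inj e1⟩ ⟨x0, z0⟩ ⟨d1.trans x0, hz.trans z0⟩
  · obtain ⟨d1, d2, d3⟩ := coords_twistFirst hα hσ hτ f1
    obtain ⟨-, d2', d3'⟩ := coords_twistFirst hα hτ hσ f2
    obtain ⟨k1, k2, k3⟩ := coords_twistMiddle hα hσ hτ g1
    obtain ⟨-, k2', k3'⟩ := coords_twistMiddle hα hτ hσ g2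
    have hz : trZ σ - trZ τ ≠ 0 := fun h => hne d1.symm k1.symm (by linarith)
    simp only [k1, d1] at d2 d3 d2' d3' k2 k3 k2' k3'
    have x0 : trX σ = 0 := (mul_eq_zero.mp (by linarith : (trZ σ - trZ τ) * trX σ = 0)).resolve_left hz
    have y0 : trY σ = 0 := (mul_eq_zero.mp (by linarith : (trZ σ - trZ τ) * trY σ = 0)).resolve_left hz
    rw [x0, y0] at d2 k3
    obtain ⟨e1, e2⟩ := coords_zero_or n0 n2 n1 n3 (by linarith) (by linarith)
    exact fin 1 ⟨hα.trc_inj e2, hα.trc_inj e1⟩ ⟨x0, y0⟩ ⟨d1.trans x0, k1.trans y0⟩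

/-! ### Existence of the exceptional points -/

/-- The half sum lies in `(3π/2, 2π)`, where the cosine is positive. This is the use of `3π < ϑ +
φ`: two such rotations can have a traceless product, at a positive distance of their centres. -/
theorem sin_lt_cos {ϑ φ : ℝ} (h1 : ϑ < 2 * π) (h2 : φ < 2 * π) (h : 3 * π < ϑ + φ) :
    Real.sin (ϑ / 2) * Real.sin (φ / 2) < Real.cos (ϑ / 2) * Real.cos (φ / 2) := by
  have e := Real.cos_add (ϑ / 2) (φ / 2)
  have hpi := Real.pi_pos
  have h3 : 0 < Real.cos (ϑ / 2 + φ / 2 - 2 * π) := by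
    apply Real.cos_pos_of_mem_Ioo
    constructor <;> linarith
  rw [Real.cos_sub_two_pi] at h3
  linarith

theorem exists_tr_eq_zero {ϑ φ : ℝ} (h1 : ϑ < 2 * π) (h2 : φ < 2 * π) (h : 3 * π < ϑ + φ) : ∃ p q : ℍ, tr (rotAbout p ϑ * rotAbout q φ) = 0 := by
  have hpi := Real.pi_pos
  have s1 : 0 < Real.sin (ϑ / 2) := Real.sin_pos_of_pos_of_lt_pi (by linarith) (by linarith)
  have s2 : 0 < Real.sin (φ / 2) := Real.sin_pos_of_pos_of_lt_pi (by linarith) (by linarith)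
  have hlt := sin_lt_cos h1 h2 h
  set k := Real.cos (ϑ / 2) * Real.cos (φ / 2) / (Real.sin (ϑ / 2) * Real.sin (φ / 2)) with hk
  have hk1 : 1 < k := by rw [hk, lt_div_iff₀ (mul_pos s1 s2)]; linarith
  -- The centres have to be at distance `arcosh k`, and `y` is the exponential of this distance.
  set y := k + √(k ^ 2 - 1) with hy
  have hsq : √(k ^ 2 - 1) ^ 2 = k ^ 2 - 1 := Real.sq_sqrt (by nlinarith)
  have hy0 : 0 < y := by
    have := Real.sqrt_nonneg (k ^ 2 - 1)
    linarith
  let q : ℍ := ⟨⟨0, y⟩, hy0⟩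
  have hq1 : q.re = 0 := rfl
  have hq2 : q.im = y := rfl
  refine ⟨UpperHalfPlane.I, q, ?_⟩
  have hchi : chi UpperHalfPlane.I q = k := by
    rw [chi_I q hq1, hq2, div_eq_iff (by positivity), hy]
    linear_combination hsq
  rw [tr_mul_rotAbout, hchi, hk]
  field_simp
  ring

theorem mul_self_of_tr_eq_zero {A : SL(2, ℝ)} (h : tr A = 0) : A * A = -1 := by
  have hd := det_eq A
  have h11 : A.1 1 1 = -A.1 0 0 := by rw [tr] at h; linarith
  obtain ⟨o1, o2, o3, o4⟩ := one_entries
  apply sl_ext <;> simp only [mul_entry, neg_entry, o1, o2, o3, o4, h11] <;> rw [h11] at hd <;>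
    linarith

theorem exists_isLift {α : Fin 4 → ℝ} {A B C D : SL(2, ℝ)} (hA : ∃ p, rotAbout p (α 0) = A)
    (hB : ∃ p, rotAbout p (α 1) = B) (hC : ∃ p, rotAbout p (α 2) = C)
    (hD : ∃ p, rotAbout p (α 3) = D) (h : A * B * C * D = -1) :
    ∃ σ P, IsLift α σ P ∧ trX σ = tr (A * B) ∧ trY σ = tr (B * C) ∧ trZ σ = tr (A * C) := by
  obtain ⟨p₀, hA⟩ := hA
  obtain ⟨p₁, hB⟩ := hB
  obtain ⟨p₂, hC⟩ := hC
  obtain ⟨p₃, hD⟩ := hD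
  have h1 : A * B * C * -D = 1 := by rw [mul_neg, h, neg_neg]
  have e (i : Fin 4) : ofQuad ![A, B, C, -D] h1 (c i) = ![A, B, C, -D] i := ofQuad_c _ _ _
  have e0 : ofQuad ![A, B, C, -D] h1 (c 0) = A := e 0
  have e1 : ofQuad ![A, B, C, -D] h1 (c 1) = B := e 1
  have e2 : ofQuad ![A, B, C, -D] h1 (c 2) = C := e 2
  have e3 : ofQuad ![A, B, C, -D] h1 (c 3) = -D := e 3
  refine ⟨ofQuad ![A, B, C, -D] h1, ![p₀, p₁, p₂, p₃], ⟨?_, ?_, ?_, ?_⟩, ?_, ?_, ?_⟩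
  · rw [e0]; exact hA.symm
  · rw [e1]; exact hB.symm
  · rw [e2]; exact hC.symm
  · rw [e3]; exact congrArg _ hD.symm
  · rw [trX, map_mul, e0, e1]
  · rw [trY, map_mul, e1, e2]
  · rw [trZ, map_mul, e0, e2]

theorem tr_neg_inv_sq (A : SL(2, ℝ)) : tr (-(A⁻¹ * A⁻¹)) = 2 - tr A ^ 2 := by
  rw [tr_neg, tr_sq, tr_inv]; ring

theorem exists_rotAbout_conj {A : SL(2, ℝ)} {ϑ : ℝ} (h : ∃ p, rotAbout p ϑ = A) (g : SL(2, ℝ)) :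
    ∃ p, rotAbout p ϑ = g * A * g⁻¹ := by
  obtain ⟨p, rfl⟩ := h
  exact ⟨g • p, (conj_rotAbout g p ϑ).symm⟩

/-- Both values of the remaining trace coordinate are attained. -/
theorem exists_points {α : Fin 4 → ℝ} (hα : Angles α) {m : Fin 3} (hp : Pat m α) :
    (∃ σ C, IsLift α σ C ∧ Zeros m σ ∧ freeTr m σ = rootFst m α) ∧
    (∃ σ C, IsLift α σ C ∧ Zeros m σ ∧ freeTr m σ = rootSnd m α) := by
  have u (i : Fin 4) := hα.upper i
  have hs := hα.sum
  -- The product of the seed rotations `U` and `V` is a half turn, so `(U V)² = -1`. Every quadruple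
  -- below consists of conjugates of `U` and `V`, with product `U V U V` or a conjugate of it.
  have main (j : Fin 4) (h0j : 3 * π < α 0 + α j) : ∃ U V : SL(2, ℝ), (∃ p, rotAbout p (α 0) = U) ∧
      (∃ p, rotAbout p (α j) = V) ∧ tr U = trc α 0 ∧ tr V = trc α j ∧ tr (U * V) = 0 ∧
      U * V * U * V = -1 ∧ tr (V * U) = 0 ∧ U * V * U = -V⁻¹ ∧ V * U * V = -U⁻¹ := by
    obtain ⟨p, q, h⟩ := exists_tr_eq_zero (u 0) (u j) h0j
    have h' := mul_self_of_tr_eq_zero h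
    rw [← mul_assoc] at h'
    refine ⟨_, _, ⟨p, rfl⟩, ⟨q, rfl⟩, tr_rotAbout _ _, tr_rotAbout _ _, h, h', ?_, ?_, ?_⟩
    · rw [tr_mul_comm, h]
    · rw [← mul_inv_eq_iff_eq_mul.mpr h'.symm, neg_mul, one_mul]
    · rw [← inv_mul_eq_iff_eq_mul.mpr (show rotAbout p (α 0) * (rotAbout q (α j) *
        rotAbout p (α 0) * rotAbout q (α j)) = -1 by rw [← h']; group).symm, mul_neg, mul_one]
  match m with
  | 0 =>
    obtain ⟨e1, e2⟩ := hp
    obtain ⟨U, V, hU, hV, tU, tV, h, hr, h', hUVU, hVUV⟩ := main 1 (by linarith)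
    constructor
    · obtain ⟨σ, P, hσ, x, y, z⟩ := exists_isLift (α := α) hU hV (e2 ▸ hV)
        (e1 ▸ exists_rotAbout_conj hU V⁻¹) (by rw [← hr]; group)
      refine ⟨σ, P, hσ, ⟨x.trans h, z.trans h⟩, y.trans ?_⟩
      rw [tr_sq, tV, rootFst]
    · obtain ⟨σ, P, hσ, x, y, z⟩ := exists_isLift (α := α) hU hV
        (e2 ▸ exists_rotAbout_conj hV U) (e1 ▸ hU) (by rw [← hr]; group)
      refine ⟨σ, P, hσ, ⟨x.trans h, z.trans ?_⟩, y.trans ?_⟩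
      · have e : U * (U * V * U⁻¹) = U * (U * V) * U⁻¹ := by group
        rw [e, tr_conj, h]
      · have e : V * (U * V * U⁻¹) = V * U * V * U⁻¹ := by group
        rw [e, hVUV, neg_mul, tr_neg_inv_sq, tU, rootSnd]
  | 1 =>
    obtain ⟨e1, e2⟩ := hp
    obtain ⟨U, V, hU, hV, tU, tV, h, hr, h', hUVU, hVUV⟩ := main 1 (by linarith)
    constructor
    · obtain ⟨σ, P, hσ, x, y, z⟩ := exists_isLift (α := α) hU hV (e2 ▸ hU) (e1 ▸ hV) hr
      refine ⟨σ, P, hσ, ⟨x.trans h, y.trans h'⟩, z.trans ?_⟩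
      rw [tr_sq, tU, rootFst]
    · obtain ⟨σ, P, hσ, x, y, z⟩ := exists_isLift (α := α) hU hV
        (e2 ▸ exists_rotAbout_conj hU V⁻¹) (e1 ▸ exists_rotAbout_conj hV U) (by
          have e : U * V * (V⁻¹ * U * V⁻¹⁻¹) * (U * V * U⁻¹) = U * (U * V * U * V) * U⁻¹ := by group
          rw [e, hr, mul_neg, mul_one, neg_mul, mul_inv_cancel])
      refine ⟨σ, P, hσ, ⟨x.trans h, y.trans ?_⟩, z.trans ?_⟩
      · have e : V * (V⁻¹ * U * V⁻¹⁻¹) = U * V := by group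
        rw [e, h]
      · have e : U * (V⁻¹ * U * V⁻¹⁻¹) = U * V⁻¹ * (U * V) := by group
        rw [e, tr_mul_comm]
        have e : U * V * (U * V⁻¹) = U * V * U * V⁻¹ := by group
        rw [e, hUVU, neg_mul, tr_neg_inv_sq, tV, rootSnd]
  | 2 =>
    obtain ⟨e1, e2⟩ := hp
    obtain ⟨U, V, hU, hV, tU, tV, h, hr, h', hUVU, hVUV⟩ := main 2 (by linarith)
    constructor
    · obtain ⟨σ, P, hσ, x, y, z⟩ := exists_isLift (α := α) hU (e2 ▸ hU)
        (exists_rotAbout_conj hV U⁻¹) (e1 ▸ hV) (by rw [← hr]; group)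
      have e : U * (U⁻¹ * V * U⁻¹⁻¹) = V * U := by group
      refine ⟨σ, P, hσ, ⟨y.trans (by rw [e, h']), z.trans (by rw [e, h'])⟩, x.trans ?_⟩
      rw [tr_sq, tU, rootFst]
    · obtain ⟨σ, P, hσ, x, y, z⟩ := exists_isLift (α := α) hU
        (e2 ▸ exists_rotAbout_conj hU V) hV (e1 ▸ hV) (by rw [← hr]; group)
      refine ⟨σ, P, hσ, ⟨y.trans ?_, z.trans h⟩, x.trans ?_⟩
      · rw [inv_mul_cancel_right, h']
      · have e : U * (V * U * V⁻¹) = U * V * U * V⁻¹ := by group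
        rw [e, hUVU, neg_mul, tr_neg_inv_sq, tV, rootSnd]

/-- Equal roots would mean that the squares of the two cosines sum to `1`, that is, equality in the
square of `sin_lt_cos`. -/
theorem rootFst_ne_rootSnd {α : Fin 4 → ℝ} (hα : Angles α) {m : Fin 3} (hp : Pat m α) :
    rootFst m α ≠ rootSnd m α := by
  have main {i j : Fin 4} (h : 3 * π < α i + α j) : trc α i ^ 2 - 2 ≠ 2 - trc α j ^ 2 := by
    have h1 := sin_lt_cos (hα.upper i) (hα.upper j) h
    have s1 := hα.sin_pos i
    have s2 := hα.sin_pos j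
    have k1 := Real.sin_sq_add_cos_sq (α i / 2)
    have k2 := Real.sin_sq_add_cos_sq (α j / 2)
    have h2 := pow_lt_pow_left₀ h1 (mul_pos s1 s2).le two_ne_zero
    intro h3
    rw [trc, trc] at h3
    rw [mul_pow, mul_pow] at h2
    rw [← eq_sub_iff_add_eq] at k1 k2
    rw [k1, k2] at h2
    linarith
  have hs := hα.sum
  match m with
  | 0 => exact main (by linarith [hp.1, hp.2])
  | 1 => exact main (by linarith [hp.1, hp.2])
  | 2 => exact main (by linarith [hp.1, hp.2])

theorem typeSet_subset_DT {α : Fin 4 → ℝ} (hα : Angles α) (m : Fin 3) : typeSet α m ⊆ DT α := by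
  rintro _ ⟨σ, C, hσ, rfl, -⟩
  exact (mem_DT_iff hα _).mpr ⟨σ, C, hσ, rfl⟩

/-- The two exceptional points. -/
theorem exists_typeSet_eq_pair {α : Fin 4 → ℝ} (hα : Angles α) {m : Fin 3} (hp : Pat m α) :
    ∃ P Q : Rep, P ≠ Q ∧ typeSet α m = {P, Q} ∧
      (∀ σ C, IsLift α σ C →
        ((⟦proj.comp σ⟧ : Rep) = P ↔ Zeros m σ ∧ freeTr m σ = rootFst m α)) ∧
      (∀ σ C, IsLift α σ C →
        ((⟦proj.comp σ⟧ : Rep) = Q ↔ Zeros m σ ∧ freeTr m σ = rootSnd m α)) := by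
  obtain ⟨⟨σ, C, hσ, z1, f1⟩, ⟨τ, D, hτ, z2, f2⟩⟩ := exists_points hα hp
  have key {σ τ : SphereGroup →* SL(2, ℝ)} {C D : Fin 4 → ℍ} (hσ : IsLift α σ C)
      (hτ : IsLift α τ D) (h : (⟦proj.comp τ⟧ : Rep) = ⟦proj.comp σ⟧) (z : Zeros m σ) :
      Zeros m τ ∧ freeTr m τ = freeTr m σ := by
    obtain ⟨hx, hy, hz⟩ := coords_of_class_eq hα hτ hσ h
    match m with
    | 0 => exact ⟨⟨hx.trans z.1, hz.trans z.2⟩, hy⟩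
    | 1 => exact ⟨⟨hx.trans z.1, hy.trans z.2⟩, hz⟩
    | 2 => exact ⟨⟨hy.trans z.1, hz.trans z.2⟩, hx⟩
  have iff1 (σ' C') (h' : IsLift α σ' C') : (⟦proj.comp σ'⟧ : Rep) = ⟦proj.comp σ⟧ ↔
      Zeros m σ' ∧ freeTr m σ' = rootFst m α :=
    ⟨fun h => f1 ▸ key hσ h' h z1, fun h => class_eq_of_freeTr_eq hα h' hσ h.1 z1 (h.2.trans f1.symm)⟩
  have iff2 (σ' C') (h' : IsLift α σ' C') : (⟦proj.comp σ'⟧ : Rep) = ⟦proj.comp τ⟧ ↔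
      Zeros m σ' ∧ freeTr m σ' = rootSnd m α :=
    ⟨fun h => f2 ▸ key hτ h' h z2, fun h => class_eq_of_freeTr_eq hα h' hτ h.1 z2 (h.2.trans f2.symm)⟩
  refine ⟨_, _, ?_, ?_, iff1, iff2⟩
  · intro h
    exact rootFst_ne_rootSnd hα hp (f1.symm.trans ((iff2 σ C hσ).mp h).2)
  · ext x
    constructor
    · rintro ⟨σ', C', h', rfl, hr⟩
      obtain ⟨-, z⟩ := (hasRole_iff hα h' m).mp hr
      rcases freeTr_eq h' hp z with h | h
      · exact Or.inl ((iff1 σ' C' h').mpr ⟨z, h⟩)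
      · exact Or.inr ((iff2 σ' C' h').mpr ⟨z, h⟩)
    · rintro (rfl | rfl)
      · exact ⟨σ, C, hσ, rfl, (hasRole_iff hα hσ m).mpr ⟨hp, z1⟩⟩
      · exact ⟨τ, D, hτ, rfl, (hasRole_iff hα hτ m).mpr ⟨hp, z2⟩⟩

/-- An invariant set of two points is an orbit as soon as something moves one of them, and one of
the two twists does. -/
theorem isTypeIIOrbit_typeSet {α : Fin 4 → ℝ} (hα : Angles α) {m : Fin 3} (hp : Pat m α) :
    IsTypeIIOrbit α (typeSet α m) := by
  obtain ⟨P, Q, hPQ, hset, -⟩ := exists_typeSet_eq_pair hα hp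
  refine ⟨typeSet_subset_DT hα m, ?_, by rw [hset, Set.ncard_pair hPQ]⟩
  have hP : P ∈ typeSet α m := by rw [hset]; exact Or.inl rfl
  have inv (φ : pureAut) : φ • P = P ∨ φ • P = Q := by
    have := smul_mem_typeSet φ hP
    rwa [hset] at this
  have hQ : ∃ φ : pureAut, φ • P = Q := by
    obtain ⟨σ, C, hσ, rfl, -⟩ := hP
    rcases inv twistFirst⁻¹ with h1 | h1
    · rcases inv twistMiddle⁻¹ with h2 | h2
      · exact (not_fixed_by_both hα hσ h1 h2).elim
      · exact ⟨_, h2⟩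
    · exact ⟨_, h1⟩
  refine ⟨P, ?_⟩
  rw [orbit_eq, hset]
  ext y
  constructor
  · rintro (rfl | rfl)
    · exact MulAction.mem_orbit_self _
    · obtain ⟨φ, hφ⟩ := hQ
      exact ⟨φ, hφ⟩
  · rintro ⟨φ, rfl⟩
    exact inv φ

/-- The orbits of length two are the sets of exceptional points. -/
theorem isTypeIIOrbit_iff {α : Fin 4 → ℝ} (hα : Angles α) (O : Set Rep) :
    IsTypeIIOrbit α O ↔ ∃ m, Pat m α ∧ O = typeSet α m := by
  constructor
  · intro hO
    obtain ⟨m, hp, hsub⟩ := exists_subset_typeSet hα hO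
    have hcard := (isTypeIIOrbit_typeSet hα hp).2.2
    refine ⟨m, hp, Set.eq_of_subset_of_ncard_le hsub ?_ ?_⟩
    · rw [hcard, hO.2.2]
    · exact Set.finite_of_ncard_ne_zero (by rw [hcard]; norm_num)
  · rintro ⟨m, hp, rfl⟩
    exact isTypeIIOrbit_typeSet hα hp

/-- If the sets for two different positions agreed, all three coordinates would vanish at both of
their points, which would then be equal. -/
theorem typeSet_injective {α : Fin 4 → ℝ} (hα : Angles α) {m n : Fin 3} (hmn : m ≠ n)
    (hm : Pat m α) : typeSet α m ≠ typeSet α n := by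
  intro h
  obtain ⟨P, Q, hPQ, hset, -⟩ := exists_typeSet_eq_pair hα hm
  have hP : P ∈ typeSet α m := by rw [hset]; exact Or.inl rfl
  have hQ : Q ∈ typeSet α m := by rw [hset]; exact Or.inr rfl
  have zero {x : Rep} (hx : x ∈ typeSet α m) : ∃ σ C, IsLift α σ C ∧ (⟦proj.comp σ⟧ : Rep) = x ∧
      trX σ = 0 ∧ trY σ = 0 ∧ trZ σ = 0 := by
    have hx' := hx
    rw [h] at hx'
    obtain ⟨σ, C, hσ, rfl, h1⟩ := hx
    obtain ⟨τ, D, hτ, h2, h3⟩ := hx'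
    obtain ⟨-, z1⟩ := (hasRole_iff hα hσ m).mp h1
    obtain ⟨-, z2⟩ := (hasRole_iff hα hτ n).mp h3
    obtain ⟨kx, ky, kz⟩ := coords_of_class_eq hα hτ hσ h2
    refine ⟨σ, C, hσ, rfl, ?_⟩
    match m, n with
    | 0, 0 => exact absurd rfl hmn
    | 0, 1 => exact ⟨z1.1, ky ▸ z2.2, z1.2⟩
    | 0, 2 => exact ⟨z1.1, ky ▸ z2.1, z1.2⟩
    | 1, 0 => exact ⟨z1.1, z1.2, kz ▸ z2.2⟩
    | 1, 1 => exact absurd rfl hmn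
    | 1, 2 => exact ⟨z1.1, z1.2, kz ▸ z2.2⟩
    | 2, 0 => exact ⟨kx ▸ z2.1, z1.1, z1.2⟩
    | 2, 1 => exact ⟨kx ▸ z2.1, z1.1, z1.2⟩
    | 2, 2 => exact absurd rfl hmn
  obtain ⟨σ, C, hσ, rfl, x1, y1, z1⟩ := zero hP
  obtain ⟨τ, D, hτ, rfl, x2, y2, z2⟩ := zero hQ
  exact hPQ (class_eq_of_coords hα hσ hτ (x1.trans x2.symm) (y1.trans y2.symm) (z1.trans z2.symm))

/-! ### Poles -/

theorem IsLift.trXYZ {α : Fin 4 → ℝ} {σ : SphereGroup →* SL(2, ℝ)} {C : Fin 4 → ℍ}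
    (h : IsLift α σ C) : trX σ = tr (rotAbout (C 0) (α 0) * rotAbout (C 1) (α 1)) ∧
      trY σ = tr (rotAbout (C 1) (α 1) * rotAbout (C 2) (α 2)) ∧
      trZ σ = tr (rotAbout (C 0) (α 0) * rotAbout (C 2) (α 2)) := by
  obtain ⟨h0, h1, h2, -⟩ := h
  simp only [trX, trY, trZ, map_mul, h0, h1, h2, and_self]

theorem proj_rotAbout_add_two_pi (p : ℍ) (ϑ : ℝ) :
    proj (rotAbout p (ϑ + 2 * π)) = proj (rotAbout p ϑ) := by
  rw [rotAbout_add_two_pi, proj_neg]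

theorem sin_eq_zero_of_proj_eq {p : ℍ} {ϑ φ : ℝ} (h : proj (rotAbout p ϑ) = proj (rotAbout p φ)) :
    Real.sin ((ϑ - φ) / 2) = 0 := by
  have hp := p.im_pos
  have key : proj (rotAbout p (ϑ - φ)) = proj 1 := by
    rw [sub_eq_add_neg, ← rotAbout_mul, ← rotAbout_inv, map_mul, map_inv, h, mul_inv_cancel, map_one]
  obtain ⟨-, -, e, -⟩ := rotAbout_entries p (ϑ - φ)
  obtain ⟨-, -, o, -⟩ := one_entries
  have h0 : (rotAbout p (ϑ - φ)).1 1 0 = 0 := by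
    rcases (proj_eq_iff _ _).mp key with h | h
    · rw [h, o]
    · rw [h, neg_entry, o, neg_zero]
  rw [h0] at e
  rcases mul_eq_zero.mp e.symm with h1 | h1
  · exact neg_eq_zero.mp h1
  · exact absurd h1 (by positivity)

theorem IsLift.center_eq {α : Fin 4 → ℝ} (hα : Angles α) {σ : SphereGroup →* SL(2, ℝ)}
    {C D : Fin 4 → ℍ} (hσ : IsLift α σ C)
    (h : ∀ i, IsRotationAbout (proj.comp σ (c i)) (D i) (α i)) : D = C := by
  funext i
  have h1 := (isRotationAbout_proj _ _ _).mp (h i)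
  rw [(isRotationAbout_proj _ _ _).mp (hσ.isRotationAbout i)] at h1
  rcases (proj_eq_iff _ _).mp h1 with h2 | h2
  · exact (center_injective (hα.sin_pos i) rfl h2).symm
  · exact absurd h2 (rotAbout_ne_neg (hα.sin_pos i) (hα.sin_pos i))

theorem IsLift.apply_b {α : Fin 4 → ℝ} {σ : SphereGroup →* SL(2, ℝ)} {C : Fin 4 → ℍ}
    (hσ : IsLift α σ C) : σ b = (rotAbout (C 0) (α 0) * rotAbout (C 1) (α 1))⁻¹ ∧
      σ b = -(rotAbout (C 2) (α 2) * rotAbout (C 3) (α 3)) := by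
  have h1 : σ b = (rotAbout (C 0) (α 0) * rotAbout (C 1) (α 1))⁻¹ := by
    rw [b, map_inv, map_mul, hσ.1, hσ.2.1]
  refine ⟨h1, ?_⟩
  rw [h1, inv_eq_iff_mul_eq_one, mul_neg, ← mul_assoc, hσ.prod, neg_neg]

/-- Chains of points of the component are chains of lifts. -/
theorem IsChain.exists_isLift {α : Fin 4 → ℝ} (hα : Angles α) {ρ : Representation}
    {C : Fin 4 → ℍ} {B : ℍ} {β : ℝ} (h : IsChain α ρ C B β) (hρ : ⟦ρ⟧ ∈ DT α) :
    ∃ σ, IsLift α σ C ∧ proj.comp σ = ρ ∧ proj (σ b) = proj (rotAbout B β) := by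
  obtain ⟨σ, D, hσ, rfl⟩ := exists_isLift_of_mem_DT hα hρ
  obtain rfl := hσ.center_eq hα h.1
  exact ⟨σ, hσ, rfl, (isRotationAbout_proj _ _ _).mp h.2.2.2⟩

theorem eq_of_tr_mul_eq {p q : ℍ} {ϑ : ℝ} (hs : Real.sin (ϑ / 2) ≠ 0)
    (h : tr (rotAbout p ϑ * rotAbout q ϑ) = (2 * Real.cos (ϑ / 2)) ^ 2 - 2) : p = q := by
  rw [tr_mul_rotAbout] at h
  have hsq := Real.sin_sq_add_cos_sq (ϑ / 2)
  rw [← chi_eq_one]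
  apply mul_left_cancel₀ (pow_ne_zero 2 hs)
  linear_combination (-1 / 2 : ℝ) * h - hsq

/-- When the centres coincide, `c 0 * c 1` is sent to a square. The identity for `tr (A A B)` with
the prescribed fourth trace then gives `Y = 0`, and `Z = Y`. Conversely, the root is the trace of a
square, which is attained only at distance zero. -/
theorem IsLift.south {α : Fin 4 → ℝ} {σ : SphereGroup →* SL(2, ℝ)} {C : Fin 4 → ℍ}
    (hα : Angles α) (hp : Pat 2 α) (hσ : IsLift α σ C) :
    Zeros 2 σ ∧ freeTr 2 σ = rootFst 2 α ↔ C 0 = C 1 := by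
  obtain ⟨t0, t1, t2, t3⟩ := hσ.traces
  obtain ⟨e1, e2⟩ := hp
  obtain ⟨x, y, z⟩ := hσ.trXYZ
  constructor
  · rintro ⟨-, h⟩
    refine eq_of_tr_mul_eq (hα.sin_pos 0).ne' ?_
    rw [freeTr, x, ← e2] at h
    exact h
  · intro h
    rw [h, e2] at x z
    have h1 := tr_sq_mul (rotAbout (C 1) (α 1)) (rotAbout (C 2) (α 2))
    have h2 : trW σ = tr (rotAbout (C 1) (α 1) * rotAbout (C 1) (α 1) * rotAbout (C 2) (α 2)) := by
      rw [trW, map_mul, map_mul, hσ.1, hσ.2.1, hσ.2.2.1, h, e2]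
    have e3 : trc α 3 = trc α 2 := by rw [trc, trc, e1]
    rw [← h2, t3, tr_rotAbout, tr_rotAbout, ← y, e3] at h1
    have hy : trc α 1 * trY σ = 0 := by
      change -trc α 2 = trc α 1 * trY σ - trc α 2 at h1
      linarith
    have y0 := (mul_eq_zero.mp hy).resolve_left (hα.trc_neg 1).ne
    refine ⟨⟨y0, z.trans (y.symm.trans y0)⟩, ?_⟩
    rw [freeTr, x, tr_sq, tr_rotAbout, rootFst, trc, e2]

theorem IsLift.north {α : Fin 4 → ℝ} {σ : SphereGroup →* SL(2, ℝ)} {C : Fin 4 → ℍ}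
    (hα : Angles α) (hp : Pat 2 α) (hσ : IsLift α σ C) :
    Zeros 2 σ ∧ freeTr 2 σ = rootSnd 2 α ↔ C 2 = C 3 := by
  obtain ⟨e1, e2⟩ := hp
  obtain ⟨x, y, z⟩ := hσ.trXYZ
  have hx : trX σ = -tr (rotAbout (C 2) (α 2) * rotAbout (C 3) (α 3)) := by
    rw [← tr_neg, ← hσ.apply_b.2, hσ.apply_b.1, tr_inv, x]
  constructor
  · rintro ⟨-, h⟩
    refine eq_of_tr_mul_eq (hα.sin_pos 2).ne' ?_
    rw [freeTr, hx, rootSnd, ← e1, trc] at h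
    linarith
  · intro h
    rw [← h, ← e1] at hx
    have hr := hσ.prod
    rw [← h, ← e1] at hr
    have h1 := tr_sq_mul (rotAbout (C 2) (α 2)) (rotAbout (C 1) (α 1))
    have h2 := tr_sq_mul (rotAbout (C 2) (α 2)) (rotAbout (C 0) (α 0))
    rw [tr_mul_comm _ (rotAbout (C 1) (α 1)), tr_mul_comm _ (rotAbout (C 1) (α 1)), ← y] at h1
    rw [tr_mul_comm (rotAbout (C 2) (α 2)) (rotAbout (C 0) (α 0)), ← z] at h2
    have k1 : rotAbout (C 1) (α 1) * (rotAbout (C 2) (α 2) * rotAbout (C 2) (α 2)) =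
        -(rotAbout (C 0) (α 0))⁻¹ := by
      rw [← inv_mul_eq_iff_eq_mul.mpr (show rotAbout (C 0) (α 0) * (rotAbout (C 1) (α 1) *
        (rotAbout (C 2) (α 2) * rotAbout (C 2) (α 2))) = -1 by rw [← hr]; group).symm, mul_neg,
        mul_one]
    have k2 : rotAbout (C 2) (α 2) * rotAbout (C 2) (α 2) * rotAbout (C 0) (α 0) =
        -(rotAbout (C 1) (α 1))⁻¹ := by
      have e := cycle_neg_one (cycle_neg_one hr)
      rw [mul_assoc, mul_assoc, ← mul_assoc (rotAbout (C 2) (α 2)), ← mul_assoc] at e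
      rw [← mul_inv_eq_iff_eq_mul.mpr e.symm, neg_mul, one_mul]
    rw [k1, tr_neg, tr_inv, tr_rotAbout, tr_rotAbout, tr_rotAbout, e2] at h1
    rw [k2, tr_neg, tr_inv, tr_rotAbout, tr_rotAbout, tr_rotAbout, e2] at h2
    have hn := hα.cos_neg 2
    have y0 : 2 * Real.cos (α 2 / 2) * trY σ = 0 := by linarith
    have z0 : 2 * Real.cos (α 2 / 2) * trZ σ = 0 := by linarith
    refine ⟨⟨(mul_eq_zero.mp y0).resolve_left (by linarith),
      (mul_eq_zero.mp z0).resolve_left (by linarith)⟩, ?_⟩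
    rw [freeTr, hx, tr_sq, tr_rotAbout, rootSnd, trc]
    ring

theorem isSouthPole_iff {α : Fin 4 → ℝ} (hα : Angles α) {σ : SphereGroup →* SL(2, ℝ)}
    {C : Fin 4 → ℍ} (hσ : IsLift α σ C) :
    IsSouthPole α ⟦proj.comp σ⟧ ↔ C 0 = C 1 := by
  have l (i : Fin 4) := hα.lower i
  have u (i : Fin 4) := hα.upper i
  have hs := hα.sum
  have hpi := Real.pi_pos
  constructor
  · rintro ⟨ρ, D, B, h, hD, hsing⟩
    obtain ⟨τ, hτ, rfl, hb⟩ := hD.exists_isLift hα (by rw [h]; exact (mem_DT_iff hα _).mpr ⟨σ, C, hσ, rfl⟩)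
    rcases hsing with ⟨h0, h1⟩ | ⟨h2, h3⟩
    · obtain ⟨g, rfl⟩ := hτ.exists_conj hα hσ h
      obtain rfl := (hτ.conj g).center_eq hα hσ.isRotationAbout
      change g • D 0 = g • D 1
      rw [h0, h1]
    · rw [hτ.apply_b.2, proj_neg, h2, h3, rotAbout_mul] at hb
      -- If the second triangle were the degenerate one, `b` would have angle `α₃ + α₄`. This
      -- differs from `4π - α₁ - α₂` by an amount strictly between `2π` and `4π`.
      have h4 := sin_eq_zero_of_proj_eq hb
      have h5 : 0 < Real.sin ((α 2 + α 3 - (4 * π - α 0 - α 1)) / 2 - π) := by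
        apply Real.sin_pos_of_pos_of_lt_pi <;> linarith [u 0, u 1, u 2, u 3]
      rw [Real.sin_sub_pi, h4, neg_zero] at h5
      exact absurd h5 (lt_irrefl 0)
  · intro h
    refine ⟨_, C, C 0, rfl, ⟨hσ.isRotationAbout, by linarith [u 0, u 1], by linarith [l 0, l 1], ?_⟩,
      Or.inl ⟨rfl, h.symm⟩⟩
    rw [isRotationAbout_proj, MonoidHom.comp_apply, hσ.apply_b.1, ← h, rotAbout_mul, rotAbout_inv,
      ← proj_rotAbout_add_two_pi, ← proj_rotAbout_add_two_pi]
    congr 2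
    ring

theorem isNorthPole_iff {α : Fin 4 → ℝ} (hα : Angles α) {σ : SphereGroup →* SL(2, ℝ)}
    {C : Fin 4 → ℍ} (hσ : IsLift α σ C) :
    IsNorthPole α ⟦proj.comp σ⟧ ↔ C 2 = C 3 := by
  have l (i : Fin 4) := hα.lower i
  have u (i : Fin 4) := hα.upper i
  have hs := hα.sum
  have hpi := Real.pi_pos
  constructor
  · rintro ⟨ρ, D, B, h, hD, hsing⟩
    obtain ⟨τ, hτ, rfl, hb⟩ := hD.exists_isLift hα (by rw [h]; exact (mem_DT_iff hα _).mpr ⟨σ, C, hσ, rfl⟩)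
    rcases hsing with ⟨h0, h1⟩ | ⟨h2, h3⟩
    · rw [hτ.apply_b.1, h0, h1, rotAbout_mul, rotAbout_inv] at hb
      have h4 := sin_eq_zero_of_proj_eq hb.symm
      have h5 : 0 < Real.sin ((α 2 + α 3 - 2 * π - -(α 0 + α 1)) / 2 - 2 * π) := by
        apply Real.sin_pos_of_pos_of_lt_pi <;> linarith [u 0, u 1, u 2, u 3]
      rw [Real.sin_sub_two_pi, h4] at h5
      exact absurd h5 (lt_irrefl 0)
    · obtain ⟨g, rfl⟩ := hτ.exists_conj hα hσ h
      obtain rfl := (hτ.conj g).center_eq hα hσ.isRotationAbout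
      change g • D 2 = g • D 3
      rw [h2, h3]
  · intro h
    refine ⟨_, C, C 2, rfl, ⟨hσ.isRotationAbout, by linarith [l 2, l 3], by linarith [u 2, u 3], ?_⟩,
      Or.inr ⟨rfl, h.symm⟩⟩
    rw [isRotationAbout_proj, MonoidHom.comp_apply, hσ.apply_b.2, ← h, rotAbout_mul, proj_neg,
      ← proj_rotAbout_add_two_pi _ (α 2 + α 3 - 2 * π), sub_add_cancel]

theorem consistsOfPoles_typeSet {α : Fin 4 → ℝ} (hα : Angles α) (hp : Pat 2 α) :
    ConsistsOfPoles α (α 2 + α 3 - 2 * π) (4 * π - α 0 - α 1) (typeSet α 2) := by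
  obtain ⟨P, Q, hPQ, hset, hP, hQ⟩ := exists_typeSet_eq_pair hα hp
  have south : ∀ x ∈ DT α, IsSouthPole α x ↔ x = P := by
    intro x hx
    obtain ⟨ρ, rfl⟩ := Quotient.exists_rep x
    obtain ⟨σ, C, hσ, rfl⟩ := exists_isLift_of_mem_DT hα hx
    rw [isSouthPole_iff hα hσ, ← hσ.south hα hp, ← hP σ C hσ]
  have north : ∀ x ∈ DT α, IsNorthPole α x ↔ x = Q := by
    intro x hx
    obtain ⟨ρ, rfl⟩ := Quotient.exists_rep x
    obtain ⟨σ, C, hσ, rfl⟩ := exists_isLift_of_mem_DT hα hx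
    rw [isNorthPole_iff hα hσ, ← hσ.north hα hp, ← hQ σ C hσ]
  have hsub := typeSet_subset_DT hα 2
  rw [hset] at hsub
  refine ⟨Q, P, hPQ.symm, hset.trans (Set.pair_comm P Q), north, south, ?_, ?_⟩
  · obtain ⟨ρ, C, B, h, hc, -⟩ := (north Q (hsub (Or.inr rfl))).mpr rfl
    exact ⟨ρ, C, B, h, hc⟩
  · obtain ⟨ρ, C, B, h, hc, -⟩ := (south P (hsub (Or.inl rfl))).mpr rfl
    exact ⟨ρ, C, B, h, hc⟩

/-! ### Angles -/

/-- A positive multiple of `disc B X`. -/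
noncomputable def direction (B X : ℍ) : ℂ :=
  ⟨((X.re - B.re) ^ 2 + X.im ^ 2 - B.im ^ 2) / (2 * X.im * B.im), (B.re - X.re) / X.im⟩

theorem disc_eq (B X : ℍ) : ∃ r : ℝ, 0 < r ∧ disc B X = r • direction B X := by
  have hB := B.im_pos
  have hX := X.im_pos
  have hN : 0 < (X.re - B.re) ^ 2 + (X.im + B.im) ^ 2 := by positivity
  obtain ⟨r, hr, h⟩ : ∃ r : ℝ, 0 < r ∧
      r = 2 * X.im * B.im / ((X.re - B.re) ^ 2 + (X.im + B.im) ^ 2) := ⟨_, by positivity, rfl⟩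
  refine ⟨r, hr, ?_⟩
  have hne : (X : ℂ) - (starRingEnd ℂ) (B : ℂ) ≠ 0 := by
    intro h
    have := congrArg Complex.im h
    simp at this
    linarith
  rw [disc, div_eq_iff hne]
  apply Complex.ext
  · simp [direction]
    rw [h]
    field_simp
    ring
  · simp [direction]
    rw [h]
    field_simp
    ring

/-- The length is the hyperbolic sine of the distance, so the inner and exterior products of
directions below are the laws of cosines and sines without denominators. -/
theorem normSq_direction (B X : ℍ) : Complex.normSq (direction B X) = chi B X ^ 2 - 1 := by
  have hB := B.im_pos
  have hX := X.im_pos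
  rw [Complex.normSq_apply, direction, chi]
  field_simp
  ring

theorem norm_direction (B X : ℍ) : ‖direction B X‖ = √(chi B X ^ 2 - 1) := by
  rw [Complex.norm_def, normSq_direction]

theorem re_direction (B X Y : ℍ) :
    (direction B X).re * (direction B Y).re + (direction B X).im * (direction B Y).im =
      chi B X * chi B Y - chi X Y := by
  have hB := B.im_pos
  have hX := X.im_pos
  have hY := Y.im_pos
  simp only [direction, chi]
  field_simp
  ring

theorem im_direction (B X Y : ℍ) :
    (direction B X).re * (direction B Y).im - (direction B X).im * (direction B Y).re =
      trip B X Y / 2 := by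
  have hB := B.im_pos
  have hX := X.im_pos
  have hY := Y.im_pos
  obtain ⟨e1, e2, e3, e4⟩ := rotAbout_entries B π
  obtain ⟨f1, f2, f3, f4⟩ := rotAbout_entries X π
  obtain ⟨g1, g2, g3, g4⟩ := rotAbout_entries Y π
  simp only [trip, tr, mul_entry, e1, e2, e3, e4, f1, f2, f3, f4, g1, g2, g3, g4,
    Real.cos_pi_div_two, Real.sin_pi_div_two, direction]
  field_simp
  ring

theorem direction_ne_zero {B X : ℍ} (h : X ≠ B) : direction B X ≠ 0 := by
  rw [← norm_pos_iff, norm_direction]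
  apply Real.sqrt_pos.mpr
  have h1 : 1 < chi B X := lt_of_le_of_ne (one_le_chi B X) (fun h0 => h (chi_eq_one.mp h0.symm).symm)
  nlinarith

theorem orientedAngle_eq {X B : ℍ} (Y : ℍ) (hX : X ≠ B) :
    orientedAngle X B Y = (Complex.arg (direction B Y * (starRingEnd ℂ) (direction B X)) : Real.Angle) := by
  obtain ⟨r, hr, h1⟩ := disc_eq B X
  obtain ⟨s, hs, h2⟩ := disc_eq B Y
  have hne := direction_ne_zero hX
  have e : disc B Y / disc B X = ((s / (r * Complex.normSq (direction B X)) : ℝ) : ℂ) *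
      (direction B Y * (starRingEnd ℂ) (direction B X)) := by
    rw [h1, h2, Complex.real_smul, Complex.real_smul, mul_div_mul_comm, div_eq_mul_inv (direction B Y),
      Complex.inv_def]
    push_cast
    field_simp
  rw [orientedAngle, e, Complex.arg_real_mul _
    (div_pos hs (mul_pos hr (Complex.normSq_pos.mpr hne)))]

/-- The law of cosines and its orientation-sensitive counterpart. -/
theorem cos_sin_orientedAngle {X B : ℍ} (Y : ℍ) (hX : X ≠ B) :
    √(chi B X ^ 2 - 1) * √(chi B Y ^ 2 - 1) * (orientedAngle X B Y).cos =
      chi B X * chi B Y - chi X Y ∧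
    √(chi B X ^ 2 - 1) * √(chi B Y ^ 2 - 1) * (orientedAngle X B Y).sin = trip B X Y / 2 := by
  set w := direction B Y * (starRingEnd ℂ) (direction B X) with hw
  have hn : √(chi B X ^ 2 - 1) * √(chi B Y ^ 2 - 1) = ‖w‖ := by
    rw [hw, norm_mul, RCLike.norm_conj, norm_direction, norm_direction, mul_comm]
  rw [hn, orientedAngle_eq Y hX, Real.Angle.cos_coe, Real.Angle.sin_coe, Complex.norm_mul_cos_arg,
    Complex.norm_mul_sin_arg, ← re_direction, ← im_direction, hw]
  constructor
  · simp; ring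
  · simp; ring

theorem cos_interiorAngle (X B Y : ℍ) :
    Real.cos (interiorAngle X B Y) =
      (chi B X * chi B Y - chi X Y) / (√(chi B X ^ 2 - 1) * √(chi B Y ^ 2 - 1)) := by
  obtain ⟨r, hr, h1⟩ := disc_eq B X
  obtain ⟨s, hs, h2⟩ := disc_eq B Y
  rw [interiorAngle, h1, h2, InnerProductGeometry.angle_smul_left_of_pos _ _ hr,
    InnerProductGeometry.angle_smul_right_of_pos _ _ hs, InnerProductGeometry.cos_angle,
    norm_direction, norm_direction, ← re_direction]
  congr 1
  rw [Complex.inner]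
  simp; ring

/-! ### Chains whose action is `π` -/

theorem angle_ext {γ δ : Real.Angle} (h1 : γ.cos = δ.cos) (h2 : γ.sin = δ.sin) : γ = δ := by
  induction γ using Real.Angle.induction_on
  induction δ using Real.Angle.induction_on
  exact Real.Angle.cos_sin_inj h1 h2

/-- Each relation such as `b c₁ = c₂⁻¹` is an equality of traces between a product with the half
turn and a single rotation, and it gives one distance to `B`. -/
theorem IsLift.half_turn {α : Fin 4 → ℝ} (hα : Angles α) {σ : SphereGroup →* SL(2, ℝ)}
    {C : Fin 4 → ℍ} (hσ : IsLift α σ C) {B : ℍ} (hb : proj (σ b) = proj (rotAbout B π)) :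
    σ b = rotAbout B π ∧
    Real.sin (α 0 / 2) * chi B (C 0) = -Real.cos (α 1 / 2) ∧
    Real.sin (α 1 / 2) * chi B (C 1) = -Real.cos (α 0 / 2) ∧
    Real.sin (α 2 / 2) * chi B (C 2) = -Real.cos (α 3 / 2) ∧
    Real.sin (α 3 / 2) * chi B (C 3) = -Real.cos (α 2 / 2) := by
  obtain ⟨b1, b2⟩ := hσ.apply_b
  have htr (p : ℍ) (ϑ : ℝ) :
      tr (rotAbout B π * rotAbout p ϑ) = -2 * (Real.sin (ϑ / 2) * chi B p) := by
    rw [tr_mul_rotAbout, Real.cos_pi_div_two, Real.sin_pi_div_two]; ring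
  -- With the other sign one side would have a positive trace, while all canonical traces are
  -- negative.
  have e : σ b = rotAbout B π := by
    refine ((proj_eq_iff _ _).mp hb).resolve_right fun h => ?_
    have h1 : (rotAbout (C 1) (α 1) * -rotAbout B π) = (rotAbout (C 0) (α 0))⁻¹ := by
      rw [← h, b1, mul_inv_rev, mul_inv_cancel_left]
    have h2 := congrArg tr h1
    rw [tr_mul_comm, neg_mul, tr_neg, htr, tr_inv, tr_rotAbout] at h2
    have h3 := mul_pos (hα.sin_pos 1) (lt_of_lt_of_le one_pos (one_le_chi B (C 1)))
    linarith [hα.cos_neg 0]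
  have hR : (rotAbout B π) * (rotAbout B π) = -1 :=
    mul_self_of_tr_eq_zero (by rw [tr_rotAbout, Real.cos_pi_div_two, mul_zero])
  rw [e] at b1 b2
  have k0 : rotAbout B π * rotAbout (C 0) (α 0) = (rotAbout (C 1) (α 1))⁻¹ := by
    rw [b1, mul_inv_rev, inv_mul_cancel_right]
  have k1 : rotAbout (C 1) (α 1) * rotAbout B π = (rotAbout (C 0) (α 0))⁻¹ := by
    rw [b1, mul_inv_rev, mul_inv_cancel_left]
  have b3 : rotAbout B π = (rotAbout (C 2) (α 2) * rotAbout (C 3) (α 3))⁻¹ := by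
    rw [eq_inv_iff_mul_eq_one, ← neg_eq_iff_eq_neg.mpr b2, mul_neg, hR, neg_neg]
  have k2 : rotAbout B π * rotAbout (C 2) (α 2) = (rotAbout (C 3) (α 3))⁻¹ := by
    rw [b3, mul_inv_rev, inv_mul_cancel_right]
  have k3 : rotAbout (C 3) (α 3) * rotAbout B π = (rotAbout (C 2) (α 2))⁻¹ := by
    rw [b3, mul_inv_rev, mul_inv_cancel_left]
  have t0 := congrArg tr k0
  have t1 := congrArg tr k1
  have t2 := congrArg tr k2
  have t3 := congrArg tr k3
  rw [htr, tr_inv, tr_rotAbout] at t0 t2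
  rw [tr_mul_comm, htr, tr_inv, tr_rotAbout] at t1 t3
  exact ⟨e, by linarith, by linarith, by linarith, by linarith⟩

theorem ne_of_mul_chi_eq {p q : ℍ} {s k : ℝ} (h : s * chi p q = -k) (hk : s ^ 2 < k ^ 2) :
    p ≠ q := by
  intro h0
  rw [chi_eq_one.mpr h0, mul_one] at h
  rw [h, neg_sq] at hk
  exact lt_irrefl _ hk

theorem mul_sqrt_chi {p q : ℍ} {s k K : ℝ} (hs : 0 < s) (h : s * chi p q = -k)
    (hk : k ^ 2 - s ^ 2 = K) : s * √(chi p q ^ 2 - 1) = √K := by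
  rw [← hk, ← neg_sq k, ← h, mul_pow, ← mul_sub_one, Real.sqrt_mul (sq_nonneg s), Real.sqrt_sq hs.le]

/-- The cosine of the angle at `B` gives the distance of `C 1` and `C 2`, hence `Y`. The sine gives
the mixed product with `B`, and this enters `Z` once the first rotation is written through `B` and
`C 1`. -/
theorem IsLift.coords_of_half_turn {α : Fin 4 → ℝ} (hα : Angles α) {σ : SphereGroup →* SL(2, ℝ)}
    {C : Fin 4 → ℍ} (hσ : IsLift α σ C) {B : ℍ} (hb : proj (σ b) = proj (rotAbout B π))
    {K : ℝ} (hK : 0 < K) (h1 : Real.cos (α 0 / 2) ^ 2 - Real.sin (α 1 / 2) ^ 2 = K)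
    (h2 : Real.cos (α 3 / 2) ^ 2 - Real.sin (α 2 / 2) ^ 2 = K) :
    trX σ = 0 ∧
    trY σ = 2 * (Real.cos (α 1 / 2) * Real.cos (α 2 / 2) - Real.cos (α 0 / 2) * Real.cos (α 3 / 2))
      + 2 * K * (orientedAngle (C 2) B (C 1)).cos ∧
    trZ σ = 2 * (Real.cos (α 0 / 2) * Real.cos (α 2 / 2) - Real.cos (α 1 / 2) * Real.cos (α 3 / 2))
      - 2 * K * (orientedAngle (C 2) B (C 1)).sin := by
  obtain ⟨e, -, k1, k2, -⟩ := hσ.half_turn hα hb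
  obtain ⟨x, y, z⟩ := hσ.trXYZ
  have b1 := hσ.apply_b.1
  rw [e] at b1
  have hne : C 2 ≠ B := (ne_of_mul_chi_eq k2 (by linarith)).symm
  obtain ⟨g1, g2⟩ := cos_sin_orientedAngle (C 1) hne
  have r1 := mul_sqrt_chi (hα.sin_pos 1) k1 h1
  have r2 := mul_sqrt_chi (hα.sin_pos 2) k2 h2
  have rK : √K * √K = K := Real.mul_self_sqrt hK.le
  have rr : Real.sin (α 1 / 2) * Real.sin (α 2 / 2) *
      (√(chi B (C 2) ^ 2 - 1) * √(chi B (C 1) ^ 2 - 1)) = K := by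
    rw [← rK]
    nth_rewrite 1 [← r1]
    rw [← r2]
    ring
  have hanti : trip B (C 1) (C 2) = -trip B (C 2) (C 1) := by
    have i1 := im_direction B (C 1) (C 2)
    have i2 := im_direction B (C 2) (C 1)
    linarith
  have hA0 : rotAbout (C 0) (α 0) = rotAbout B (-π) * rotAbout (C 1) (-α 1) := by
    rw [← rotAbout_inv, ← rotAbout_inv, b1]; group
  refine ⟨?_, ?_, ?_⟩
  · rw [x, ← tr_inv, ← b1, tr_rotAbout, Real.cos_pi_div_two, mul_zero]
  · rw [y, tr_mul_rotAbout, chi_comm (C 1)]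
    have p12 : Real.sin (α 1 / 2) * chi B (C 1) * (Real.sin (α 2 / 2) * chi B (C 2)) =
      Real.cos (α 0 / 2) * Real.cos (α 3 / 2) := by rw [k1, k2]; ring
    linear_combination -2 * (Real.sin (α 1 / 2) * Real.sin (α 2 / 2)) * g1 +
      2 * (orientedAngle (C 2) B (C 1)).cos * rr - 2 * p12
  · have e1 : -π / 2 = -(π / 2) := by ring
    have e2 : -α 1 / 2 = -(α 1 / 2) := by ring
    rw [z, hA0, tr_mul_mul_rotAbout, e1, e2, Real.cos_neg, Real.sin_neg, Real.cos_neg, Real.sin_neg,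
      Real.cos_pi_div_two, Real.sin_pi_div_two, hanti]
    linear_combination 2 * (Real.sin (α 1 / 2) * Real.sin (α 2 / 2)) * g2 -
      2 * (orientedAngle (C 2) B (C 1)).sin * rr - 2 * Real.cos (α 2 / 2) * k1
      + 2 * Real.cos (α 1 / 2) * k2

theorem mul_ne_mul_of_sq {s t k l : ℝ} (h1 : s ^ 2 < k ^ 2) (h2 : t ^ 2 < l ^ 2) :
    k * l ≠ s * t := by
  intro h
  have := mul_lt_mul'' h1 h2 (sq_nonneg s) (sq_nonneg t)
  rw [← mul_pow, ← mul_pow, h] at this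
  exact lt_irrefl _ this

/-- The patterns for which the exceptional points have action `π`. -/
theorem cos_sq_sub_sin_sq {α : Fin 4 → ℝ} (hα : Angles α) (hp : Pat 0 α ∨ Pat 1 α) : ∃ K : ℝ,
    K = Real.cos (α 0 / 2) ^ 2 + Real.cos (α 1 / 2) ^ 2 - 1 ∧ 0 < K ∧
    Real.cos (α 0 / 2) ^ 2 - Real.sin (α 1 / 2) ^ 2 = K ∧
    Real.cos (α 1 / 2) ^ 2 - Real.sin (α 0 / 2) ^ 2 = K ∧
    Real.cos (α 3 / 2) ^ 2 - Real.sin (α 2 / 2) ^ 2 = K ∧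
    Real.cos (α 2 / 2) ^ 2 - Real.sin (α 3 / 2) ^ 2 = K := by
  have hs := hα.sum
  have q (i : Fin 4) := Real.sin_sq_add_cos_sq (α i / 2)
  have h01 : 3 * π < α 0 + α 1 := by
    rcases hp with ⟨e1, e2⟩ | ⟨e1, e2⟩ <;> linarith
  have h2 := pow_lt_pow_left₀ (sin_lt_cos (hα.upper 0) (hα.upper 1) h01)
    (mul_pos (hα.sin_pos 0) (hα.sin_pos 1)).le two_ne_zero
  have q0 := q 0
  have q1 := q 1
  have hpos : 0 < Real.cos (α 0 / 2) ^ 2 + Real.cos (α 1 / 2) ^ 2 - 1 := by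
    rw [mul_pow, mul_pow, ← sub_eq_iff_eq_add.mpr q0.symm] at h2
    rw [← eq_sub_iff_add_eq] at q0 q1
    rw [q1] at h2
    nlinarith
  refine ⟨_, rfl, hpos, by linarith, by linarith, ?_, ?_⟩ <;>
    rcases hp with ⟨e1, e2⟩ | ⟨e1, e2⟩ <;> rw [← e1, ← e2] <;> linarith

/-- Conversely, `X = 0` makes `b` a half turn and provides `B`. The other two equations recover the
cosine and sine of the angle because their common coefficient is positive. -/
theorem hasActionAngle_iff {α : Fin 4 → ℝ} (hα : Angles α) (hp : Pat 0 α ∨ Pat 1 α)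
    {σ : SphereGroup →* SL(2, ℝ)} {C : Fin 4 → ℍ} (hσ : IsLift α σ C) (γ : Real.Angle) :
    HasActionAngle α ⟦proj.comp σ⟧ π γ ↔ trX σ = 0 ∧
    trY σ = 2 * (Real.cos (α 1 / 2) * Real.cos (α 2 / 2) - Real.cos (α 0 / 2) * Real.cos (α 3 / 2))
      + 2 * (Real.cos (α 0 / 2) ^ 2 + Real.cos (α 1 / 2) ^ 2 - 1) * γ.cos ∧
    trZ σ = 2 * (Real.cos (α 0 / 2) * Real.cos (α 2 / 2) - Real.cos (α 1 / 2) * Real.cos (α 3 / 2))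
      - 2 * (Real.cos (α 0 / 2) ^ 2 + Real.cos (α 1 / 2) ^ 2 - 1) * γ.sin := by
  obtain ⟨K, hKdef, hK, h01, h10, h32, h23⟩ := cos_sq_sub_sin_sq hα hp
  rw [← hKdef]
  constructor
  · rintro ⟨ρ, D, B, h, hD, -, rfl⟩
    obtain ⟨τ, hτ, rfl, hb⟩ := hD.exists_isLift hα (by rw [h]; exact (mem_DT_iff hα _).mpr ⟨σ, C, hσ, rfl⟩)
    obtain ⟨x, y, z⟩ := coords_of_class_eq hα hτ hσ h
    rw [← x, ← y, ← z]
    exact hτ.coords_of_half_turn hα hb hK h01 h32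
  · rintro ⟨x, y, z⟩
    obtain ⟨b1, b2⟩ := hσ.apply_b
    obtain ⟨tx, -, -⟩ := hσ.trXYZ
    obtain ⟨B, hB⟩ : ∃ B, proj (σ b) = proj (rotAbout B π) := by
      obtain ⟨B, hB | hB⟩ := exists_rotAbout_of_tr_eq_zero (σ b) (by rw [b1, tr_inv, ← tx, x])
      · exact ⟨B, by rw [hB]⟩
      · exact ⟨B, by rw [hB, proj_neg]⟩
    obtain ⟨-, k0, k1, k2, k3⟩ := hσ.half_turn hα hB
    obtain ⟨-, y', z'⟩ := hσ.coords_of_half_turn hα hB hK h01 h32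
    -- Coinciding centres would turn `X = 0` into an equality of the products of cosines and of
    -- sines, excluded by `cos_sq_sub_sin_sq`.
    have n01 : C 0 ≠ C 1 := by
      intro h
      rw [x, tr_mul_rotAbout, chi_eq_one.mpr h] at tx
      exact mul_ne_mul_of_sq (s := Real.sin (α 1 / 2)) (t := Real.sin (α 0 / 2))
        (by linarith) (by linarith) (show Real.cos (α 0 / 2) * Real.cos (α 1 / 2) = _ by linarith)
    have n23 : C 2 ≠ C 3 := by
      intro h
      have hx : tr (σ b) = 0 := by rw [b1, tr_inv, ← tx, x]
      rw [b2, tr_neg, tr_mul_rotAbout, chi_eq_one.mpr h] at hx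
      exact mul_ne_mul_of_sq (s := Real.sin (α 3 / 2)) (t := Real.sin (α 2 / 2))
        (by linarith) (by linarith) (show Real.cos (α 2 / 2) * Real.cos (α 3 / 2) = _ by linarith)
    refine ⟨_, C, B, rfl, ⟨hσ.isRotationAbout, Real.pi_pos, by linarith [Real.pi_pos],
      (isRotationAbout_proj _ _ _).mpr hB⟩, ⟨⟨n01, (ne_of_mul_chi_eq k1 (by linarith)).symm,
      ne_of_mul_chi_eq k0 (by linarith)⟩, ne_of_mul_chi_eq k2 (by linarith), n23,
      (ne_of_mul_chi_eq k3 (by linarith)).symm⟩, ?_⟩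
    apply angle_ext
    · apply mul_left_cancel₀ (mul_pos two_pos hK).ne'
      linarith
    · apply mul_left_cancel₀ (mul_pos two_pos hK).ne'
      linarith

theorem consistsOfRegular_typeSet_one {α : Fin 4 → ℝ} (hα : Angles α) (hp : Pat 1 α) :
    ConsistsOfRegular α π ((π / 2 : ℝ) : Real.Angle) ((3 * π / 2 : ℝ) : Real.Angle)
      (typeSet α 1) := by
  obtain ⟨P, Q, hPQ, hset, hP, hQ⟩ := exists_typeSet_eq_pair hα hp
  have e : 3 * π / 2 = π / 2 + π := by ring
  -- The order is reversed because at `γ = π/2` the remaining coordinate is `2 - trc α 1 ^ 2`, the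
  -- second root.
  refine ⟨Q, P, hPQ.symm, hset.trans (Set.pair_comm P Q), ?_, ?_⟩
  · intro x hx
    obtain ⟨ρ, rfl⟩ := Quotient.exists_rep x
    obtain ⟨σ, C, hσ, rfl⟩ := exists_isLift_of_mem_DT hα hx
    rw [hasActionAngle_iff hα (Or.inr hp) hσ, hQ σ C hσ, Zeros, freeTr, rootSnd, trc, and_assoc,
      Real.Angle.cos_coe, Real.Angle.sin_coe, Real.cos_pi_div_two, Real.sin_pi_div_two, ← hp.1, ← hp.2]
    ring_nf
  · intro x hx
    obtain ⟨ρ, rfl⟩ := Quotient.exists_rep x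
    obtain ⟨σ, C, hσ, rfl⟩ := exists_isLift_of_mem_DT hα hx
    rw [hasActionAngle_iff hα (Or.inr hp) hσ, hP σ C hσ, Zeros, freeTr, rootFst, trc, and_assoc, e,
      Real.Angle.cos_coe, Real.Angle.sin_coe, Real.cos_add_pi, Real.sin_add_pi,
      Real.cos_pi_div_two, Real.sin_pi_div_two, ← hp.1, ← hp.2]
    ring_nf

theorem consistsOfRegular_typeSet_zero {α : Fin 4 → ℝ} (hα : Angles α) (hp : Pat 0 α) :
    ConsistsOfRegular α π ((0 : ℝ) : Real.Angle) ((π : ℝ) : Real.Angle) (typeSet α 0) := by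
  obtain ⟨P, Q, hPQ, hset, hP, hQ⟩ := exists_typeSet_eq_pair hα hp
  refine ⟨P, Q, hPQ, hset, ?_, ?_⟩
  · intro x hx
    obtain ⟨ρ, rfl⟩ := Quotient.exists_rep x
    obtain ⟨σ, C, hσ, rfl⟩ := exists_isLift_of_mem_DT hα hx
    rw [hasActionAngle_iff hα (Or.inl hp) hσ, hP σ C hσ, Zeros, freeTr, rootFst, trc, and_assoc,
      Real.Angle.cos_coe, Real.Angle.sin_coe, Real.cos_zero, Real.sin_zero, ← hp.1, ← hp.2,
      and_comm (a := trZ σ = 0)]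
    ring_nf
  · intro x hx
    obtain ⟨ρ, rfl⟩ := Quotient.exists_rep x
    obtain ⟨σ, C, hσ, rfl⟩ := exists_isLift_of_mem_DT hα hx
    rw [hasActionAngle_iff hα (Or.inl hp) hσ, hQ σ C hσ, Zeros, freeTr, rootSnd, trc, and_assoc,
      Real.Angle.cos_coe, Real.Angle.sin_coe, Real.cos_pi, Real.sin_pi, ← hp.1, ← hp.2,
      and_comm (a := trZ σ = 0)]
    ring_nf

/-! ### Images -/

theorem interiorAngle_eq_of_cos {X B Y : ℍ} {t : ℝ} (h0 : 0 ≤ t) (h1 : t ≤ π)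
    (h : Real.cos (interiorAngle X B Y) = Real.cos t) : interiorAngle X B Y = t :=
  Real.injOn_cos ⟨InnerProductGeometry.angle_nonneg _ _, InnerProductGeometry.angle_le_pi _ _⟩
    ⟨h0, h1⟩ h

/-- The group generated by two rotations whose product is a half-turn. -/
theorem isRotationTriangleGroup_closure {p q : ℍ} {ϑ φ : ℝ} (h1 : ϑ < 2 * π) (h2 : φ < 2 * π)
    (h : 3 * π < ϑ + φ)
    (htr : tr (rotAbout p ϑ * rotAbout q φ) = 0) :
    IsRotationTriangleGroup 2 (1 - ϑ / (2 * π))⁻¹ (1 - φ / (2 * π))⁻¹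
      (Subgroup.closure {proj (rotAbout p ϑ), proj (rotAbout q φ)}) := by
  have hpi := Real.pi_pos
  have s1 : 0 < Real.sin (ϑ / 2) := Real.sin_pos_of_pos_of_lt_pi (by linarith) (by linarith)
  have s2 : 0 < Real.sin (φ / 2) := Real.sin_pos_of_pos_of_lt_pi (by linarith) (by linarith)
  have n1 : Real.cos (ϑ / 2) < 0 := Real.cos_neg_of_pi_div_two_lt_of_lt (by linarith) (by linarith)
  have hlt := sin_lt_cos h1 h2 h
  have hsq := pow_lt_pow_left₀ hlt (mul_pos s1 s2).le two_ne_zero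
  have q1 := Real.sin_sq_add_cos_sq (ϑ / 2)
  have q2 := Real.sin_sq_add_cos_sq (φ / 2)
  have hsV (P : ℍ) : tr (rotAbout P π * (rotAbout q φ)⁻¹) =
      2 * (Real.sin (φ / 2) * chi P q) := by
    have e : -φ / 2 = -(φ / 2) := by ring
    rw [rotAbout_inv, tr_mul_rotAbout, e, Real.sin_neg, Real.cos_pi_div_two, Real.sin_pi_div_two]
    ring
  have hsU (P : ℍ) : tr (rotAbout P π * (rotAbout p ϑ)⁻¹) =
      2 * (Real.sin (ϑ / 2) * chi P p) := by
    have e : -ϑ / 2 = -(ϑ / 2) := by ring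
    rw [rotAbout_inv, tr_mul_rotAbout, e, Real.sin_neg, Real.cos_pi_div_two, Real.sin_pi_div_two]
    ring
  obtain ⟨P, hP⟩ : ∃ P, rotAbout p ϑ * rotAbout q φ = -rotAbout P π := by
    obtain ⟨P, hP | hP⟩ := exists_rotAbout_of_tr_eq_zero _ htr
    · exfalso
      have h3 := hsV P
      rw [← hP, mul_inv_cancel_right, tr_rotAbout] at h3
      have := mul_pos s2 (lt_of_lt_of_le one_pos (one_le_chi P q))
      linarith
    · exact ⟨P, hP⟩
  have hP' : rotAbout P π = -(rotAbout p ϑ * rotAbout q φ) := by rw [hP, neg_neg]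
  have kR : Real.sin (φ / 2) * chi P q = -Real.cos (ϑ / 2) := by
    have h3 := hsV P
    rw [hP', neg_mul, mul_inv_cancel_right, tr_neg, tr_rotAbout] at h3
    linarith
  have kQ : Real.sin (ϑ / 2) * chi P p = -Real.cos (φ / 2) := by
    have h3 := hsU P
    rw [hP', neg_mul, tr_neg, tr_conj, tr_rotAbout] at h3
    linarith
  have kQR : Real.sin (ϑ / 2) * Real.sin (φ / 2) * chi p q = Real.cos (ϑ / 2) * Real.cos (φ / 2) := by
    rw [tr_mul_rotAbout] at htr
    linarith
  obtain ⟨K, hK⟩ : ∃ K, K = Real.cos (ϑ / 2) ^ 2 + Real.cos (φ / 2) ^ 2 - 1 := ⟨_, rfl⟩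
  have hK1 : Real.cos (ϑ / 2) ^ 2 - Real.sin (φ / 2) ^ 2 = K := by linarith
  have hK2 : Real.cos (φ / 2) ^ 2 - Real.sin (ϑ / 2) ^ 2 = K := by linarith
  have hK3 : (-(Real.cos (ϑ / 2) * Real.cos (φ / 2))) ^ 2 -
      (Real.sin (ϑ / 2) * Real.sin (φ / 2)) ^ 2 = K := by
    rw [hK]
    linear_combination (-Real.sin (φ / 2) ^ 2) * q1 - (1 - Real.cos (ϑ / 2) ^ 2) * q2
  have hK0 : 0 < K := by rw [← hK3, neg_sq]; linarith
  have rR := mul_sqrt_chi s2 kR hK1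
  have rQ := mul_sqrt_chi s1 kQ hK2
  have rQR := mul_sqrt_chi (mul_pos s1 s2) (kQR.trans (neg_neg _).symm) hK3
  have hsK := Real.sqrt_pos.mpr hK0
  have rK : √K * √K = K := Real.mul_self_sqrt hK0.le
  have posR : 0 < √(chi P q ^ 2 - 1) := pos_of_mul_pos_right (rR ▸ hsK) s2.le
  have posQ : 0 < √(chi P p ^ 2 - 1) := pos_of_mul_pos_right (rQ ▸ hsK) s1.le
  have posQR : 0 < √(chi p q ^ 2 - 1) := pos_of_mul_pos_right (rQR ▸ hsK) (mul_pos s1 s2).le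
  -- The interior angles are `π - t / 2`, so the generators turn by `2π - t`: they are the inverses
  -- of the given rotations.
  have ang (t : ℝ) : π / (1 - t / (2 * π))⁻¹ = π - t / 2 := by
    rw [div_inv_eq_mul]; field_simp
  have ang' (t : ℝ) : 2 * π / (1 - t / (2 * π))⁻¹ = -t + 2 * π := by
    rw [div_inv_eq_mul]; field_simp; ring
  refine ⟨P, p, q, ne_of_mul_chi_eq kQ (by linarith),
    ne_of_mul_chi_eq (kQR.trans (neg_neg _).symm) (by linarith),
    (ne_of_mul_chi_eq kR (by linarith)).symm, ?_, ?_, ?_,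
    proj (rotAbout P π), (proj (rotAbout p ϑ))⁻¹, (proj (rotAbout q φ))⁻¹, ?_, ?_, ?_, ?_⟩
  · apply interiorAngle_eq_of_cos (by linarith) (by linarith)
    rw [cos_interiorAngle, Real.cos_pi_div_two, div_eq_zero_iff]
    left
    apply mul_left_cancel₀ (mul_pos s1 s2).ne'
    linear_combination Real.sin (φ / 2) * chi P q * kQ - Real.cos (φ / 2) * kR - kQR
  · rw [ang]
    apply interiorAngle_eq_of_cos (by linarith) (by linarith)
    rw [cos_interiorAngle, Real.cos_pi_sub, chi_comm p P, chi_comm q P,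
      div_eq_iff (mul_pos posQR posQ).ne']
    apply mul_left_cancel₀ (mul_pos (mul_pos s1 s1) s2).ne'
    have e : Real.sin (ϑ / 2) * Real.sin (ϑ / 2) * Real.sin (φ / 2) *
        (√(chi p q ^ 2 - 1) * √(chi P p ^ 2 - 1)) = K := by
      rw [← rK]
      nth_rewrite 1 [← rQR]
      rw [← rQ]
      ring
    linear_combination Real.cos (ϑ / 2) * e + Real.sin (ϑ / 2) * chi P p * kQR +
      Real.cos (ϑ / 2) * Real.cos (φ / 2) * kQ - Real.sin (ϑ / 2) ^ 2 * kR - Real.cos (ϑ / 2) * hK2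
  · rw [ang]
    apply interiorAngle_eq_of_cos (by linarith) (by linarith)
    rw [cos_interiorAngle, Real.cos_pi_sub, chi_comm q P, chi_comm q p,
      div_eq_iff (mul_pos posR posQR).ne']
    apply mul_left_cancel₀ (mul_pos (mul_pos s1 s2) s2).ne'
    have e : Real.sin (ϑ / 2) * Real.sin (φ / 2) * Real.sin (φ / 2) *
        (√(chi P q ^ 2 - 1) * √(chi p q ^ 2 - 1)) = K := by
      rw [← rK]
      nth_rewrite 1 [← rQR]
      rw [← rR]
      ring
    linear_combination Real.cos (φ / 2) * e + Real.sin (φ / 2) * chi P q * kQR +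
      Real.cos (ϑ / 2) * Real.cos (φ / 2) * kR - Real.sin (φ / 2) ^ 2 * kQ - Real.cos (φ / 2) * hK1
  · rw [isRotationAbout_proj]
    congr 2
    ring
  · rw [isRotationAbout_proj, ang', proj_rotAbout_add_two_pi, ← map_inv, rotAbout_inv]
  · rw [isRotationAbout_proj, ang', proj_rotAbout_add_two_pi, ← map_inv, rotAbout_inv]
  · rw [hP', proj_neg, map_mul]
    apply le_antisymm
    · rw [Subgroup.closure_le]
      rintro x (rfl | rfl)
      · exact (Subgroup.inv_mem_iff _).mp (Subgroup.subset_closure (by simp))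
      · exact (Subgroup.inv_mem_iff _).mp (Subgroup.subset_closure (by simp))
    · rw [Subgroup.closure_le]
      have i1 : proj (rotAbout p ϑ) ∈ Subgroup.closure {proj (rotAbout p ϑ), proj (rotAbout q φ)} :=
        Subgroup.subset_closure (by simp)
      have i2 : proj (rotAbout q φ) ∈ Subgroup.closure {proj (rotAbout p ϑ), proj (rotAbout q φ)} :=
        Subgroup.subset_closure (by simp)
      rintro x (rfl | rfl | rfl)
      · exact mul_mem i1 i2
      · exact inv_mem i1
      · exact inv_mem i2

theorem range_le {G : Type*} [Group G] {f : SphereGroup →* G} {H : Subgroup G}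
    (h0 : f (c 0) ∈ H) (h1 : f (c 1) ∈ H) (h2 : f (c 2) ∈ H) : f.range ≤ H := by
  have h3 : f (c 3) ∈ H := by
    rw [c_three, map_inv, map_mul, map_mul]
    exact inv_mem (mul_mem (mul_mem h0 h1) h2)
  rw [MonoidHom.range_eq_map, ← PresentedGroup.closure_range_of, Subgroup.map_le_iff_le_comap,
    Subgroup.closure_le]
  rintro _ ⟨i, rfl⟩
  match i with
  | 0 => exact h0
  | 1 => exact h1
  | 2 => exact h2
  | 3 => exact h3

theorem range_eq_closure {G : Type*} [Group G] {f : SphereGroup →* G} (i j : Fin 4)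
    (h0 : f (c 0) ∈ Subgroup.closure {f (c i), f (c j)})
    (h1 : f (c 1) ∈ Subgroup.closure {f (c i), f (c j)})
    (h2 : f (c 2) ∈ Subgroup.closure {f (c i), f (c j)}) :
    f.range = Subgroup.closure {f (c i), f (c j)} := by
  apply le_antisymm (range_le h0 h1 h2)
  rw [Subgroup.closure_le]
  rintro _ (rfl | rfl) <;> exact ⟨_, rfl⟩

/-- The puncture that is not paired with the first one. -/
def other (m : Fin 3) : Fin 4 :=
  match m with
  | 0 => 1
  | 1 => 1
  | 2 => 2

/-- At each root two generators of equal angle have the same image, possibly after conjugation by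
another one. With the relation, two generators then suffice. -/
theorem range_eq_of_mem_typeSet {α : Fin 4 → ℝ} (hα : Angles α) {m : Fin 3} (hp : Pat m α)
    {σ : SphereGroup →* SL(2, ℝ)} {C : Fin 4 → ℍ} (hσ : IsLift α σ C) (hz : Zeros m σ) :
    (proj.comp σ).range =
      Subgroup.closure {proj.comp σ (c 0), proj.comp σ (c (other m))} := by
  set f := proj.comp σ with hf
  have f0 : f (c 0) = proj (rotAbout (C 0) (α 0)) := by rw [hf, MonoidHom.comp_apply, hσ.1]
  have f1 : f (c 1) = proj (rotAbout (C 1) (α 1)) := by rw [hf, MonoidHom.comp_apply, hσ.2.1]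
  have f2 : f (c 2) = proj (rotAbout (C 2) (α 2)) := by rw [hf, MonoidHom.comp_apply, hσ.2.2.1]
  have f3 : f (c 3) = proj (rotAbout (C 3) (α 3)) := by
    rw [hf, MonoidHom.comp_apply, hσ.2.2.2, proj_neg]
  have rel : f (c 0) * f (c 1) * f (c 2) * f (c 3) = 1 := by
    rw [← map_mul, ← map_mul, ← map_mul, c_rel, map_one]
  obtain ⟨x, y, z⟩ := hσ.trXYZ
  have i0 (j : Fin 4) : f (c 0) ∈ Subgroup.closure {f (c 0), f (c j)} :=
    Subgroup.subset_closure (Or.inl rfl)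
  have ij (j : Fin 4) : f (c j) ∈ Subgroup.closure {f (c 0), f (c j)} :=
    Subgroup.subset_closure (Or.inr rfl)
  have key := freeTr_eq hσ hp hz
  match m with
  | 0 =>
    apply range_eq_closure _ _ (i0 _) (ij _)
    rcases key with h | h
    · rw [freeTr, y, rootFst, ← hp.2] at h
      rw [f2, ← eq_of_tr_mul_eq (hα.sin_pos 1).ne' h, ← hp.2, ← f1]
      exact ij 1
    · have h' : tr (rotAbout (C 3) (α 0) * rotAbout (C 0) (α 0)) =
          (2 * Real.cos (α 0 / 2)) ^ 2 - 2 := by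
        have e := cycle_neg_one (cycle_neg_one (cycle_neg_one hσ.prod))
        rw [mul_assoc] at e
        have e' : (rotAbout (C 3) (α 3) * rotAbout (C 0) (α 0))⁻¹ =
            -(rotAbout (C 1) (α 1) * rotAbout (C 2) (α 2)) := by
          rw [inv_eq_iff_mul_eq_one, mul_neg, e, neg_neg]
        rw [← hp.1] at e'
        rw [← tr_inv, e', tr_neg, ← y]
        rw [freeTr, rootSnd, trc] at h
        linarith
      have e1 : f (c 3) = f (c 0) := by
        rw [f3, eq_of_tr_mul_eq (hα.sin_pos 0).ne' h', ← hp.1, ← f0]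
      have e2 : f (c 2) = (f (c 0) * f (c 1))⁻¹ * (f (c 3))⁻¹ := by
        rw [eq_inv_mul_iff_mul_eq, eq_inv_iff_mul_eq_one, rel]
      rw [e2, e1]
      exact mul_mem (inv_mem (mul_mem (i0 1) (ij 1))) (inv_mem (i0 1))
  | 1 =>
    apply range_eq_closure _ _ (i0 _) (ij _)
    rcases key with h | h
    · rw [freeTr, z, rootFst, ← hp.2] at h
      rw [f2, ← eq_of_tr_mul_eq (hα.sin_pos 0).ne' h, ← hp.2, ← f0]
      exact i0 1
    · have h' : tr (rotAbout (C 1) (α 1) * rotAbout (rotAbout (C 2) (α 2) • C 3) (α 1)) =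
          (2 * Real.cos (α 1 / 2)) ^ 2 - 2 := by
        have e : (rotAbout (C 2) (α 2) * rotAbout (C 0) (α 0))⁻¹ = -(rotAbout (C 1) (α 1) *
            (rotAbout (C 2) (α 2) * rotAbout (C 3) (α 3) * (rotAbout (C 2) (α 2))⁻¹)) := by
          have e1 : rotAbout (C 2) (α 2) * rotAbout (C 0) (α 0) * (rotAbout (C 1) (α 1) *
              (rotAbout (C 2) (α 2) * rotAbout (C 3) (α 3) * (rotAbout (C 2) (α 2))⁻¹)) =
              rotAbout (C 2) (α 2) * (rotAbout (C 0) (α 0) * rotAbout (C 1) (α 1) *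
                rotAbout (C 2) (α 2) * rotAbout (C 3) (α 3)) * (rotAbout (C 2) (α 2))⁻¹ := by
            group
          rw [inv_eq_iff_mul_eq_one, mul_neg, e1, hσ.prod, mul_neg, mul_one, neg_mul,
            mul_inv_cancel, neg_neg]
        have e2 := congrArg tr e
        rw [tr_neg, tr_inv, tr_mul_comm, ← z, conj_rotAbout, ← hp.1] at e2
        rw [freeTr, rootSnd, trc] at h
        linarith
      have e1 : f (c 1) = f (c 2) * f (c 3) * (f (c 2))⁻¹ := by
        rw [f1, eq_of_tr_mul_eq (hα.sin_pos 1).ne' h', hp.1, ← conj_rotAbout, map_mul, map_mul,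
          map_inv, ← f2, ← f3]
      have e2 : f (c 2) = (f (c 0) * f (c 1) * f (c 1))⁻¹ := by
        rw [eq_comm, inv_eq_iff_mul_eq_one, ← rel]
        nth_rewrite 2 [e1]
        group
      rw [e2]
      exact inv_mem (mul_mem (mul_mem (i0 1) (ij 1)) (ij 1))
  | 2 =>
    refine range_eq_closure _ _ (i0 _) ?_ (ij _)
    change f (c 1) ∈ Subgroup.closure {f (c 0), f (c 2)}
    rcases key with h | h
    · rw [f1, ← (hσ.south hα hp).mp ⟨hz, h⟩, ← hp.2, ← f0]
      exact i0 2
    · have e : f (c 1) = (f (c 0))⁻¹ * (f (c 2) * f (c 3))⁻¹ := by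
        rw [eq_inv_mul_iff_mul_eq, eq_inv_iff_mul_eq_one, ← mul_assoc, rel]
      have e' : f (c 3) = f (c 2) := by
        rw [f3, ← (hσ.north hα hp).mp ⟨hz, h⟩, ← hp.1, ← f2]
      rw [e, e']
      exact mul_mem (inv_mem (i0 2)) (inv_mem (mul_mem (ij 2) (ij 2)))

/-- The image of an exceptional point is a rotation triangle group. -/
theorem isRotationTriangleGroup_range {α : Fin 4 → ℝ} (hα : Angles α) {m : Fin 3} (hp : Pat m α)
    {ρ : Representation} (hρ : ⟦ρ⟧ ∈ typeSet α m) : IsRotationTriangleGroup 2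
      (1 - α 0 / (2 * π))⁻¹ (1 - α (other m) / (2 * π))⁻¹ ρ.range := by
  obtain ⟨σ, C, hσ, rfl⟩ := exists_isLift_of_mem_DT hα (typeSet_subset_DT hα m hρ)
  obtain ⟨P, Q, -, hset, hP, hQ⟩ := exists_typeSet_eq_pair hα hp
  rw [hset] at hρ
  have hz : Zeros m σ := by
    rcases hρ with h | h
    · exact ((hP σ C hσ).mp h).1
    · exact ((hQ σ C hσ).mp h).1
  rw [range_eq_of_mem_typeSet hα hp hσ hz, MonoidHom.comp_apply, MonoidHom.comp_apply, hσ.1]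
  obtain ⟨x, y, z⟩ := hσ.trXYZ
  have hs := hα.sum
  match m with
  | 0 =>
    obtain ⟨e1, e2⟩ := hp
    rw [other, hσ.2.1]
    exact isRotationTriangleGroup_closure (hα.upper 0) (hα.upper 1) (by linarith)
      (x.symm.trans hz.1)
  | 1 =>
    obtain ⟨e1, e2⟩ := hp
    rw [other, hσ.2.1]
    exact isRotationTriangleGroup_closure (hα.upper 0) (hα.upper 1) (by linarith)
      (x.symm.trans hz.1)
  | 2 =>
    obtain ⟨e1, e2⟩ := hp
    rw [other, hσ.2.2.1]
    exact isRotationTriangleGroup_closure (hα.upper 0) (hα.upper 2) (by linarith)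
      (z.symm.trans hz.2)

/-! ### The three orderings of the angles -/

theorem angles_of {t u v w : ℝ} (ht : π < t) (ht' : t < 2 * π) (hu : π < u) (hu' : u < 2 * π)
    (hv : π < v) (hv' : v < 2 * π) (hw : π < w) (hw' : w < 2 * π) (h : 6 * π < t + u + v + w) :
    Angles ![t, u, v, w] where
  lower i := by
    match i with
    | 0 => exact ht
    | 1 => exact hu
    | 2 => exact hv
    | 3 => exact hw
  upper i := by
    match i with
    | 0 => exact ht'
    | 1 => exact hu'
    | 2 => exact hv'
    | 3 => exact hw'
  sum := h

theorem existsUnique_isTypeIIOrbit {α : Fin 4 → ℝ} (hα : Angles α) {m : Fin 3} (hp : Pat m α)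
    (h : ∀ n, Pat n α → n = m) : ∃! O, IsTypeIIOrbit α O := by
  refine ⟨typeSet α m, isTypeIIOrbit_typeSet hα hp, fun O hO => ?_⟩
  obtain ⟨n, hn, rfl⟩ := (isTypeIIOrbit_iff hα O).mp hO
  rw [h n hn]

end TypeII

theorem mainTheorem1 (θ₁ θ₂ : ℝ) (h₁ : 0 < θ₁ ∧ θ₁ < 2 * π) (h₂ : 0 < θ₂ ∧ θ₂ < 2 * π)
    (h : 3 * π < θ₁ + θ₂) :
    -- the orbits of the table
    (∃ O, TypeII.IsTypeIIOrbit ![θ₁, θ₁, θ₂, θ₂] O ∧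
      TypeII.ConsistsOfPoles ![θ₁, θ₁, θ₂, θ₂] (2 * θ₂ - 2 * π) (4 * π - 2 * θ₁) O) ∧
    (∃ O, TypeII.IsTypeIIOrbit ![θ₁, θ₂, θ₁, θ₂] O ∧
      TypeII.ConsistsOfRegular ![θ₁, θ₂, θ₁, θ₂] π
        ((π / 2 : ℝ) : Real.Angle) ((3 * π / 2 : ℝ) : Real.Angle) O) ∧
    (∃ O, TypeII.IsTypeIIOrbit ![θ₁, θ₂, θ₂, θ₁] O ∧
      TypeII.ConsistsOfRegular ![θ₁, θ₂, θ₂, θ₁] π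
        ((0 : ℝ) : Real.Angle) ((π : ℝ) : Real.Angle) O) ∧
    -- uniqueness when the two angles differ
    (θ₁ ≠ θ₂ →
      (∃! O, TypeII.IsTypeIIOrbit ![θ₁, θ₁, θ₂, θ₂] O) ∧
      (∃! O, TypeII.IsTypeIIOrbit ![θ₁, θ₂, θ₁, θ₂] O) ∧
      (∃! O, TypeII.IsTypeIIOrbit ![θ₁, θ₂, θ₂, θ₁] O)) ∧
    -- when the two angles agree, the orbits are exactly the three of the table
    (θ₁ = θ₂ → ∃ O₁ O₂ O₃ : Set TypeII.Rep,
      O₁ ≠ O₂ ∧ O₂ ≠ O₃ ∧ O₃ ≠ O₁ ∧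
      TypeII.ConsistsOfPoles ![θ₁, θ₁, θ₁, θ₁] (2 * θ₁ - 2 * π) (4 * π - 2 * θ₁) O₁ ∧
      TypeII.ConsistsOfRegular ![θ₁, θ₁, θ₁, θ₁] π
        ((π / 2 : ℝ) : Real.Angle) ((3 * π / 2 : ℝ) : Real.Angle) O₂ ∧
      TypeII.ConsistsOfRegular ![θ₁, θ₁, θ₁, θ₁] π
        ((0 : ℝ) : Real.Angle) ((π : ℝ) : Real.Angle) O₃ ∧
      ∀ O, TypeII.IsTypeIIOrbit ![θ₁, θ₁, θ₁, θ₁] O ↔ O = O₁ ∨ O = O₂ ∨ O = O₃) ∧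
    -- the images of the representations
    (∀ α : Fin 4 → ℝ,
      α = ![θ₁, θ₁, θ₂, θ₂] ∨ α = ![θ₁, θ₂, θ₁, θ₂] ∨ α = ![θ₁, θ₂, θ₂, θ₁] →
      ∀ O, TypeII.IsTypeIIOrbit α O → ∀ ρ : TypeII.Representation, ⟦ρ⟧ ∈ O →
        TypeII.IsRotationTriangleGroup 2 (1 - θ₁ / (2 * π))⁻¹ (1 - θ₂ / (2 * π))⁻¹
          ρ.range) := by
  have hpi := Real.pi_pos
  -- Each angle exceeds `π` because the sum exceeds `3π` and the other angle is less than `2π`.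
  have A2 : TypeII.Angles ![θ₁, θ₁, θ₂, θ₂] := TypeII.angles_of (by linarith) h₁.2 (by linarith)
    h₁.2 (by linarith) h₂.2 (by linarith) h₂.2 (by linarith)
  have A1 : TypeII.Angles ![θ₁, θ₂, θ₁, θ₂] := TypeII.angles_of (by linarith) h₁.2 (by linarith)
    h₂.2 (by linarith) h₁.2 (by linarith) h₂.2 (by linarith)
  have A0 : TypeII.Angles ![θ₁, θ₂, θ₂, θ₁] := TypeII.angles_of (by linarith) h₁.2 (by linarith)
    h₂.2 (by linarith) h₂.2 (by linarith) h₁.2 (by linarith)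
  have p2 : TypeII.Pat 2 ![θ₁, θ₁, θ₂, θ₂] := ⟨rfl, rfl⟩
  have p1 : TypeII.Pat 1 ![θ₁, θ₂, θ₁, θ₂] := ⟨rfl, rfl⟩
  have p0 : TypeII.Pat 0 ![θ₁, θ₂, θ₂, θ₁] := ⟨rfl, rfl⟩
  have poles : TypeII.ConsistsOfPoles ![θ₁, θ₁, θ₂, θ₂] (2 * θ₂ - 2 * π) (4 * π - 2 * θ₁)
      (TypeII.typeSet ![θ₁, θ₁, θ₂, θ₂] 2) := by
    have e := TypeII.consistsOfPoles_typeSet A2 p2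
    change TypeII.ConsistsOfPoles _ (θ₂ + θ₂ - 2 * π) (4 * π - θ₁ - θ₁) _ at e
    have e1 : θ₂ + θ₂ - 2 * π = 2 * θ₂ - 2 * π := by ring
    have e2 : 4 * π - θ₁ - θ₁ = 4 * π - 2 * θ₁ := by ring
    rwa [e1, e2] at e
  have uniq (hne : θ₁ ≠ θ₂) : (∀ n, TypeII.Pat n ![θ₁, θ₁, θ₂, θ₂] → n = 2) ∧
      (∀ n, TypeII.Pat n ![θ₁, θ₂, θ₁, θ₂] → n = 1) ∧
      (∀ n, TypeII.Pat n ![θ₁, θ₂, θ₂, θ₁] → n = 0) := by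
    refine ⟨fun n hn => ?_, fun n hn => ?_, fun n hn => ?_⟩
    · match n with
      | 0 => exact absurd hn.1 hne
      | 1 => exact absurd hn.1 hne
      | 2 => rfl
    · match n with
      | 0 => exact absurd hn.1 hne
      | 1 => rfl
      | 2 => exact absurd hn.2 hne
    · match n with
      | 0 => rfl
      | 1 => exact absurd hn.2 hne
      | 2 => exact absurd hn.2 hne
  refine ⟨⟨_, TypeII.isTypeIIOrbit_typeSet A2 p2, poles⟩,
    ⟨_, TypeII.isTypeIIOrbit_typeSet A1 p1, TypeII.consistsOfRegular_typeSet_one A1 p1⟩,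
    ⟨_, TypeII.isTypeIIOrbit_typeSet A0 p0, TypeII.consistsOfRegular_typeSet_zero A0 p0⟩,
    fun hne => ⟨TypeII.existsUnique_isTypeIIOrbit A2 p2 (uniq hne).1,
      TypeII.existsUnique_isTypeIIOrbit A1 p1 (uniq hne).2.1,
      TypeII.existsUnique_isTypeIIOrbit A0 p0 (uniq hne).2.2⟩, ?_, ?_⟩
  -- With equal angles the three orderings are the same tuple, so all three patterns hold for it at
  -- once.
  · rintro rfl
    refine ⟨_, _, _, TypeII.typeSet_injective A2 (by decide) p2,
      TypeII.typeSet_injective A2 (by decide) p1, TypeII.typeSet_injective A2 (by decide) p0,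
      poles, TypeII.consistsOfRegular_typeSet_one A1 p1,
      TypeII.consistsOfRegular_typeSet_zero A0 p0, fun O => ?_⟩
    rw [TypeII.isTypeIIOrbit_iff A2]
    constructor
    · rintro ⟨m, -, rfl⟩
      match m with
      | 0 => exact Or.inr (Or.inr rfl)
      | 1 => exact Or.inr (Or.inl rfl)
      | 2 => exact Or.inl rfl
    · rintro (rfl | rfl | rfl)
      · exact ⟨2, p2, rfl⟩
      · exact ⟨1, p1, rfl⟩
      · exact ⟨0, p0, rfl⟩
  · have image {α : Fin 4 → ℝ} (hα : TypeII.Angles α) (h0 : α 0 = θ₁)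
        (hj : ∀ m, TypeII.Pat m α → α (TypeII.other m) = θ₂) (O : Set TypeII.Rep)
        (hO : TypeII.IsTypeIIOrbit α O) (ρ : TypeII.Representation) (hρ : ⟦ρ⟧ ∈ O) :
        TypeII.IsRotationTriangleGroup 2 (1 - θ₁ / (2 * π))⁻¹ (1 - θ₂ / (2 * π))⁻¹ ρ.range := by
      obtain ⟨m, hp, rfl⟩ := (TypeII.isTypeIIOrbit_iff hα O).mp hO
      have e := TypeII.isRotationTriangleGroup_range hα hp hρ
      rwa [h0, hj m hp] at e
    rintro α (rfl | rfl | rfl)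
    · refine image A2 rfl fun m hm => ?_
      match m with
      | 0 => exact hm.1
      | 1 => exact hm.1
      | 2 => rfl
    · refine image A1 rfl fun m hm => ?_
      match m with
      | 0 => rfl
      | 1 => rfl
      | 2 => exact hm.1
    · refine image A0 rfl fun m hm => ?_
      match m with
      | 0 => rfl
      | 1 => rfl
      | 2 => rfl
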